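/- **Theorem (Simulation of sparse time-dependent Hamiltonians).** There are absolute constants $C,c>0$ and a polynomial $P$ such that the following holds. Let $N,d,n_p$ be natural numbers with $1\le d\le N$, and let $t,\epsilon,\mu,u>0$ and $\Lambda\ge 0$ be reals with $d\mu t\ge 1$ and $d\mu t/\epsilon\ge 16$. Put $$R=\frac{\log(d\mu t/\epsilon)}{\log\log(d\mu t/\epsilon)},\qquad S=\log\Big(\frac{Nt}{d\mu\,\epsilon}\big(\Lambda+(d\mu)^2\big)\Big).$$ There are a number $n_t$ of time-index bits and a quantum circuit, made of arbitrary one- and two-qubit gates (the primitive gates) and of queries to two oracles $O_H$, $O_f$ (possibly inverted and/or controlled by one qubit), all depending only on $N,d,n_p,t,\epsilon,\mu,\Lambda,u$, which acts on a system register of $\lceil\log_2N\rceil$ qubits and on ancilla qubits and has 1. at most $C\, d\mu t\, R$ queries to $O_H$ and $O_f$ (linear in $d$), 2. at most $C\,(n_p+S)$ qubits, 3. at most $C\, d\mu t\,\big(P(n_p)+S\,R\big)$ primitive gates, such that the following is true for every Hamiltonian and all oracles as described next. *Hamiltonian.* $H:[0,t]\to\mathbb C^{N\times N}$ is differentiable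 with $\|\dot H\|$ (spectral norm) integrable, every $H(s)$ is Hermitian with at most $d$ non-zero entries in each row, $\|H\|_{\max}=\max_{s,x,y}|H_{xy}(s)|\le\mu$, and the average rate of change satisfies $\langle\|\dot H\|\rangle=\frac1t\int_0^t\|\dot H(s)\|\,\mathrm ds\le\Lambda$. (So one may take $\mu=\|H\|_{\max}$ if this is positive, and $\Lambda=\langle\|\dot H\|\rangle$.) *Oracles.* Let $s_m=mt/2^{n_t}$ for $0\le m<2^{n_t}$. $O_H$ and $O_f$ are unitaries such that, for all such $m$ and all $x,y\in\{0,\dots,N-1\}$, $j\in\{0,\dots,d-1\}$, $$O_H|m,x,y,0\rangle=|m,x,y,h_m(x,y)\rangle,\qquad O_f|m,x,j\rangle=|m,x,f_m(x,j)\rangle .$$ Here $h_m(x,y)$ consists of the real and the imaginary part, each an $n_p$-bit two's-complement integer multiple of $u$, of a complex number that differs from $H_{xy}(s_m)$ by at most $c\,\epsilon/(dt)$ (for example, it equals $H_{xy}(s_m)$); and $f_m(x,0),\dots,f_m(x,d-1)$ are distinct column indices that include the columns of all non-zero entries in row $x$ of $H(s_m)$. On all other basis states the oracles are arbitrary. *Conclusion.*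 Let $W\in\mathbb C^{N\times N}$ be the operation obtained by starting all ancillas in $|0\rangle$, running the circuit, and projecting all ancillas onto $|0\rangle$ (and the system onto the span of $|0\rangle,\dots,|N-1\rangle$). Then $$\Big\|W-\mathcal T\big[e^{-i\int_0^tH(s)\,\mathrm ds}\big]\Big\|\le\epsilon,$$ where the time-ordered exponential is the sum of the Dyson series $\sum_{k\ge0}(-i)^k\int_{0\le s_1\le\dots\le s_k\le t}H(s_k)\cdots H(s_1)\,\mathrm ds_1\cdots\mathrm ds_k$; and the failure probability $1-\|W\psi\|^2$ is at most $C\epsilon$ for every unit vector $\psi\in\mathbb C^N$. -/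

import Mathlib

open scoped Matrix.Norms.L2Operator

noncomputable section

namespace SparseSim

/-! ### Time-dependent Hamiltonians

Matrices carry the spectral norm (the operator norm for the Euclidean norm). -/

/-- The `k`-th term of the Dyson series, without its factor `(-i)^k`: the nested integral
`∫_{0 ≤ s₁ ≤ ⋯ ≤ s_k ≤ s} H(s_k) ⋯ H(s₁) ds₁ ⋯ ds_k`. -/
def dysonTerm {N : ℕ} (H : ℝ → Matrix (Fin N) (Fin N) ℂ) : ℕ → ℝ → Matrix (Fin N) (Fin N) ℂ
  | 0 => fun _ => 1
  | k + 1 => fun s => ∫ r in (0 : ℝ)..s, H r * dysonTerm H k r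

/-- The time-ordered evolution operator `𝒯 exp(-i ∫₀ᵗ H(s) ds)`, as the sum of its Dyson series. -/
def timeOrderedExp {N : ℕ} (H : ℝ → Matrix (Fin N) (Fin N) ℂ) (t : ℝ) :
    Matrix (Fin N) (Fin N) ℂ :=
  ∑' k : ℕ, (-Complex.I) ^ k • dysonTerm H k t

/-- The average rate of change `(1/t) ∫₀ᵗ ‖dH/ds‖ ds`. -/
def avgRate {N : ℕ} (H : ℝ → Matrix (Fin N) (Fin N) ℂ) (t : ℝ) : ℝ :=
  (1 / t) * ∫ s in (0 : ℝ)..t, ‖derivWithin H (Set.Icc 0 t) s‖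

/-- `H` is a differentiable time-dependent `d`-sparse Hamiltonian on `[0, t]` whose entries are at
most `hmax` in absolute value and whose average rate of change is at most `rate`. -/
structure IsSparseHamiltonian {N : ℕ} (d : ℕ) (t hmax rate : ℝ)
    (H : ℝ → Matrix (Fin N) (Fin N) ℂ) : Prop where
  hermitian : ∀ s ∈ Set.Icc (0 : ℝ) t, (H s).IsHermitian
  sparse : ∀ s ∈ Set.Icc (0 : ℝ) t, ∀ x : Fin N, {y : Fin N | H s x y ≠ 0}.ncard ≤ d
  entry_le : ∀ s ∈ Set.Icc (0 : ℝ) t, ∀ x y : Fin N, ‖H s x y‖ ≤ hmax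
  differentiable : DifferentiableOn ℝ H (Set.Icc 0 t)
  integrable : IntervalIntegrable (fun s => ‖derivWithin H (Set.Icc 0 t) s‖)
    MeasureTheory.volume 0 t
  avgRate_le : avgRate H t ≤ rate

/-! ### Qubits and registers

A computational basis state of a set `κ` of qubits is a function `κ → Bool`, and an operator on
these qubits is a matrix indexed by such functions. -/

/-- Operators on the qubits `κ`. -/
abbrev QOp (κ : Type) : Type := Matrix (κ → Bool) (κ → Bool) ℂ

/-- The `n` low-order binary digits of `x`, least significant first. -/
def natBits (n x : ℕ) : Fin n → Bool := fun i => x.testBit i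

/-- The integer with the given binary digits in two's complement, least significant first. -/
def bitsToInt {n : ℕ} (b : Fin n → Bool) : ℤ :=
  ∑ i : Fin n, if b i then (if (i : ℕ) + 1 = n then -(2 : ℤ) ^ (i : ℕ) else 2 ^ (i : ℕ)) else 0

/-- The number of qubits that hold an index in `{0, …, N - 1}`. -/
abbrev indexQubits (N : ℕ) : ℕ := Nat.clog 2 N

/-- The qubits on which `O_H` acts: time index, row index, column index, real part and imaginary
part of the matrix entry. -/
abbrev HWire (nt N np : ℕ) : Type :=
  Fin nt ⊕ Fin (indexQubits N) ⊕ Fin (indexQubits N) ⊕ Fin np ⊕ Fin np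

/-- The qubits on which `O_f` acts: time index, row index, and a third register that holds `j` on
input and `f(x, j)` on output. -/
abbrev FWire (nt N : ℕ) : Type :=
  Fin nt ⊕ Fin (indexQubits N) ⊕ Fin (indexQubits N)

/-- The basis state `|m, x, y, re, im⟩`. -/
def hState (nt N np : ℕ) (m x y : ℕ) (re im : Fin np → Bool) : HWire nt N np → Bool :=
  Sum.elim (natBits nt m) (Sum.elim (natBits _ x) (Sum.elim (natBits _ y) (Sum.elim re im)))

/-- The basis state `|m, x, j⟩`. -/
def fState (nt N : ℕ) (m x j : ℕ) : FWire nt N → Bool :=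
  Sum.elim (natBits nt m) (Sum.elim (natBits _ x) (natBits _ j))

/-- The sampled time `m t / 2^nt` with time index `m`. -/
def gridTime (nt : ℕ) (t : ℝ) (m : ℕ) : ℝ := m * t / 2 ^ nt

/-- `O` maps `|m, x, y, 0⟩` to `|m, x, y, H_xy(s_m)⟩`, where the value register holds the real and
the imaginary part of the entry as `np`-bit fixed-point numbers (integer multiples of `unit`),
accurate to within `δ`. -/
def IsValueOracle {N : ℕ} (nt np : ℕ) (unit t δ : ℝ) (H : ℝ → Matrix (Fin N) (Fin N) ℂ)
    (O : QOp (HWire nt N np)) : Prop :=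
  ∀ m < 2 ^ nt, ∀ x y : Fin N, ∃ re im : Fin np → Bool,
    O.mulVec (Pi.single (hState nt N np m x y (fun _ => false) (fun _ => false)) 1) =
        Pi.single (hState nt N np m x y re im) 1 ∧
      ‖(unit : ℂ) * ((bitsToInt re : ℂ) + (bitsToInt im : ℂ) * Complex.I)
          - H (gridTime nt t m) x y‖ ≤ δ

/-- `O` maps `|m, x, j⟩` to `|m, x, f(m, x, j)⟩` for `j < d`, where `f(m, x, 0), …, f(m, x, d - 1)`
are distinct columns, among them all the columns of the non-zero entries in row `x` of `H(s_m)`. -/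
def IsPositionOracle {N : ℕ} (nt d : ℕ) (t : ℝ) (H : ℝ → Matrix (Fin N) (Fin N) ℂ)
    (O : QOp (FWire nt N)) : Prop :=
  ∀ m < 2 ^ nt, ∀ x : Fin N, ∃ f : Fin d → Fin N, Function.Injective f ∧
    (∀ y : Fin N, H (gridTime nt t m) x y ≠ 0 → ∃ j, f j = y) ∧
    ∀ j : Fin d, O.mulVec (Pi.single (fState nt N m x j) 1) = Pi.single (fState nt N m x (f j)) 1

/-! ### Quantum circuits with oracle gates -/

/-- The operator that applies `A` to the qubits selected by `e` and the identity to the others. -/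
def place {ι κ : Type} [Fintype ι] [Fintype κ] [DecidableEq κ] (e : ι ↪ κ) (A : QOp ι) : QOp κ :=
  fun x y => if ∀ k, (∀ i, e i ≠ k) → x k = y k then A (x ∘ e) (y ∘ e) else 0

/-- The operator `A` controlled by one further qubit, which is called `none`. -/
def controlled {ι : Type} [Fintype ι] (A : QOp ι) : QOp (Option ι) :=
  fun x y =>
    if x none = y none then
      (if x none then A else 1) (fun i => x (some i)) (fun i => y (some i))
    else 0

/-- The operator `A`, or its adjoint if `adj` holds. -/
def dagIf {ι : Type} (adj : Bool) (A : QOp ι) : QOp ι := if adj then A.conjTranspose else A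

/-- Gates on the qubits `κ`: arbitrary unitaries on one or two qubits (the primitive gates), and
queries to the oracles `O_H` and `O_f`, their inverses, and the controlled versions of these. -/
inductive Gate (nt N np : ℕ) (κ : Type) : Type
  | one (u : Matrix.unitaryGroup (Fin 1 → Bool) ℂ) (e : Fin 1 ↪ κ)
  | two (u : Matrix.unitaryGroup (Fin 2 → Bool) ℂ) (e : Fin 2 ↪ κ)
  | queryH (adj : Bool) (e : HWire nt N np ↪ κ)
  | queryF (adj : Bool) (e : FWire nt N ↪ κ)
  | ctrlQueryH (adj : Bool) (e : Option (HWire nt N np) ↪ κ)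
  | ctrlQueryF (adj : Bool) (e : Option (FWire nt N) ↪ κ)

namespace Gate

variable {nt N np : ℕ} {κ : Type}

/-- Whether the gate is an oracle query, as opposed to a primitive gate. -/
def isQuery : Gate nt N np κ → Bool
  | one _ _ => false
  | two _ _ => false
  | queryH _ _ => true
  | queryF _ _ => true
  | ctrlQueryH _ _ => true
  | ctrlQueryF _ _ => true

/-- The operator that a gate performs for given oracles. -/
def op [Fintype κ] [DecidableEq κ] (OH : QOp (HWire nt N np)) (Of : QOp (FWire nt N)) :
    Gate nt N np κ → QOp κ
  | one u e => place e u.1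
  | two u e => place e u.1
  | queryH adj e => place e (dagIf adj OH)
  | queryF adj e => place e (dagIf adj Of)
  | ctrlQueryH adj e => place e (controlled (dagIf adj OH))
  | ctrlQueryF adj e => place e (controlled (dagIf adj Of))

end Gate

/-- Circuits on the system qubits, which hold an index in `{0, …, N - 1}`, and `a` ancilla qubits;
the first gate of the list is applied first. -/
abbrev Circuit (nt N np a : ℕ) : Type := List (Gate nt N np (Fin (indexQubits N) ⊕ Fin a))

namespace Circuit

variable {nt N np a : ℕ}

/-- The number of queries to `O_H` and `O_f`. -/
def queries (c : Circuit nt N np a) : ℕ := c.countP fun g => g.isQuery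

/-- The number of primitive gates. -/
def primitiveGates (c : Circuit nt N np a) : ℕ := c.countP fun g => !g.isQuery

/-- The total number of qubits, system and ancillas. -/
def qubits (_ : Circuit nt N np a) : ℕ := indexQubits N + a

/-- The operator that the circuit performs on all of its qubits for given oracles. -/
def op (OH : QOp (HWire nt N np)) (Of : QOp (FWire nt N)) :
    Circuit nt N np a → QOp (Fin (indexQubits N) ⊕ Fin a)
  | [] => 1
  | g :: c => op OH Of c * g.op OH Of

/-- The operation implemented on `ℂ^N`: the ancillas start in `|0⋯0⟩`, and the run is successful if
they are found in `|0⋯0⟩` (and the system in `ℂ^N`) at the end. -/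
def implemented (OH : QOp (HWire nt N np)) (Of : QOp (FWire nt N)) (c : Circuit nt N np a) :
    Matrix (Fin N) (Fin N) ℂ :=
  fun x y => op OH Of c (Sum.elim (natBits _ x) fun _ => false)
    (Sum.elim (natBits _ y) fun _ => false)

end Circuit

/-- The probability that the operation `W` fails on the state `ψ`. -/
def failureProb {N : ℕ} (W : Matrix (Fin N) (Fin N) ℂ) (ψ : Fin N → ℂ) : ℝ :=
  1 - ∑ x, ‖W.mulVec ψ x‖ ^ 2

end SparseSim

end

/-! The interval is divided into `2 ^ p` segments, between `32` and `64` times `d * hmax * t` in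
number, and every segment into `2 ^ n` steps of length `δ`. If `A_m` is the Hermitian matrix
reported by the oracles at step `m`, the evolution over a segment is close to the product of the
factors `1 - i δ A_m`. This product expands exactly into sums over strictly increasing times
(`timeProd_one_add_smul`), and cutting the expansion at order `K` costs about `1 / K!`
(`norm_truncation_sub_le`). With `L = d * hmax * t / ε`, an order `K` proportional to `log L / log
log L` already gives `K! ≥ L ^ 7` (`pow_le_factorial`); this is the source of the factor `R`.

The truncated series is a block of a unitary `opW` built from three devices. The first, `opB`,
encodes `A_m`: each row is sent to a uniform superposition of its listed columns, and after an
exchange of the row and column registers the states of rows `x` and `x'` overlap only in the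
position joining them. The value of the entry arises as a sum of signs, `+1` for each number below
the shifted integer value and `-1` for the others. The scale of this encoding is about `d * hmax`,
hence the linear dependence on `d`. The second, `opL`, exchanges the clock with a uniformly
distributed second clock and rejects the result unless it is later, so that its block sums over
earlier times. The third is a unary control register (`chain`) with weights `2 ^ -(k + 1)`, which
fixes how many factors act. A flag qubit after each step records failure, so that the blocks of the
steps multiply (`seqOp_apply`).

A rotation `Ra` of one ancilla tunes the scale of `opB` so that its powers cancel the unary weights:
the block of `opW` is exactly half of the series, with its last term doubled (`blk_opW_eq`). Since
the series is almost unitary, one round of oblivious amplitude amplification turns the factor `1 /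
2` into `1` (`amplification_block`, `norm_amplification_sub_le`). A unitary whose block is nearly
unitary leaks at most the square root of the error (`norm_mul_isometry_sub_sq_le`), so the segments
can be composed on the same ancillas (`norm_opTotal_block_sub_le`).

Sampling `H` at the grid times costs the precision of the oracle plus a term proportional to the
step length. Only the average rate of change enters, because the variations over the steps add up to
an integral (`IsSparseHamiltonian.norm_timeProd_exp_sub_le`). The errors from the segments, the
oracle and the discretization are at most `ε / 2`, `ε / 4` and `3 / 16 * ε`.

For the gate count, every elementary operator other than a query is a gate, a phase or a swap
conditioned on a Boolean formula. The formula is evaluated into clean work qubits and then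
uncomputed (`exists_compile`, `Impl.cOp`), at a cost proportional to its size, which is linear in
the size of the registers. If `ε ≥ 2`, or if all encoded values must be zero, the empty circuit
suffices (`exists_simulation_of_trivial`). -/

set_option linter.unusedSectionVars false
set_option linter.unnecessarySeqFocus false

namespace SparseSim

open Matrix

/-! ### Basis vectors. -/

section Kets

variable {κ : Type}

/-- The computational basis vector with label `s`. -/
def ket [DecidableEq κ] [Fintype κ] (s : κ → Bool) : (κ → Bool) → ℂ := Pi.single s 1

variable [Fintype κ] [DecidableEq κ]

lemma ket_apply (s x : κ → Bool) : ket s x = if x = s then 1 else 0 := by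
  simp [ket, Pi.single_apply]

lemma mulVec_ket {α : Type*} (A : Matrix α (κ → Bool) ℂ) (s : κ → Bool) (x : α) :
    (A *ᵥ ket s) x = A x s := by
  simp [ket]

lemma ext_ket {α : Type*} {A B : Matrix α (κ → Bool) ℂ} (h : ∀ s, A *ᵥ ket s = B *ᵥ ket s) :
    A = B := by
  ext x s
  rw [← mulVec_ket A, ← mulVec_ket B, h]

lemma mulVec_sum_smul_ket {α ι : Type*} [Fintype ι] (A : Matrix α (κ → Bool) ℂ) (z : ι → ℂ)
    (f : ι → κ → Bool) : A *ᵥ (∑ i, z i • ket (f i)) = ∑ i, z i • (A *ᵥ ket (f i)) := by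
  ext x
  rw [Matrix.mulVec_sum]
  simp [Matrix.mulVec_smul]

end Kets

/-! ### Operators on a subset of the qubits. -/

section Place

variable {ι κ : Type} [Fintype ι] [DecidableEq ι] [Fintype κ] [DecidableEq κ]

lemma extend_comp_self (e : ι ↪ κ) (a : ι → Bool) (s : κ → Bool) :
    Function.extend e a s ∘ e = a := by
  ext i; simp [e.injective.extend_apply]

lemma extend_extend (e : ι ↪ κ) (a b : ι → Bool) (s : κ → Bool) :
    Function.extend e b (Function.extend e a s) = Function.extend e b s := by
  ext k
  by_cases h : ∃ i, e i = k
  · obtain ⟨i, rfl⟩ := h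
    simp [e.injective.extend_apply]
  · simp [Function.extend_apply' _ _ _ h]

lemma extend_self (e : ι ↪ κ) (s : κ → Bool) : Function.extend e (s ∘ e) s = s := by
  ext k
  by_cases h : ∃ i, e i = k
  · obtain ⟨i, rfl⟩ := h
    simp [e.injective.extend_apply]
  · simp [Function.extend_apply' _ _ _ h]

lemma eq_extend_of_eq_off (e : ι ↪ κ) (x y : κ → Bool) (h : ∀ k, (∀ i, e i ≠ k) → x k = y k) :
    x = Function.extend e (x ∘ e) y := by
  ext k
  by_cases h' : ∃ i, e i = k
  · obtain ⟨i, rfl⟩ := h'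
    simp [e.injective.extend_apply]
  · rw [Function.extend_apply' _ _ _ h', h k (by simpa using h')]

/-- Operator identities are checked on basis vectors throughout; this expansion and its analogues
for the other kinds of operators are the normal forms used for that. -/
lemma place_mulVec_ket (e : ι ↪ κ) (A : QOp ι) (s : κ → Bool) :
    place e A *ᵥ ket s = ∑ a, A a (s ∘ e) • ket (Function.extend e a s) := by
  ext x
  rw [mulVec_ket]
  simp only [place, Finset.sum_apply, Pi.smul_apply, ket_apply, smul_eq_mul, mul_ite, mul_one,
    mul_zero]
  split_ifs with h
  · rw [Finset.sum_eq_single (x ∘ e)]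
    · rw [if_pos (eq_extend_of_eq_off e x s h)]
    · intro b _ hb
      rw [if_neg]
      rintro rfl
      exact hb (extend_comp_self e b s).symm
    · simp
  · rw [Finset.sum_eq_zero]
    intro a _
    rw [if_neg]
    rintro rfl
    exact h fun k hk => Function.extend_apply' _ _ _ (by simpa using hk)

lemma place_mulVec_ket_of_ket (e : ι ↪ κ) (A : QOp ι) (s : κ → Bool) (z : ι → Bool)
    (h : A *ᵥ ket (s ∘ e) = ket z) : place e A *ᵥ ket s = ket (Function.extend e z s) := by
  rw [place_mulVec_ket]
  simp_rw [← mulVec_ket A, h, ket_apply]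
  simp

lemma place_mul (e : ι ↪ κ) (A B : QOp ι) : place e A * place e B = place e (A * B) := by
  refine ext_ket fun s => ?_
  rw [← mulVec_mulVec, place_mulVec_ket, mulVec_sum_smul_ket, place_mulVec_ket]
  simp_rw [place_mulVec_ket, extend_comp_self, extend_extend, Finset.smul_sum, smul_smul,
    Matrix.mul_apply, Finset.sum_smul]
  rw [Finset.sum_comm]
  simp_rw [mul_comm]

lemma place_one (e : ι ↪ κ) : place e (1 : QOp ι) = 1 := by
  refine ext_ket fun s => ?_
  rw [place_mulVec_ket_of_ket e 1 s (s ∘ e) (by simp), extend_self, one_mulVec]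

lemma place_conjTranspose (e : ι ↪ κ) (A : QOp ι) : (place e A)ᴴ = place e Aᴴ := by
  ext x y
  simp only [conjTranspose_apply, place]
  by_cases h : ∀ k, (∀ i, e i ≠ k) → x k = y k
  · rw [if_pos h, if_pos fun k hk => (h k hk).symm]
  · rw [if_neg h, if_neg fun h' => h fun k hk => (h' k hk).symm, star_zero]

lemma place_mem_unitary (e : ι ↪ κ) {A : QOp ι} (hA : A ∈ unitaryGroup (ι → Bool) ℂ) :
    place e A ∈ unitaryGroup (κ → Bool) ℂ := by
  rw [mem_unitaryGroup_iff, star_eq_conjTranspose] at hA ⊢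
  rw [place_conjTranspose, place_mul, hA, place_one]

end Place

/-! ### Conditional one-qubit operators and the Toffoli gate. -/

section ConditionalOneQubit

variable {κ : Type} [Fintype κ] [DecidableEq κ]

/-- The operator that applies to the qubit `t` a one-qubit operator `U s`, which depends on the
basis state `s` of the qubits. -/
def gOp (t : κ) (U : (κ → Bool) → Matrix Bool Bool ℂ) : QOp κ :=
  fun x y => if ∀ k, k ≠ t → x k = y k then U y (x t) (y t) else 0

/-- `f s` does not depend on the qubit `t`. -/
def IndepOf {α : Type*} (t : κ) (f : (κ → Bool) → α) : Prop :=
  ∀ s c, f (Function.update s t c) = f s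

lemma IndepOf.eq {α : Type*} {t : κ} {f : (κ → Bool) → α} (h : IndepOf t f) {x y : κ → Bool}
    (hxy : ∀ k, k ≠ t → x k = y k) : f x = f y := by
  have : x = Function.update y t (x t) := by
    ext k
    by_cases hk : k = t
    · subst hk; simp
    · simp [hk, hxy k hk]
  rw [this, h]

lemma gOp_mulVec_ket (t : κ) (U : (κ → Bool) → Matrix Bool Bool ℂ) (s : κ → Bool) :
    gOp t U *ᵥ ket s = ∑ c, U s c (s t) • ket (Function.update s t c) := by
  ext x
  rw [mulVec_ket]
  simp only [gOp, Finset.sum_apply, Pi.smul_apply, ket_apply, smul_eq_mul, mul_ite, mul_one,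
    mul_zero]
  split_ifs with h
  · rw [Finset.sum_eq_single (x t)]
    · rw [if_pos]
      ext k
      by_cases hk : k = t
      · subst hk; simp
      · simp [hk, h k hk]
    · intro b _ hb
      rw [if_neg]
      rintro rfl
      simp at hb
    · simp
  · rw [Finset.sum_eq_zero]
    intro a _
    rw [if_neg]
    rintro rfl
    exact h fun k hk => by simp [hk]

/-- Only the left factor has to be independent of `t`: it is evaluated after the right factor may
have changed that qubit, whereas the right factor is evaluated at the original label. -/
lemma gOp_mul (t : κ) {V : (κ → Bool) → Matrix Bool Bool ℂ} (U : (κ → Bool) → Matrix Bool Bool ℂ)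
    (hV : IndepOf t V) : gOp t V * gOp t U = gOp t (fun s => V s * U s) := by
  refine ext_ket fun s => ?_
  rw [← mulVec_mulVec, gOp_mulVec_ket, mulVec_sum_smul_ket, gOp_mulVec_ket]
  simp_rw [gOp_mulVec_ket, hV s, Function.update_self, Function.update_idem, Finset.smul_sum,
    smul_smul, Matrix.mul_apply, Finset.sum_smul]
  rw [Finset.sum_comm]
  simp_rw [mul_comm]

lemma gOp_one (t : κ) : gOp t (fun _ => 1) = 1 := by
  refine ext_ket fun s => ?_
  rw [gOp_mulVec_ket, one_mulVec]
  simp [Matrix.one_apply, ite_smul]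

lemma gOp_conjTranspose (t : κ) {U : (κ → Bool) → Matrix Bool Bool ℂ} (hU : IndepOf t U) :
    (gOp t U)ᴴ = gOp t (fun s => (U s)ᴴ) := by
  ext x y
  simp only [conjTranspose_apply, gOp]
  by_cases h : ∀ k, k ≠ t → x k = y k
  · rw [if_pos h, if_pos fun k hk => (h k hk).symm, hU.eq h]
  · rw [if_neg h, if_neg fun h' => h fun k hk => (h' k hk).symm, star_zero]

lemma gOp_mem_unitary (t : κ) {U : (κ → Bool) → Matrix Bool Bool ℂ} (hU : IndepOf t U)
    (h : ∀ s, U s ∈ unitaryGroup Bool ℂ) : gOp t U ∈ unitaryGroup (κ → Bool) ℂ := by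
  rw [mem_unitaryGroup_iff, star_eq_conjTranspose, gOp_conjTranspose t hU, gOp_mul t _ hU]
  simp_rw [← star_eq_conjTranspose, mem_unitaryGroup_iff.1 (h _)]
  exact gOp_one t

lemma place_gOp {ι : Type} [Fintype ι] [DecidableEq ι] (e : ι ↪ κ) (t : ι)
    (U : (ι → Bool) → Matrix Bool Bool ℂ) :
    place e (gOp t U) = gOp (e t) (fun s => U (s ∘ e)) := by
  ext x y
  simp only [place, gOp]
  by_cases h : ∀ k, k ≠ e t → x k = y k
  · rw [if_pos h, if_pos, if_pos]
    · rfl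
    · exact fun k hk => h _ (by simpa using hk)
    · exact fun k hk => h _ (hk t).symm
  · rw [if_neg h]
    split_ifs with h1 h2
    · refine (h fun k hk => ?_).elim
      by_cases hk' : ∃ i, e i = k
      · obtain ⟨i, rfl⟩ := hk'
        exact h2 i (by simpa using hk)
      · exact h1 k (by simpa using hk')
    · rfl
    · rfl

/-- The operator that applies `U` to the qubit `t` if the condition `ψ` holds. -/
def cOp (ψ : (κ → Bool) → Bool) (t : κ) (U : Matrix Bool Bool ℂ) : QOp κ :=
  gOp t (fun s => if ψ s then U else 1)

lemma IndepOf.ite {ψ : (κ → Bool) → Bool} {t : κ} (h : IndepOf t ψ) (U : Matrix Bool Bool ℂ) :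
    IndepOf t (fun s => if ψ s then U else 1) := fun s c => by simp only [h s c]

lemma cOp_mem_unitary {ψ : (κ → Bool) → Bool} {t : κ} (h : IndepOf t ψ) {U : Matrix Bool Bool ℂ}
    (hU : U ∈ unitaryGroup Bool ℂ) : cOp ψ t U ∈ unitaryGroup (κ → Bool) ℂ := by
  refine gOp_mem_unitary t (h.ite U) fun s => ?_
  split_ifs
  · exact hU
  · exact one_mem _

lemma cOp_conjTranspose {ψ : (κ → Bool) → Bool} {t : κ} (h : IndepOf t ψ)
    (U : Matrix Bool Bool ℂ) : (cOp ψ t U)ᴴ = cOp ψ t Uᴴ := by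
  rw [cOp, gOp_conjTranspose t (h.ite U), cOp]
  congr 1
  ext1 s
  split_ifs <;> simp

lemma cOp_mulVec_ket (ψ : (κ → Bool) → Bool) (t : κ) (U : Matrix Bool Bool ℂ) (s : κ → Bool) :
    cOp ψ t U *ᵥ ket s =
      if ψ s then ∑ c, U c (s t) • ket (Function.update s t c) else ket s := by
  rw [cOp, gOp_mulVec_ket]
  split_ifs
  · rfl
  · simp [Matrix.one_apply, ite_smul]

/-- The Pauli matrix `X`. -/
def pauliX : Matrix Bool Bool ℂ := fun a b => if a = !b then 1 else 0

/-- The Hadamard matrix. -/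
noncomputable def hadamard : Matrix Bool Bool ℂ := fun a b => (if a && b then -1 else 1) / (√2 : ℝ)

/-- The square root of `X`. -/
noncomputable def sqrtX : Matrix Bool Bool ℂ :=
  fun a b => if a = b then (1 + Complex.I) / 2 else (1 - Complex.I) / 2

lemma pauliX_mem : pauliX ∈ unitaryGroup Bool ℂ := by
  rw [mem_unitaryGroup_iff]
  ext a b
  cases a <;> cases b <;> simp [Matrix.mul_apply, pauliX]

lemma hadamard_conjTranspose : hadamardᴴ = hadamard := by
  ext a b
  cases a <;> cases b <;> simp [hadamard]

lemma hadamard_mul_self : hadamard * hadamard = 1 := by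
  have h : ((√2 : ℝ) : ℂ) * (√2 : ℝ) = 2 := by
    rw [← Complex.ofReal_mul, Real.mul_self_sqrt (by norm_num)]; norm_num
  have h0 : ((√2 : ℝ) : ℂ) ≠ 0 := by
    intro h0; rw [h0] at h; norm_num at h
  ext a b
  cases a <;> cases b <;> simp [Matrix.mul_apply, hadamard] <;> field_simp <;>
    simp [sq, h] <;> norm_num

lemma hadamard_mem : hadamard ∈ unitaryGroup Bool ℂ := by
  rw [mem_unitaryGroup_iff, star_eq_conjTranspose, hadamard_conjTranspose, hadamard_mul_self]

lemma sqrtX_mul_self : sqrtX * sqrtX = pauliX := by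
  ext a b
  cases a <;> cases b <;> simp [Matrix.mul_apply, sqrtX, pauliX] <;> ring_nf <;> simp <;> norm_num

lemma sqrtX_mul_star : sqrtX * sqrtXᴴ = 1 := by
  ext a b
  have h : (starRingEnd ℂ) 2 = 2 := Complex.conj_ofNat 2
  cases a <;> cases b <;> simp [Matrix.mul_apply, sqrtX, h] <;> ring_nf <;> simp <;> norm_num

lemma sqrtX_star_mul : sqrtXᴴ * sqrtX = 1 := mul_eq_one_comm.1 sqrtX_mul_star

lemma sqrtX_mem : sqrtX ∈ unitaryGroup Bool ℂ := by
  rw [mem_unitaryGroup_iff, star_eq_conjTranspose, sqrtX_mul_star]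

lemma flip_mulVec_ket (ψ : (κ → Bool) → Bool) (t : κ) (s : κ → Bool) :
    cOp ψ t pauliX *ᵥ ket s = ket (if ψ s then Function.update s t (!s t) else s) := by
  rw [cOp_mulVec_ket]
  split_ifs
  · rw [Finset.sum_eq_single (!s t)]
    · simp [pauliX]
    · intro b _ hb
      simp [pauliX, hb]
    · simp
  · rfl

/-- Since `φ` depends on neither `b` nor `t`, the two flips have the same condition and undo each
other; what remains is that `ψ` is evaluated with `b` flipped. -/
lemma cOp_flip_conj (ψ φ : (κ → Bool) → Bool) (b t : κ) (V : Matrix Bool Bool ℂ) (hbt : b ≠ t)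
    (hφb : IndepOf b φ) (hφt : IndepOf t φ) :
    cOp φ b pauliX * cOp ψ t V * cOp φ b pauliX =
      cOp (fun s => ψ (if φ s then Function.update s b (!s b) else s)) t V := by
  refine ext_ket fun s => ?_
  rw [← mulVec_mulVec, ← mulVec_mulVec, flip_mulVec_ket, cOp_mulVec_ket, cOp_mulVec_ket]
  split_ifs with h1 h2 h3
  · simp_rw [mulVec_sum_smul_ket, flip_mulVec_ket]
    refine Finset.sum_congr rfl fun c _ => ?_
    rw [hφt, hφb, if_pos h1, Function.update_of_ne hbt.symm]
    congr 2
    rw [Function.update_of_ne hbt, Function.update_self, Bool.not_not, Function.update_comm hbt,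
      Function.update_idem]
    ext k
    by_cases hk : k = b
    · subst hk; simp [hbt]
    · simp [hk, Function.update_apply]
  · rw [flip_mulVec_ket, hφb, if_pos h1]
    simp
  · simp_rw [mulVec_sum_smul_ket, flip_mulVec_ket]
    refine Finset.sum_congr rfl fun c _ => ?_
    rw [hφt, if_neg h1]
  · rw [flip_mulVec_ket, if_neg h1]

/-- Counted with sign, the square root of `X` is applied `a + b - (a xor b) = 2ab` times. -/
lemma cOp_and_pauliX (a b t : κ) (hab : a ≠ b) (hat : a ≠ t) (hbt : b ≠ t) :
    cOp (fun s => s a && s b) t pauliX =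
      cOp (fun s => s b) t sqrtX *
        ((cOp (fun s => s a) b pauliX * cOp (fun s => s b) t sqrtXᴴ * cOp (fun s => s a) b pauliX) *
          cOp (fun s => s a) t sqrtX) := by
  have i1 : IndepOf t (fun s : κ → Bool => s a) := fun s c => by simp [hat]
  have i2 : IndepOf t (fun s : κ → Bool => s b) := fun s c => by simp [hbt]
  have i3 : IndepOf b (fun s : κ → Bool => s a) := fun s c => by simp [hab]
  rw [cOp_flip_conj _ _ _ _ _ hbt i3 i1]
  have i4 : IndepOf t (fun s : κ → Bool => (if s a then Function.update s b (!s b) else s) b) :=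
    fun s c => by
      by_cases h : s a
      · simp [hat, hbt, h]
      · simp [hat, hbt, h]
  simp only [cOp]
  rw [gOp_mul _ _ (i4.ite _), gOp_mul _ _ (i2.ite _)]
  congr 1
  ext1 s
  by_cases ha : s a <;> by_cases hb : s b <;>
    simp [ha, hb, sqrtX_mul_self, sqrtX_mul_star, sqrtX_star_mul]

end ConditionalOneQubit

/-! ### Lists of gates, their inverses, and elementary conditional gates. -/

section GateLists

variable {nt N np : ℕ} {κ : Type} [Fintype κ] [DecidableEq κ]

/-- The operator performed by a list of gates, the first of which is applied first. -/
def gatesOp (OH : QOp (HWire nt N np)) (Of : QOp (FWire nt N)) : List (Gate nt N np κ) → QOp κ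
  | [] => 1
  | g :: c => gatesOp OH Of c * g.op OH Of

lemma gatesOp_append (OH : QOp (HWire nt N np)) (Of : QOp (FWire nt N))
    (c c' : List (Gate nt N np κ)) :
    gatesOp OH Of (c ++ c') = gatesOp OH Of c' * gatesOp OH Of c := by
  induction c with
  | nil => simp [gatesOp]
  | cons g c ih => simp [gatesOp, ih, Matrix.mul_assoc]

/-- The inverse of a gate. -/
def Gate.inv : Gate nt N np κ → Gate nt N np κ
  | .one u e => .one (star u) e
  | .two u e => .two (star u) e
  | .queryH adj e => .queryH (!adj) e
  | .queryF adj e => .queryF (!adj) e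
  | .ctrlQueryH adj e => .ctrlQueryH (!adj) e
  | .ctrlQueryF adj e => .ctrlQueryF (!adj) e

lemma dagIf_not {ι : Type} (adj : Bool) (A : QOp ι) : dagIf (!adj) A = (dagIf adj A)ᴴ := by
  cases adj <;> simp [dagIf]

lemma controlled_conjTranspose {ι : Type} [Fintype ι] [DecidableEq ι] (A : QOp ι) :
    (controlled A)ᴴ = controlled Aᴴ := by
  ext x y
  simp only [controlled, conjTranspose_apply]
  by_cases h : x none = y none
  · rw [if_pos h, if_pos h.symm, h]
    split_ifs
    · rfl
    · rw [← conjTranspose_apply, conjTranspose_one]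
  · rw [if_neg h, if_neg (Ne.symm h), star_zero]

lemma Gate.op_inv (OH : QOp (HWire nt N np)) (Of : QOp (FWire nt N)) (g : Gate nt N np κ) :
    g.inv.op OH Of = (g.op OH Of)ᴴ := by
  cases g <;>
    simp [Gate.inv, Gate.op, place_conjTranspose, dagIf_not, controlled_conjTranspose,
      star_eq_conjTranspose]

lemma Gate.isQuery_inv (g : Gate nt N np κ) : g.inv.isQuery = g.isQuery := by
  cases g <;> rfl

/-- The reversed list of the inverse gates. -/
def invGates (c : List (Gate nt N np κ)) : List (Gate nt N np κ) := (c.map Gate.inv).reverse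

lemma gatesOp_invGates (OH : QOp (HWire nt N np)) (Of : QOp (FWire nt N))
    (c : List (Gate nt N np κ)) : gatesOp OH Of (invGates c) = (gatesOp OH Of c)ᴴ := by
  induction c with
  | nil => simp [gatesOp, invGates]
  | cons g c ih =>
    rw [invGates] at ih
    simp [invGates, gatesOp_append, ih, gatesOp, Gate.op_inv]

lemma countP_invGates (c : List (Gate nt N np κ)) :
    (invGates c).countP (fun g => g.isQuery) = c.countP (fun g => g.isQuery) ∧
      (invGates c).countP (fun g => !g.isQuery) = c.countP (fun g => !g.isQuery) := by
  simp only [invGates, List.countP_reverse, List.countP_map]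
  constructor <;> congr 1 <;> ext g <;> simp [Gate.isQuery_inv]

/-- A list of primitive gates that performs the operator `M`. -/
structure Performs (c : List (Gate nt N np κ)) (M : QOp κ) : Prop where
  prim : ∀ g ∈ c, g.isQuery = false
  op : ∀ OH Of, gatesOp OH Of c = M

lemma Performs.append {c c' : List (Gate nt N np κ)} {M M' : QOp κ} (h : Performs c M)
    (h' : Performs c' M') : Performs (c ++ c') (M' * M) where
  prim g hg := (List.mem_append.1 hg).elim (h.prim g) (h'.prim g)
  op OH Of := by rw [gatesOp_append, h.op, h'.op]

variable (nt N np)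

lemma exists_performs_one (t : κ) {U : Matrix Bool Bool ℂ} (hU : U ∈ unitaryGroup Bool ℂ) :
    ∃ c : List (Gate nt N np κ), c.length = 1 ∧ Performs c (cOp (fun _ => true) t U) := by
  refine ⟨[.one ⟨cOp (fun _ => true) 0 U, cOp_mem_unitary (fun _ _ => rfl) hU⟩
    ⟨fun _ => t, fun _ _ _ => Subsingleton.elim _ _⟩], rfl, by simp [Gate.isQuery], ?_⟩
  intro OH Of
  simp only [gatesOp, Gate.op, one_mul, cOp, place_gOp]
  rfl

lemma exists_performs_two {a t : κ} (hat : a ≠ t) {U : Matrix Bool Bool ℂ}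
    (hU : U ∈ unitaryGroup Bool ℂ) :
    ∃ c : List (Gate nt N np κ), c.length = 1 ∧ Performs c (cOp (fun s => s a) t U) := by
  refine ⟨[.two ⟨cOp (fun s => s 0) 1 U, cOp_mem_unitary (fun _ _ => by simp) hU⟩
    ⟨![a, t], ?_⟩], rfl, by simp [Gate.isQuery], ?_⟩
  · intro i j h
    fin_cases i <;> fin_cases j <;> simp_all
  · intro OH Of
    simp only [gatesOp, Gate.op, one_mul, cOp, place_gOp]
    rfl

lemma exists_performs_toffoli {a b t : κ} (hab : a ≠ b) (hat : a ≠ t) (hbt : b ≠ t) :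
    ∃ c : List (Gate nt N np κ), c.length = 5 ∧
      Performs c (cOp (fun s => s a && s b) t pauliX) := by
  have hV : sqrtXᴴ ∈ unitaryGroup Bool ℂ := by
    rw [← star_eq_conjTranspose]; exact Unitary.star_mem sqrtX_mem
  obtain ⟨c1, h1, p1⟩ := exists_performs_two nt N np hat sqrtX_mem
  obtain ⟨c2, h2, p2⟩ := exists_performs_two nt N np hab pauliX_mem
  obtain ⟨c3, h3, p3⟩ := exists_performs_two nt N np hbt hV
  obtain ⟨c4, h4, p4⟩ := exists_performs_two nt N np hbt sqrtX_mem
  refine ⟨(c1 ++ ((c2 ++ c3) ++ c2)) ++ c4, by simp [h1, h2, h3, h4], ?_⟩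
  rw [cOp_and_pauliX a b t hab hat hbt, Matrix.mul_assoc (cOp (fun s => s a) b pauliX)]
  exact (p1.append ((p2.append p3).append p2)).append p4

end GateLists

/-! ### Boolean formulas in the values of qubits. -/

section Formulas

/-- Boolean formulas in the values of the qubits `κ`. -/
inductive Form (κ : Type) : Type
  | var (k : κ)
  | tru
  | not (φ : Form κ)
  | and (φ ψ : Form κ)
  | xor (φ ψ : Form κ)

namespace Form

variable {κ : Type}

/-- The truth value of a formula in a basis state. -/
def eval (s : κ → Bool) : Form κ → Bool
  | var k => s k
  | tru => true
  | not φ => !φ.eval s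
  | and φ ψ => φ.eval s && ψ.eval s
  | xor φ ψ => Bool.xor (φ.eval s) (ψ.eval s)

/-- The number of nodes of a formula. -/
def size : Form κ → ℕ
  | var _ => 1
  | tru => 1
  | not φ => φ.size + 1
  | and φ ψ => φ.size + ψ.size + 1
  | xor φ ψ => φ.size + ψ.size + 1

/-- The formula does not mention the qubit `t`. -/
def Avoids (t : κ) : Form κ → Prop
  | var k => k ≠ t
  | tru => True
  | not φ => φ.Avoids t
  | and φ ψ => φ.Avoids t ∧ ψ.Avoids t
  | xor φ ψ => φ.Avoids t ∧ ψ.Avoids t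

lemma Avoids.indepOf [DecidableEq κ] {t : κ} {φ : Form κ} (h : φ.Avoids t) :
    IndepOf t (fun s => φ.eval s) := by
  intro s c
  induction φ with
  | var k => simpa [eval] using Function.update_of_ne h c s
  | tru => rfl
  | not φ ih => simpa [eval] using ih h
  | and φ ψ ih ih' => simp only [eval] at *; rw [ih h.1, ih' h.2]
  | xor φ ψ ih ih' => simp only [eval] at *; rw [ih h.1, ih' h.2]

end Form

end Formulas

/-! ### Reversible evaluation of formulas on work qubits. -/

section Compile

variable {nt N np : ℕ} {κ : Type} [Fintype κ] [DecidableEq κ] {w : ℕ}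

/-- The gate list `c` maps basis states to basis states by `f`, and changes only the work qubits
with numbers in `[i, i + n)`, in a way that does not depend on the qubits in `A`. -/
structure WorkCirc (A : Set κ) (i n : ℕ) (c : List (Gate nt N np (κ ⊕ Fin w)))
    (f : (κ ⊕ Fin w → Bool) → κ ⊕ Fin w → Bool) : Prop where
  prim : ∀ g ∈ c, g.isQuery = false
  unitary : ∀ OH Of, gatesOp OH Of c ∈ unitaryGroup (κ ⊕ Fin w → Bool) ℂ
  ket : ∀ OH Of s, gatesOp OH Of c *ᵥ ket s = ket (f s)
  inl : ∀ s k, f s (Sum.inl k) = s (Sum.inl k)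
  out : ∀ s (j : Fin w), (j : ℕ) < i ∨ i + n ≤ j → f s (Sum.inr j) = s (Sum.inr j)
  upd : ∀ t ∈ A, ∀ s b, f (Function.update s (Sum.inl t) b) = Function.update (f s) (Sum.inl t) b

lemma WorkCirc.trans {A : Set κ} {i i' n n' : ℕ} {c c' : List (Gate nt N np (κ ⊕ Fin w))}
    {f f' : (κ ⊕ Fin w → Bool) → κ ⊕ Fin w → Bool} (h : WorkCirc A i n c f)
    (h' : WorkCirc A i' n' c' f') (hi : i' = i + n) : WorkCirc A i (n + n') (c ++ c') (f' ∘ f) where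
  prim g hg := (List.mem_append.1 hg).elim (h.prim g) (h'.prim g)
  unitary OH Of := by
    rw [gatesOp_append]; exact mul_mem (h'.unitary OH Of) (h.unitary OH Of)
  ket OH Of s := by
    rw [gatesOp_append, ← mulVec_mulVec, h.ket, h'.ket]; rfl
  inl s k := by rw [Function.comp_apply, h'.inl, h.inl]
  out s j hj := by
    rw [Function.comp_apply, h'.out _ _ (by omega), h.out _ _ (by omega)]
  upd t ht s b := by rw [Function.comp_apply, h.upd t ht, h'.upd t ht]; rfl

lemma WorkCirc.mono {A B : Set κ} {i n : ℕ} {c : List (Gate nt N np (κ ⊕ Fin w))}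
    {f : (κ ⊕ Fin w → Bool) → κ ⊕ Fin w → Bool} (h : WorkCirc A i n c f) (hB : B ⊆ A) :
    WorkCirc B i n c f :=
  { h with upd := fun t ht => h.upd t (hB ht) }

lemma WorkCirc.flip {A : Set κ} {i : ℕ} (hi : i < w) {c : List (Gate nt N np (κ ⊕ Fin w))}
    {ψ : (κ ⊕ Fin w → Bool) → Bool} (hc : Performs c (cOp ψ (Sum.inr ⟨i, hi⟩) pauliX))
    (hψ : IndepOf (Sum.inr ⟨i, hi⟩) ψ) (hA : ∀ t ∈ A, IndepOf (Sum.inl t) ψ) :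
    WorkCirc A i 1 c (fun s => if ψ s then
      Function.update s (Sum.inr ⟨i, hi⟩) (!s (Sum.inr ⟨i, hi⟩)) else s) where
  prim := hc.prim
  unitary OH Of := by rw [hc.op]; exact cOp_mem_unitary hψ pauliX_mem
  ket OH Of s := by rw [hc.op, flip_mulVec_ket]
  inl s k := by split_ifs <;> simp
  out s j hj := by
    have : j ≠ ⟨i, hi⟩ := by rintro rfl; simp at hj
    split_ifs <;> simp [this]
  upd t ht s b := by
    simp only [hA t ht s b]
    split_ifs
    · rw [Function.update_comm (by simp)]
      simp
    · rfl

/-- Every node of the formula gets its own work qubit, in postorder, so the values of subformulas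
survive until they are used, and the value of `φ` ends up in the last qubit of the window. Hence
`φ.size` counts the work qubits and, up to the factor five of a Toffoli gate, bounds the gates. -/
lemma exists_compile (φ : Form κ) (i : ℕ) (h : i + φ.size ≤ w) :
    ∃ (c : List (Gate nt N np (κ ⊕ Fin w))) (f : (κ ⊕ Fin w → Bool) → κ ⊕ Fin w → Bool)
      (top : Fin w), (top : ℕ) + 1 = i + φ.size ∧
      WorkCirc {t | φ.Avoids t} i φ.size c f ∧ c.length ≤ 5 * φ.size ∧
      ∀ s, (∀ j : Fin w, i ≤ j → (j : ℕ) < i + φ.size → s (Sum.inr j) = false) →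
        f s (Sum.inr top) = φ.eval (fun k => s (Sum.inl k)) := by
  induction φ generalizing i with
  | var k =>
    simp only [Form.size] at h ⊢
    obtain ⟨c, hl, hc⟩ := exists_performs_two nt N np (κ := κ ⊕ Fin w) (a := Sum.inl k)
      (t := Sum.inr ⟨i, h⟩) (by simp) pauliX_mem
    refine ⟨c, _, ⟨i, h⟩, rfl, WorkCirc.flip h hc (fun s b => by simp) ?_, by omega, ?_⟩
    · intro t ht s b
      have : k ≠ t := ht
      simp [this]
    · intro s hs
      have := hs ⟨i, h⟩ le_rfl (by simp)
      by_cases hk : s (Sum.inl k) <;> simp [hk, this, Form.eval]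
  | tru =>
    simp only [Form.size] at h ⊢
    obtain ⟨c, hl, hc⟩ := exists_performs_one nt N np (κ := κ ⊕ Fin w)
      (Sum.inr ⟨i, h⟩) pauliX_mem
    refine ⟨c, _, ⟨i, h⟩, rfl, WorkCirc.flip h hc (fun s b => by simp) ?_, by omega, ?_⟩
    · intro t ht s b
      rfl
    · intro s hs
      have := hs ⟨i, h⟩ le_rfl (by simp)
      simp [this, Form.eval]
  | not φ ih =>
    simp only [Form.size] at h ⊢
    obtain ⟨c, f, top, htop, hc, hl, hv⟩ := ih i (by omega)
    have hlt : i + φ.size < w := by omega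
    have hne : top ≠ ⟨i + φ.size, hlt⟩ := by rintro rfl; simp at htop
    obtain ⟨c1, hl1, hc1⟩ := exists_performs_two nt N np (κ := κ ⊕ Fin w) (a := Sum.inr top)
      (t := Sum.inr ⟨i + φ.size, hlt⟩) (by simpa using hne) pauliX_mem
    obtain ⟨c2, hl2, hc2⟩ := exists_performs_one nt N np (κ := κ ⊕ Fin w)
      (Sum.inr ⟨i + φ.size, hlt⟩) pauliX_mem
    have w1 := WorkCirc.flip (A := {t | φ.Avoids t}) hlt hc1 (fun s b => by simp [hne])
      (fun t ht s b => by simp)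
    have w2 := WorkCirc.flip (A := {t | φ.Avoids t}) hlt hc2 (fun s b => by simp)
      (fun t ht s b => by simp)
    -- Both pieces write to the same work qubit, so `WorkCirc.trans`, which moves the window on,
    -- does not apply.
    have w12 : WorkCirc {t | φ.Avoids t} (i + φ.size) 1 (c1 ++ c2) _ :=
      { prim := fun g hg => (List.mem_append.1 hg).elim (w1.prim g) (w2.prim g)
        unitary := fun OH Of => by
          rw [gatesOp_append]; exact mul_mem (w2.unitary OH Of) (w1.unitary OH Of)
        ket := fun OH Of s => by rw [gatesOp_append, ← mulVec_mulVec, w1.ket, w2.ket]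
        inl := fun s k => by rw [w2.inl, w1.inl]
        out := fun s j hj => by rw [w2.out _ _ hj, w1.out _ _ hj]
        upd := fun t ht s b => by rw [w1.upd t ht, w2.upd t ht] }
    refine ⟨c ++ (c1 ++ c2), _, ⟨i + φ.size, hlt⟩, by simp; omega, hc.trans w12 rfl,
      by simp; omega, ?_⟩
    intro s hs
    have h1 := hv s fun j h1 h2 => hs j h1 (by omega)
    have h2 : f s (Sum.inr ⟨i + φ.size, hlt⟩) = false := by
      rw [hc.out _ _ (by simp), hs _ (by simp) (by simp)]
    by_cases hk : φ.eval (fun k => s (Sum.inl k)) <;>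
      simp [h1, h2, hk, Form.eval]
  | and φ ψ ih ih' =>
    simp only [Form.size] at h ⊢
    obtain ⟨c, f, top, htop, hc, hl, hv⟩ := ih i (by omega)
    obtain ⟨c', f', top', htop', hc', hl', hv'⟩ := ih' (i + φ.size) (by omega)
    have hlt : i + φ.size + ψ.size < w := by omega
    have hn := φ.size.zero_le
    have hpos : 0 < ψ.size := by cases ψ <;> simp [Form.size]
    have hne : top ≠ ⟨i + φ.size + ψ.size, hlt⟩ := by rintro rfl; simp at htop; omega
    have hne' : top' ≠ ⟨i + φ.size + ψ.size, hlt⟩ := by rintro rfl; simp at htop'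
    have hne2 : top ≠ top' := by rintro rfl; omega
    obtain ⟨c1, hl1, hc1⟩ := exists_performs_toffoli nt N np (κ := κ ⊕ Fin w) (a := Sum.inr top)
      (b := Sum.inr top') (t := Sum.inr ⟨i + φ.size + ψ.size, hlt⟩) (by simpa using hne2)
      (by simpa using hne) (by simpa using hne')
    have w1 := WorkCirc.flip (A := {t | (φ.and ψ).Avoids t}) hlt hc1
      (fun s b => by simp [hne, hne']) (fun t ht s b => by simp)
    have w0 := (hc.mono (B := {t | (φ.and ψ).Avoids t}) fun t ht => ht.1).trans
      (hc'.mono (B := {t | (φ.and ψ).Avoids t}) fun t ht => ht.2) rfl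
    refine ⟨(c ++ c') ++ c1, _, ⟨i + φ.size + ψ.size, hlt⟩, by simp; omega, w0.trans w1 (add_assoc _ _ _),
      by simp; omega, ?_⟩
    intro s hs
    have h1 := hv s fun j h1 h2 => hs j h1 (by omega)
    have h1' : f' (f s) (Sum.inr top) = φ.eval (fun k => s (Sum.inl k)) := by
      rw [hc'.out _ _ (by omega), h1]
    have h2 : f' (f s) (Sum.inr top') = ψ.eval (fun k => s (Sum.inl k)) := by
      rw [hv' (f s) fun j h1 h2 => ?_]
      · simp_rw [hc.inl]
      · rw [hc.out _ _ (by omega), hs _ (by omega) (by omega)]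
    have h3 : f' (f s) (Sum.inr ⟨i + φ.size + ψ.size, hlt⟩) = false := by
      rw [hc'.out _ _ (Or.inr le_rfl), hc.out _ _ (Or.inr (by dsimp only; omega)),
        hs _ (by dsimp only; omega) (by dsimp only; omega)]
    by_cases hk : φ.eval (fun k => s (Sum.inl k)) <;>
      by_cases hk' : ψ.eval (fun k => s (Sum.inl k)) <;>
      simp [h1', h2, h3, hk, hk', Form.eval]
  | xor φ ψ ih ih' =>
    simp only [Form.size] at h ⊢
    obtain ⟨c, f, top, htop, hc, hl, hv⟩ := ih i (by omega)
    obtain ⟨c', f', top', htop', hc', hl', hv'⟩ := ih' (i + φ.size) (by omega)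
    have hlt : i + φ.size + ψ.size < w := by omega
    have hpos : 0 < ψ.size := by cases ψ <;> simp [Form.size]
    have hne : top ≠ ⟨i + φ.size + ψ.size, hlt⟩ := by rintro rfl; simp at htop; omega
    have hne' : top' ≠ ⟨i + φ.size + ψ.size, hlt⟩ := by rintro rfl; simp at htop'
    obtain ⟨c1, hl1, hc1⟩ := exists_performs_two nt N np (κ := κ ⊕ Fin w) (a := Sum.inr top)
      (t := Sum.inr ⟨i + φ.size + ψ.size, hlt⟩) (by simpa using hne) pauliX_mem
    obtain ⟨c2, hl2, hc2⟩ := exists_performs_two nt N np (κ := κ ⊕ Fin w) (a := Sum.inr top')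
      (t := Sum.inr ⟨i + φ.size + ψ.size, hlt⟩) (by simpa using hne') pauliX_mem
    -- `Avoids` unfolds to the same conjunction for `and` and for `xor`.
    have w1 := WorkCirc.flip (A := {t | (φ.and ψ).Avoids t}) hlt hc1 (fun s b => by simp [hne])
      (fun t ht s b => by simp)
    have w2 := WorkCirc.flip (A := {t | (φ.and ψ).Avoids t}) hlt hc2 (fun s b => by simp [hne'])
      (fun t ht s b => by simp)
    have w12 : WorkCirc {t | (φ.and ψ).Avoids t} (i + φ.size + ψ.size) 1 (c1 ++ c2) _ :=
      { prim := fun g hg => (List.mem_append.1 hg).elim (w1.prim g) (w2.prim g)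
        unitary := fun OH Of => by
          rw [gatesOp_append]; exact mul_mem (w2.unitary OH Of) (w1.unitary OH Of)
        ket := fun OH Of s => by rw [gatesOp_append, ← mulVec_mulVec, w1.ket, w2.ket]
        inl := fun s k => by rw [w2.inl, w1.inl]
        out := fun s j hj => by rw [w2.out _ _ hj, w1.out _ _ hj]
        upd := fun t ht s b => by rw [w1.upd t ht, w2.upd t ht] }
    have w0 := (hc.mono (B := {t | (φ.and ψ).Avoids t}) fun t ht => ht.1).trans
      (hc'.mono (B := {t | (φ.and ψ).Avoids t}) fun t ht => ht.2) rfl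
    refine ⟨(c ++ c') ++ (c1 ++ c2), _, ⟨i + φ.size + ψ.size, hlt⟩, by simp; omega,
      w0.trans w12 (add_assoc _ _ _), by simp; omega, ?_⟩
    intro s hs
    have h1 := hv s fun j h1 h2 => hs j h1 (by omega)
    have h1' : f' (f s) (Sum.inr top) = φ.eval (fun k => s (Sum.inl k)) := by
      rw [hc'.out _ _ (by omega), h1]
    have h2 : f' (f s) (Sum.inr top') = ψ.eval (fun k => s (Sum.inl k)) := by
      rw [hv' (f s) fun j h1 h2 => ?_]
      · simp_rw [hc.inl]
      · rw [hc.out _ _ (by omega), hs _ (by omega) (by omega)]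
    have h3 : f' (f s) (Sum.inr ⟨i + φ.size + ψ.size, hlt⟩) = false := by
      rw [hc'.out _ _ (Or.inr le_rfl), hc.out _ _ (Or.inr (by dsimp only; omega)),
        hs _ (by dsimp only; omega) (by dsimp only; omega)]
    by_cases hk : φ.eval (fun k => s (Sum.inl k)) <;>
      by_cases hk' : ψ.eval (fun k => s (Sum.inl k)) <;>
      simp [h1', h2, h3, hk, hk', Form.eval, hne']

end Compile

/-! ### Operators implemented with clean work qubits. -/

section Impl

variable {nt N np : ℕ} {κ : Type} [Fintype κ] [DecidableEq κ] {w : ℕ}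

/-- The basis state `s` together with clean work qubits. -/
def clean (w : ℕ) (s : κ → Bool) : κ ⊕ Fin w → Bool := Sum.elim s fun _ => false

/-- The isometry that appends clean work qubits. -/
def cleanEmb (κ : Type) [Fintype κ] [DecidableEq κ] (w : ℕ) :
    Matrix (κ ⊕ Fin w → Bool) (κ → Bool) ℂ :=
  fun x y => if x = clean w y then 1 else 0

lemma clean_injective : Function.Injective (clean w : (κ → Bool) → κ ⊕ Fin w → Bool) := by
  intro s t h
  ext k
  simpa [clean] using congrFun h (Sum.inl k)

lemma cleanEmb_mulVec_ket (s : κ → Bool) : cleanEmb κ w *ᵥ ket s = ket (clean w s) := by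
  ext x
  rw [mulVec_ket, ket_apply, cleanEmb]

lemma cleanEmb_conjTranspose_mul : (cleanEmb κ w)ᴴ * cleanEmb κ w = 1 := by
  ext x y
  simp [Matrix.mul_apply, cleanEmb, Matrix.one_apply, clean_injective.eq_iff, eq_comm]

/-- The operator `F`, which depends on the oracles, is performed by a circuit with at most `Q`
queries and at most `G` primitive gates on the qubits `κ` and `w` clean work qubits. -/
def Impl (w : ℕ) (F : QOp (HWire nt N np) → QOp (FWire nt N) → QOp κ) (Q G : ℕ) : Prop :=
  ∃ c : List (Gate nt N np (κ ⊕ Fin w)), c.countP (fun g => g.isQuery) ≤ Q ∧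
    c.countP (fun g => !g.isQuery) ≤ G ∧
    ∀ OH ∈ unitaryGroup (HWire nt N np → Bool) ℂ, ∀ Of ∈ unitaryGroup (FWire nt N → Bool) ℂ,
      gatesOp OH Of c ∈ unitaryGroup (κ ⊕ Fin w → Bool) ℂ ∧
      gatesOp OH Of c * cleanEmb κ w = cleanEmb κ w * F OH Of

variable {F F' : QOp (HWire nt N np) → QOp (FWire nt N) → QOp κ} {Q Q' G G' : ℕ}

lemma Impl.mono (h : Impl w F Q G) (hQ : Q ≤ Q') (hG : G ≤ G') : Impl w F Q' G' := by
  obtain ⟨c, h1, h2, h3⟩ := h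
  exact ⟨c, h1.trans hQ, h2.trans hG, h3⟩

lemma Impl.mul (h : Impl w F Q G) (h' : Impl w F' Q' G') :
    Impl w (fun OH Of => F OH Of * F' OH Of) (Q + Q') (G + G') := by
  obtain ⟨c, h1, h2, h3⟩ := h
  obtain ⟨c', h1', h2', h3'⟩ := h'
  refine ⟨c' ++ c, by simp; omega, by simp only [List.countP_append]; omega, ?_⟩
  intro OH hOH Of hOf
  rw [gatesOp_append]
  refine ⟨mul_mem (h3 OH hOH Of hOf).1 (h3' OH hOH Of hOf).1, ?_⟩
  rw [Matrix.mul_assoc, (h3' OH hOH Of hOf).2, ← Matrix.mul_assoc, (h3 OH hOH Of hOf).2,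
    Matrix.mul_assoc]

lemma Impl.one : Impl w (fun (_ : QOp (HWire nt N np)) (_ : QOp (FWire nt N)) => (1 : QOp κ))
    0 0 :=
  ⟨[], by simp, by simp, fun _ _ _ _ => by simp [gatesOp]⟩

/-- The circuit is unitary and `cleanEmb` is an isometry, so being implemented already forces `F OH
Of` to be an isometry. The unitarity of the large composite operators is obtained in this way. -/
lemma Impl.conjTranspose_mul_self (h : Impl w F Q G)
    {OH : QOp (HWire nt N np)} (hOH : OH ∈ unitaryGroup (HWire nt N np → Bool) ℂ)
    {Of : QOp (FWire nt N)} (hOf : Of ∈ unitaryGroup (FWire nt N → Bool) ℂ) :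
    (F OH Of)ᴴ * F OH Of = 1 := by
  obtain ⟨c, -, -, h3⟩ := h
  obtain ⟨hu, h4⟩ := h3 OH hOH Of hOf
  rw [mem_unitaryGroup_iff', star_eq_conjTranspose] at hu
  have := congrArg (fun A => Aᴴ * A) h4
  simp only [conjTranspose_mul] at this
  rw [Matrix.mul_assoc, ← Matrix.mul_assoc (gatesOp OH Of c)ᴴ, hu, Matrix.one_mul,
    cleanEmb_conjTranspose_mul, Matrix.mul_assoc, ← Matrix.mul_assoc (cleanEmb κ w)ᴴ,
    cleanEmb_conjTranspose_mul, Matrix.one_mul] at this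
  exact this.symm

/-- The reversed circuit also returns the work qubits clean, because the isometry `F OH Of` is
square and therefore invertible. -/
lemma Impl.adj (h : Impl w F Q G) : Impl w (fun OH Of => (F OH Of)ᴴ) Q G := by
  have h' := h
  obtain ⟨c, h1, h2, h3⟩ := h
  refine ⟨invGates c, by rwa [(countP_invGates c).1], by rwa [(countP_invGates c).2], ?_⟩
  intro OH hOH Of hOf
  obtain ⟨hu, h4⟩ := h3 OH hOH Of hOf
  rw [gatesOp_invGates]
  refine ⟨by rw [← star_eq_conjTranspose]; exact Unitary.star_mem hu, ?_⟩
  have hF : F OH Of * (F OH Of)ᴴ = 1 := mul_eq_one_comm.1 (h'.conjTranspose_mul_self hOH hOf)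
  rw [mem_unitaryGroup_iff', star_eq_conjTranspose] at hu
  calc (gatesOp OH Of c)ᴴ * cleanEmb κ w
      = (gatesOp OH Of c)ᴴ * (cleanEmb κ w * F OH Of) * (F OH Of)ᴴ := by
        rw [Matrix.mul_assoc, Matrix.mul_assoc, hF, Matrix.mul_one]
    _ = cleanEmb κ w * (F OH Of)ᴴ := by
        rw [← h4, ← Matrix.mul_assoc, hu, Matrix.one_mul]

lemma extend_inl_clean {ι : Type} (e : ι ↪ κ) (a : ι → Bool) (s : κ → Bool) :
    Function.extend (e.trans Function.Embedding.inl) a (clean w s) =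
      clean w (Function.extend e a s) := by
  ext k
  by_cases h : ∃ i, (e.trans Function.Embedding.inl) i = k
  · obtain ⟨i, rfl⟩ := h
    rw [(e.trans Function.Embedding.inl).injective.extend_apply]
    simp [clean, e.injective.extend_apply]
  · rw [Function.extend_apply' _ _ _ h]
    rcases k with k | k
    · simp only [clean, Sum.elim_inl]
      rw [Function.extend_apply']
      rintro ⟨i, rfl⟩
      exact h ⟨i, rfl⟩
    · simp [clean]

lemma place_inl_mul_cleanEmb {ι : Type} [Fintype ι] [DecidableEq ι] (e : ι ↪ κ) (A : QOp ι) :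
    (place (e.trans Function.Embedding.inl) A : QOp (κ ⊕ Fin w)) * cleanEmb κ w = cleanEmb κ w * place e A := by
  refine ext_ket fun s => ?_
  rw [← mulVec_mulVec, ← mulVec_mulVec, cleanEmb_mulVec_ket, place_mulVec_ket, place_mulVec_ket,
    mulVec_sum_smul_ket]
  simp_rw [cleanEmb_mulVec_ket, extend_inl_clean]
  rfl

lemma dagIf_mem_unitary {ι : Type} [Fintype ι] [DecidableEq ι] {A : QOp ι}
    (hA : A ∈ unitaryGroup (ι → Bool) ℂ) (adj : Bool) :
    dagIf adj A ∈ unitaryGroup (ι → Bool) ℂ := by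
  cases adj
  · exact hA
  · exact Unitary.star_mem hA

lemma Impl.queryH (adj : Bool) (e : HWire nt N np ↪ κ) :
    Impl w (fun OH (_ : QOp (FWire nt N)) => place e (dagIf adj OH)) 1 0 := by
  refine ⟨[.queryH adj (e.trans Function.Embedding.inl)], by simp [Gate.isQuery],
    by simp [Gate.isQuery], fun OH hOH Of hOf => ?_⟩
  simp only [gatesOp, Gate.op, Matrix.one_mul]
  exact ⟨place_mem_unitary _ (dagIf_mem_unitary hOH adj), place_inl_mul_cleanEmb e _⟩

lemma Impl.queryF (adj : Bool) (e : FWire nt N ↪ κ) :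
    Impl w (fun (_ : QOp (HWire nt N np)) Of => place e (dagIf adj Of)) 1 0 := by
  refine ⟨[.queryF adj (e.trans Function.Embedding.inl)], by simp [Gate.isQuery],
    by simp [Gate.isQuery], fun OH hOH Of hOf => ?_⟩
  simp only [gatesOp, Gate.op, Matrix.one_mul]
  exact ⟨place_mem_unitary _ (dagIf_mem_unitary hOf adj), place_inl_mul_cleanEmb e _⟩

lemma Form.size_pos (φ : Form κ) : 0 < φ.size := by cases φ <;> simp [Form.size]

lemma countP_of_prim {c : List (Gate nt N np κ)} (h : ∀ g ∈ c, g.isQuery = false) :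
    c.countP (fun g => g.isQuery) = 0 ∧ c.countP (fun g => !g.isQuery) = c.length :=
  ⟨List.countP_eq_zero.2 fun g hg => by simp [h g hg],
    List.countP_eq_length.2 fun g hg => by simp [h g hg]⟩

/-- Compute, act, uncompute. The hypothesis `h` says that `g` acts on the computed state as `M`
would before the computation. -/
lemma impl_conj {c g : List (Gate nt N np (κ ⊕ Fin w))} {M : QOp κ}
    (hc : ∀ g ∈ c, g.isQuery = false) (hg : ∀ h ∈ g, h.isQuery = false)
    (hcu : ∀ OH Of, gatesOp OH Of c ∈ unitaryGroup (κ ⊕ Fin w → Bool) ℂ)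
    (hgu : ∀ OH Of, gatesOp OH Of g ∈ unitaryGroup (κ ⊕ Fin w → Bool) ℂ)
    (h : ∀ OH Of s, gatesOp OH Of g *ᵥ gatesOp OH Of c *ᵥ ket (clean w s) =
      gatesOp OH Of c *ᵥ cleanEmb κ w *ᵥ M *ᵥ ket s) :
    Impl w (fun (_ : QOp (HWire nt N np)) (_ : QOp (FWire nt N)) => M) 0
      (2 * c.length + g.length) := by
  refine ⟨(c ++ g) ++ invGates c, ?_, ?_, fun OH _ Of _ => ⟨?_, ?_⟩⟩
  · simp only [List.countP_append, (countP_invGates c).1, (countP_of_prim hc).1,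
      (countP_of_prim hg).1]
    rfl
  · simp only [List.countP_append, (countP_invGates c).2, (countP_of_prim hc).2,
      (countP_of_prim hg).2]
    omega
  · rw [gatesOp_append, gatesOp_append, gatesOp_invGates, ← star_eq_conjTranspose]
    exact mul_mem (Unitary.star_mem (hcu OH Of)) (mul_mem (hgu OH Of) (hcu OH Of))
  · refine ext_ket fun s => ?_
    rw [gatesOp_append, gatesOp_append, gatesOp_invGates, ← mulVec_mulVec, ← mulVec_mulVec,
      ← mulVec_mulVec, cleanEmb_mulVec_ket, h, mulVec_mulVec]
    have := mem_unitaryGroup_iff'.1 (hcu OH Of)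
    rw [star_eq_conjTranspose] at this
    rw [this, one_mulVec, mulVec_mulVec]

lemma Impl.cOp (φ : Form κ) (t : κ) (ht : φ.Avoids t) (hw : φ.size ≤ w)
    {U : Matrix Bool Bool ℂ} (hU : U ∈ unitaryGroup Bool ℂ) :
    Impl w (fun (_ : QOp (HWire nt N np)) (_ : QOp (FWire nt N)) =>
      cOp (fun s => φ.eval s) t U) 0 (11 * φ.size) := by
  obtain ⟨c, f, top, -, hc, hl, hv⟩ := exists_compile (nt := nt) (N := N) (np := np) φ 0
    (w := w) (by simpa using hw)
  obtain ⟨g, hgl, hg⟩ := exists_performs_two nt N np (κ := κ ⊕ Fin w) (a := Sum.inr top)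
      (t := Sum.inl t) (by simp) hU
  -- Two passes of at most `5 * φ.size` gates and one gate in between; this is at most `11 * φ.size`
  -- because a formula has at least one node.
  refine (impl_conj hc.prim hg.prim hc.unitary
    (fun OH Of => by rw [hg.op]; exact cOp_mem_unitary (fun _ _ => by simp) hU)
    fun OH Of s => ?_).mono le_rfl (by have := φ.size_pos; omega)
  have htop : f (clean w s) (Sum.inr top) = φ.eval s := by
    rw [hv _ fun j _ _ => rfl]; rfl
  rw [hc.ket, hg.op, cOp_mulVec_ket, cOp_mulVec_ket, htop, hc.inl]
  split_ifs
  · rw [mulVec_sum_smul_ket]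
    simp_rw [cleanEmb_mulVec_ket]
    rw [mulVec_sum_smul_ket]
    simp_rw [hc.ket]
    refine Finset.sum_congr rfl fun b _ => ?_
    -- As `φ` does not mention `t`, the work qubits still hold the right values after `t` has
    -- changed, so they can be uncomputed.
    rw [← hc.upd t ht]
    congr 3
    ext k
    rcases k with k | k
    · simp [clean, Function.update_apply]
    · simp [clean]
  · rw [cleanEmb_mulVec_ket, hc.ket]

/-- The diagonal operator that multiplies the basis states satisfying `ψ` by `z`. -/
def phaseOp (ψ : (κ → Bool) → Bool) (z : ℂ) : QOp κ := diagonal fun s => if ψ s then z else 1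

lemma phaseOp_mulVec_ket (ψ : (κ → Bool) → Bool) (z : ℂ) (s : κ → Bool) :
    phaseOp ψ z *ᵥ ket s = (if ψ s then z else 1) • ket s := by
  ext x
  rw [mulVec_ket, phaseOp, diagonal_apply]
  simp only [Pi.smul_apply, ket_apply, smul_eq_mul, mul_ite, mul_one, mul_zero]
  split_ifs <;> simp_all

/-- The phase is put on the work qubit that holds the truth value. There is no target qubit, so `φ`
may mention all qubits. -/
lemma Impl.phase (φ : Form κ) (hw : φ.size ≤ w) {z : ℂ} (hz : z * star z = 1) :
    Impl w (fun (_ : QOp (HWire nt N np)) (_ : QOp (FWire nt N)) =>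
      phaseOp (fun s => φ.eval s) z) 0 (11 * φ.size) := by
  obtain ⟨c, f, top, -, hc, hl, hv⟩ := exists_compile (nt := nt) (N := N) (np := np) φ 0
    (w := w) (by simpa using hw)
  have hU : (diagonal fun b : Bool => if b then z else 1) ∈ unitaryGroup Bool ℂ := by
    rw [mem_unitaryGroup_iff, star_eq_conjTranspose, diagonal_conjTranspose, diagonal_mul_diagonal,
      ← diagonal_one]
    congr 1
    ext b
    cases b <;> simp
    simpa using hz
  obtain ⟨g, hgl, hg⟩ := exists_performs_one nt N np (κ := κ ⊕ Fin w) (Sum.inr top) hU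
  refine (impl_conj hc.prim hg.prim hc.unitary
    (fun OH Of => by rw [hg.op]; exact cOp_mem_unitary (fun _ _ => by simp) hU)
    fun OH Of s => ?_).mono le_rfl (by have := φ.size_pos; omega)
  have htop : f (clean w s) (Sum.inr top) = φ.eval s := by
    rw [hv _ fun j _ _ => rfl]; rfl
  rw [hc.ket, hg.op, cOp_mulVec_ket, phaseOp_mulVec_ket, mulVec_smul, mulVec_smul,
    cleanEmb_mulVec_ket, hc.ket, if_pos rfl, ← htop,
    Finset.sum_eq_single (f (clean w s) (Sum.inr top))]
  · simp
  · intro b _ hb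
    simp [hb]
  · simp

end Impl

/-! ### Operators controlled by the basis state of further qubits. -/

section CtrlLift

variable {ρ β : Type} [Fintype ρ] [DecidableEq ρ] [Fintype β] [DecidableEq β]

/-- The operator on the qubits `ρ` and `β` that applies `u b` to the qubits `ρ` if the qubits `β`
are in the basis state `b`. -/
def ctrlLift (u : (β → Bool) → QOp ρ) : QOp (ρ ⊕ β) :=
  fun x y => if x ∘ Sum.inr = y ∘ Sum.inr then u (y ∘ Sum.inr) (x ∘ Sum.inl) (y ∘ Sum.inl) else 0

lemma elim_eq_iff (x : ρ ⊕ β → Bool) (a : ρ → Bool) (b : β → Bool) :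
    x = Sum.elim a b ↔ x ∘ Sum.inl = a ∧ x ∘ Sum.inr = b := by
  constructor
  · rintro rfl; exact ⟨rfl, rfl⟩
  · rintro ⟨rfl, rfl⟩; exact (Sum.elim_comp_inl_inr x).symm

lemma ctrlLift_mulVec_ket (u : (β → Bool) → QOp ρ) (s : ρ ⊕ β → Bool) :
    ctrlLift u *ᵥ ket s =
      ∑ a, u (s ∘ Sum.inr) a (s ∘ Sum.inl) • ket (Sum.elim a (s ∘ Sum.inr)) := by
  ext x
  rw [mulVec_ket]
  simp only [ctrlLift, Finset.sum_apply, Pi.smul_apply, ket_apply, elim_eq_iff, smul_eq_mul,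
    mul_ite, mul_one, mul_zero]
  split_ifs with h
  · rw [Finset.sum_eq_single (x ∘ Sum.inl)]
    · rw [if_pos ⟨rfl, h⟩]
    · exact fun a _ ha => if_neg fun h' => ha h'.1.symm
    · exact fun h' => (h' (Finset.mem_univ _)).elim
  · exact (Finset.sum_eq_zero fun a _ => if_neg fun h' => h h'.2).symm

lemma ctrlLift_mul (u v : (β → Bool) → QOp ρ) :
    ctrlLift u * ctrlLift v = ctrlLift fun b => u b * v b := by
  refine ext_ket fun s => ?_
  rw [← mulVec_mulVec, ctrlLift_mulVec_ket, mulVec_sum_smul_ket, ctrlLift_mulVec_ket]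
  simp_rw [ctrlLift_mulVec_ket, Finset.smul_sum, smul_smul, Matrix.mul_apply, Finset.sum_smul,
    Sum.elim_comp_inl, Sum.elim_comp_inr]
  rw [Finset.sum_comm]
  simp_rw [mul_comm]

lemma ctrlLift_one : ctrlLift (fun _ : β → Bool => (1 : QOp ρ)) = 1 := by
  refine ext_ket fun s => ?_
  rw [ctrlLift_mulVec_ket]
  simp [Matrix.one_apply, ite_smul]

lemma ctrlLift_conjTranspose (u : (β → Bool) → QOp ρ) :
    (ctrlLift u)ᴴ = ctrlLift fun b => (u b)ᴴ := by
  ext x y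
  simp only [conjTranspose_apply, ctrlLift]
  by_cases h : x ∘ Sum.inr = y ∘ Sum.inr
  · rw [if_pos h, if_pos h.symm, h]
  · rw [if_neg h, if_neg (Ne.symm h), star_zero]

lemma update_inl_eq_elim (s : ρ ⊕ β → Bool) (t : ρ) (c : Bool) :
    Function.update s (Sum.inl t) c =
      Sum.elim (Function.update (s ∘ Sum.inl) t c) (s ∘ Sum.inr) := by
  rw [elim_eq_iff]
  constructor
  · ext k
    simp [Function.update_apply]
  · ext k
    simp

lemma cOp_inl (ψ : (ρ ⊕ β → Bool) → Bool) (t : ρ) (U : Matrix Bool Bool ℂ) :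
    cOp ψ (Sum.inl t) U = ctrlLift fun b => cOp (fun s => ψ (Sum.elim s b)) t U := by
  refine ext_ket fun s => ?_
  rw [cOp_mulVec_ket, ctrlLift_mulVec_ket]
  simp_rw [← mulVec_ket (cOp _ _ _), cOp_mulVec_ket, Sum.elim_comp_inl_inr]
  split_ifs
  · simp_rw [Finset.sum_apply, Finset.sum_smul, Pi.smul_apply, ket_apply, smul_eq_mul, mul_ite,
      mul_one, mul_zero]
    rw [Finset.sum_comm]
    simp only [update_inl_eq_elim, ite_smul, zero_smul, Finset.sum_ite_eq', Finset.mem_univ,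
      if_true]
    rfl
  · simp_rw [ket_apply, ite_smul]
    simp

lemma phaseOp_eq_ctrlLift (ψ : (ρ ⊕ β → Bool) → Bool) (z : ℂ) :
    phaseOp ψ z = ctrlLift fun b => phaseOp (fun s => ψ (Sum.elim s b)) z := by
  refine ext_ket fun s => ?_
  rw [phaseOp_mulVec_ket, ctrlLift_mulVec_ket]
  simp_rw [← mulVec_ket (phaseOp _ _), phaseOp_mulVec_ket, Sum.elim_comp_inl_inr, Pi.smul_apply,
    ket_apply, smul_eq_mul, mul_ite, mul_one, mul_zero, ite_smul]
  simp

lemma extend_inl_eq_elim {ι : Type} (e : ι ↪ ρ) (a : ι → Bool) (s : ρ ⊕ β → Bool) :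
    Function.extend (e.trans Function.Embedding.inl) a s =
      Sum.elim (Function.extend e a (s ∘ Sum.inl)) (s ∘ Sum.inr) := by
  ext k
  by_cases h : ∃ i, (e.trans Function.Embedding.inl) i = k
  · obtain ⟨i, rfl⟩ := h
    rw [(e.trans Function.Embedding.inl).injective.extend_apply]
    simp [e.injective.extend_apply]
  · rw [Function.extend_apply' _ _ _ h]
    rcases k with k | k
    · simp only [Sum.elim_inl]
      rw [Function.extend_apply']
      · rfl
      · rintro ⟨i, rfl⟩
        exact h ⟨i, rfl⟩
    · simp

lemma place_inl {ι : Type} [Fintype ι] [DecidableEq ι] (e : ι ↪ ρ) (A : QOp ι) :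
    place (e.trans (Function.Embedding.inl : ρ ↪ ρ ⊕ β)) A = ctrlLift fun _ => place e A := by
  refine ext_ket fun s => ?_
  rw [place_mulVec_ket, ctrlLift_mulVec_ket]
  simp_rw [← mulVec_ket (place e A), place_mulVec_ket, Finset.sum_apply, Finset.sum_smul,
    Pi.smul_apply, ket_apply, smul_eq_mul, mul_ite, mul_one, mul_zero]
  rw [Finset.sum_comm]
  simp [ite_smul, extend_inl_eq_elim]
  rfl

variable {nt N np : ℕ} {w : ℕ}

/-- The operators `u OH Of b` on the qubits `ρ`, controlled by the state `b` of the qubits `β`, are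
performed by a circuit with the given numbers of queries and primitive gates. -/
def CImpl (w : ℕ) (u : QOp (HWire nt N np) → QOp (FWire nt N) → (β → Bool) → QOp ρ)
    (Q G : ℕ) : Prop :=
  Impl w (fun OH Of => ctrlLift (u OH Of)) Q G

variable {u v : QOp (HWire nt N np) → QOp (FWire nt N) → (β → Bool) → QOp ρ} {Q Q' G G' : ℕ}

lemma CImpl.mono (h : CImpl w u Q G) (hQ : Q ≤ Q') (hG : G ≤ G') : CImpl w u Q' G' :=
  Impl.mono h hQ hG

lemma CImpl.mul (h : CImpl w u Q G) (h' : CImpl w v Q' G') :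
    CImpl w (fun OH Of b => u OH Of b * v OH Of b) (Q + Q') (G + G') := by
  have := Impl.mul h h'
  simp_rw [ctrlLift_mul] at this
  exact this

lemma CImpl.adj (h : CImpl w u Q G) : CImpl w (fun OH Of b => (u OH Of b)ᴴ) Q G := by
  have := Impl.adj h
  simp_rw [ctrlLift_conjTranspose] at this
  exact this

lemma CImpl.one : CImpl w (fun (_ : QOp (HWire nt N np)) (_ : QOp (FWire nt N)) (_ : β → Bool) =>
    (1 : QOp ρ)) 0 0 := by
  unfold CImpl
  simp_rw [ctrlLift_one]
  exact Impl.one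

lemma CImpl.cOp (φ : Form (ρ ⊕ β)) (t : ρ) (ht : φ.Avoids (Sum.inl t)) (hw : φ.size ≤ w)
    {U : Matrix Bool Bool ℂ} (hU : U ∈ unitaryGroup Bool ℂ) :
    CImpl w (fun (_ : QOp (HWire nt N np)) (_ : QOp (FWire nt N)) (b : β → Bool) =>
      cOp (fun s => φ.eval (Sum.elim s b)) t U) 0 (11 * φ.size) := by
  unfold CImpl
  simp_rw [← cOp_inl (fun s => φ.eval s)]
  exact Impl.cOp φ _ ht hw hU

lemma CImpl.phase (φ : Form (ρ ⊕ β)) (hw : φ.size ≤ w) {z : ℂ} (hz : z * star z = 1) :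
    CImpl w (fun (_ : QOp (HWire nt N np)) (_ : QOp (FWire nt N)) (b : β → Bool) =>
      phaseOp (fun s => φ.eval (Sum.elim s b)) z) 0 (11 * φ.size) := by
  unfold CImpl
  simp_rw [← phaseOp_eq_ctrlLift (fun s => φ.eval s)]
  exact Impl.phase φ hw hz

lemma CImpl.queryH (adj : Bool) (e : HWire nt N np ↪ ρ) :
    CImpl w (fun OH (_ : QOp (FWire nt N)) (_ : β → Bool) => place e (dagIf adj OH)) 1 0 := by
  unfold CImpl
  simp_rw [← place_inl]
  exact Impl.queryH adj _

lemma CImpl.queryF (adj : Bool) (e : FWire nt N ↪ ρ) :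
    CImpl w (fun (_ : QOp (HWire nt N np)) Of (_ : β → Bool) => place e (dagIf adj Of)) 1 0 := by
  unfold CImpl
  simp_rw [← place_inl]
  exact Impl.queryF adj _

end CtrlLift

/-! ### Hadamard gates on many qubits. -/

section Hadamards

variable {ι : Type} [Fintype ι] [DecidableEq ι]

/-- Hadamard gates on the qubits in `S`. -/
noncomputable def hadPart (S : Finset ι) : QOp ι :=
  fun x y => ∏ i, if i ∈ S then hadamard (x i) (y i) else if x i = y i then 1 else 0

/-- Hadamard gates on all qubits. -/
noncomputable def hadAll (ι : Type) [Fintype ι] : QOp ι := fun x y => ∏ i, hadamard (x i) (y i)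

lemma hadPart_empty : hadPart (∅ : Finset ι) = 1 := by
  ext x y
  simp only [hadPart, Finset.notMem_empty, if_false, Matrix.one_apply, Fintype.prod_ite_zero,
    funext_iff]
  simp

lemma hadPart_univ : hadPart (Finset.univ : Finset ι) = hadAll ι := by
  ext x y
  simp [hadPart, hadAll]

/-- `hadPart` interpolates between the identity and `hadAll`, so that the layer can be built and its
gates counted one qubit at a time. -/
lemma hadPart_insert {S : Finset ι} {i : ι} (hi : i ∉ S) :
    hadPart (insert i S) = cOp (fun _ => true) i hadamard * hadPart S := by
  ext x y
  have key : ∀ c, hadPart S (Function.update x i c) y =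
      (if c = y i then 1 else 0) * ∏ j ∈ Finset.univ.erase i,
        if j ∈ S then hadamard (x j) (y j) else if x j = y j then 1 else 0 := by
    intro c
    rw [hadPart, ← Finset.mul_prod_erase _ _ (Finset.mem_univ i)]
    congr 1
    · simp [hi]
    · refine Finset.prod_congr rfl fun j hj => ?_
      simp [Finset.ne_of_mem_erase hj]
  have h2 : (cOp (fun _ => true) i hadamard * hadPart S) x y =
      ∑ c, hadamard (x i) c * hadPart S (Function.update x i c) y := by
    rw [← conjTranspose_conjTranspose (cOp _ _ _), cOp_conjTranspose (fun _ _ => rfl),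
      hadamard_conjTranspose, Matrix.mul_apply]
    simp_rw [conjTranspose_apply, ← mulVec_ket (cOp _ _ _), cOp_mulVec_ket, if_true,
      Finset.sum_apply, star_sum, Finset.sum_mul, Pi.smul_apply, ket_apply, smul_eq_mul,
      mul_ite, mul_one, mul_zero, apply_ite star, star_zero, ite_mul, zero_mul]
    rw [Finset.sum_comm]
    refine Finset.sum_congr rfl fun c _ => ?_
    rw [Finset.sum_ite_eq' Finset.univ, if_pos (Finset.mem_univ _)]
    congr 1
    rw [← conjTranspose_apply, hadamard_conjTranspose]
  rw [h2]
  simp_rw [key]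
  rw [hadPart, ← Finset.mul_prod_erase _ _ (Finset.mem_univ i)]
  simp only [Finset.mem_insert, true_or, if_true, ite_mul, one_mul, zero_mul, mul_ite, mul_zero,
    Finset.sum_ite_eq', Finset.mem_univ]
  congr 1
  refine Finset.prod_congr rfl fun j hj => ?_
  simp [Finset.ne_of_mem_erase hj]

lemma hadAll_conjTranspose : (hadAll ι)ᴴ = hadAll ι := by
  ext x y
  simp only [conjTranspose_apply, hadAll]
  rw [star_prod]
  refine Finset.prod_congr rfl fun i _ => ?_
  rw [← conjTranspose_apply, hadamard_conjTranspose]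

lemma hadAll_mul_self : hadAll ι * hadAll ι = 1 := by
  ext x y
  have : ∀ i, ∑ c, hadamard (x i) c * hadamard c (y i) = if x i = y i then 1 else 0 := fun i => by
    rw [← Matrix.mul_apply, hadamard_mul_self, Matrix.one_apply]
  rw [Matrix.mul_apply]
  simp_rw [hadAll, ← Finset.prod_mul_distrib]
  have h := Finset.prod_univ_sum (fun _ : ι => (Finset.univ : Finset Bool))
    (fun i c => hadamard (x i) c * hadamard c (y i))
  rw [Fintype.piFinset_univ] at h
  rw [← h]
  simp_rw [this, Matrix.one_apply, Fintype.prod_ite_zero, funext_iff]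
  simp

lemma hadAll_zero (x : ι → Bool) :
    hadAll ι x (fun _ => false) = ((√2 : ℝ) : ℂ)⁻¹ ^ Fintype.card ι := by
  simp [hadAll, hadamard, Finset.prod_const]

end Hadamards

/-! ### Circuits for layers of Hadamard gates and for conditional swaps. -/

section Layers

variable {ρ β : Type} [Fintype ρ] [DecidableEq ρ] [Fintype β] [DecidableEq β]
variable {nt N np : ℕ} {w : ℕ}

lemma CImpl.hadAll {ι : Type} [Fintype ι] [DecidableEq ι] (e : ι ↪ ρ) (hw : 1 ≤ w) :
    CImpl w (fun (_ : QOp (HWire nt N np)) (_ : QOp (FWire nt N)) (_ : β → Bool) =>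
      place e (hadAll ι)) 0 (11 * Fintype.card ι) := by
  have key : ∀ S : Finset ι,
      CImpl w (fun (_ : QOp (HWire nt N np)) (_ : QOp (FWire nt N)) (_ : β → Bool) =>
        place e (hadPart S)) 0 (11 * S.card) := by
    intro S
    induction S using Finset.induction_on with
    | empty => simpa [hadPart_empty, place_one] using CImpl.one
    | insert i S hi ih =>
      simp_rw [hadPart_insert hi, ← place_mul, SparseSim.cOp, place_gOp, Finset.card_insert_of_notMem hi]
      refine ((CImpl.cOp (.tru) (e i) trivial hw hadamard_mem).mul ih).mono (by simp) ?_
      simp only [Form.size]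
      omega
  simpa [hadPart_univ] using key Finset.univ

/-- The operator that maps the basis state `s` to the basis state `f s`. -/
def permOp {κ : Type} [Fintype κ] [DecidableEq κ] (f : (κ → Bool) → κ → Bool) : QOp κ :=
  fun x y => if x = f y then 1 else 0

lemma permOp_mulVec_ket {κ : Type} [Fintype κ] [DecidableEq κ] (f : (κ → Bool) → κ → Bool)
    (s : κ → Bool) : permOp f *ᵥ ket s = ket (f s) := by
  ext x
  rw [mulVec_ket, ket_apply, permOp]

lemma permOp_mul {κ : Type} [Fintype κ] [DecidableEq κ] (f g : (κ → Bool) → κ → Bool) :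
    permOp f * permOp g = permOp (f ∘ g) :=
  ext_ket fun s => by rw [← mulVec_mulVec]; simp only [permOp_mulVec_ket, Function.comp]

lemma flip_eq_permOp {κ : Type} [Fintype κ] [DecidableEq κ] (ψ : (κ → Bool) → Bool) (t : κ) :
    cOp ψ t pauliX = permOp fun s => if ψ s then Function.update s t (!s t) else s :=
  ext_ket fun s => by rw [flip_mulVec_ket, permOp_mulVec_ket]

/-- The result of exchanging pairs of qubits in a basis state. -/
def swapList : List (ρ × ρ) → (ρ → Bool) → ρ → Bool
  | [], s => s
  | p :: l, s => swapList l (s ∘ Equiv.swap p.1 p.2)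

/-- A swap consists of three controlled flips. Conditioning the middle one is enough, because
without it the outer two cancel. -/
lemma flip_conj_eq_swap {κ : Type} [Fintype κ] [DecidableEq κ] (ψ : (κ → Bool) → Bool) (a b : κ)
    (hab : a ≠ b) (ha : IndepOf a ψ) :
    cOp (fun s => s b) a pauliX * (cOp (fun s => ψ s && s a) b pauliX *
      cOp (fun s => s b) a pauliX) =
      permOp fun s => if ψ s then s ∘ Equiv.swap a b else s := by
  refine ext_ket fun s => ?_
  rw [← mulVec_mulVec, ← mulVec_mulVec]
  simp only [flip_mulVec_ket, permOp_mulVec_ket]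
  congr 1
  have hi : ∀ s c, ψ (Function.update s a c) = ψ s := ha
  have key : s ∘ Equiv.swap a b = Function.update (Function.update s a (s b)) b (s a) := by
    ext k
    by_cases hka : k = a
    · subst hka; simp [hab]
    · by_cases hkb : k = b
      · subst hkb; simp
      · simp [hka, hkb, Equiv.swap_apply_of_ne_of_ne]
  rw [key]
  by_cases h : ψ s <;> cases hsa : s a <;> cases hsb : s b <;>
    simp [h, hsa, hsb, hab, hab.symm, hi] <;>
    (ext k; by_cases hka : k = a <;> by_cases hkb : k = b <;>
      simp_all)

lemma CImpl.swap (φ : Form (ρ ⊕ β)) (l : List (ρ × ρ))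
    (hφ : ∀ p ∈ l, p.1 ≠ p.2 ∧ φ.Avoids (Sum.inl p.1) ∧ φ.Avoids (Sum.inl p.2))
    (hw : φ.size + 2 ≤ w) :
    CImpl w (fun (_ : QOp (HWire nt N np)) (_ : QOp (FWire nt N)) (b : β → Bool) =>
      permOp fun s => if φ.eval (Sum.elim s b) then swapList l s else s) 0
      (11 * (l.length * (φ.size + 4))) := by
  induction l with
  | nil =>
    have : permOp (fun s : ρ → Bool => s) = 1 := ext_ket fun s => by
      rw [permOp_mulVec_ket, one_mulVec]
    simpa [swapList, this] using CImpl.one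
  | cons p l ih =>
    obtain ⟨h1, h2, h3⟩ := hφ p (by simp)
    have i1 : CImpl w (fun (_ : QOp (HWire nt N np)) (_ : QOp (FWire nt N)) (b : β → Bool) =>
        SparseSim.cOp (fun s : ρ → Bool => s p.2) p.1 pauliX) 0 (11 * 1) :=
      CImpl.cOp (.var (Sum.inl p.2)) p.1 (by simpa [Form.Avoids] using h1.symm)
        (by simp only [Form.size]; omega) pauliX_mem
    have i2 : CImpl w (fun (_ : QOp (HWire nt N np)) (_ : QOp (FWire nt N)) (b : β → Bool) =>
        SparseSim.cOp (fun s : ρ → Bool => φ.eval (Sum.elim s b) && s p.1) p.2 pauliX) 0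
          (11 * (φ.size + 2)) :=
      CImpl.cOp (φ.and (.var (Sum.inl p.1))) p.2 ⟨h3, by simpa [Form.Avoids] using h1⟩
        (by simp only [Form.size]; omega) pauliX_mem
    have hind : ∀ b : β → Bool, ∀ t, φ.Avoids (Sum.inl t) →
        IndepOf t (fun s : ρ → Bool => φ.eval (Sum.elim s b)) := by
      intro b t ht s c
      rw [← ht.indepOf (Sum.elim s b) c, update_inl_eq_elim]
      rfl
    have i3 := i1.mul (i2.mul i1)
    simp_rw [fun b => flip_conj_eq_swap _ _ _ h1 (hind b p.1 h2)] at i3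
    have i4 := (ih fun q hq => hφ q (by simp [hq])).mul i3
    -- The condition does not see the exchanged qubits, so it keeps its value along the whole list
    -- of swaps.
    have hs : ∀ b : β → Bool, ∀ s : ρ → Bool,
        φ.eval (Sum.elim (s ∘ Equiv.swap p.1 p.2) b) = φ.eval (Sum.elim s b) := by
      intro b s
      have : s ∘ Equiv.swap p.1 p.2 =
          Function.update (Function.update s p.1 (s p.2)) p.2 (s p.1) := by
        ext k
        by_cases hka : k = p.1
        · subst hka; simp [h1]
        · by_cases hkb : k = p.2
          · subst hkb; simp
          · simp [hka, hkb, Equiv.swap_apply_of_ne_of_ne]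
      rw [this]
      exact (hind b p.2 h3 _ _).trans (hind b p.1 h2 _ _)
    simp_rw [permOp_mul] at i4
    have hfun : ∀ b : β → Bool, ((fun s => if φ.eval (Sum.elim s b) then swapList l s else s) ∘
        fun s => if φ.eval (Sum.elim s b) then s ∘ Equiv.swap p.1 p.2 else s) =
        fun s => if φ.eval (Sum.elim s b) then swapList (p :: l) s else s := by
      intro b
      ext1 s
      simp only [Function.comp_apply]
      by_cases hb : φ.eval (Sum.elim s b)
      · simp only [if_pos hb]
        rw [hs b s, if_pos hb]
        rfl
      · simp only [if_neg hb]
    simp_rw [hfun] at i4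
    refine i4.mono (by omega) ?_
    simp only [List.length_cons]
    ring_nf
    omega

end Layers

/-! ### Binary digits. -/

section Bits

/-- The natural number with the given binary digits, least significant first. -/
def bv {n : ℕ} (b : Fin n → Bool) : ℕ := ∑ i, if b i then 2 ^ (i : ℕ) else 0

lemma bv_succ {n : ℕ} (b : Fin (n + 1) → Bool) :
    bv b = bv (fun i : Fin n => b i.castSucc) + if b (Fin.last n) then 2 ^ n else 0 := by
  simp [bv, Fin.sum_univ_castSucc]

lemma bv_lt {n : ℕ} (b : Fin n → Bool) : bv b < 2 ^ n := by
  induction n with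
  | zero => simp [bv]
  | succ n ih =>
    rw [bv_succ, pow_succ]
    have := ih fun i : Fin n => b i.castSucc
    split_ifs <;> omega

lemma bv_natBits (n x : ℕ) : bv (natBits n x) = x % 2 ^ n := by
  induction n with
  | zero => simp [bv, Nat.mod_one]
  | succ n ih =>
    rw [bv_succ, Nat.mod_pow_succ, ← Nat.toNat_testBit, ← ih]
    congr 1
    cases h : x.testBit n <;> simp [natBits, h]

lemma natBits_injOn {n x y : ℕ} (hx : x < 2 ^ n) (hy : y < 2 ^ n)
    (h : natBits n x = natBits n y) : x = y := by
  rw [← Nat.mod_eq_of_lt hx, ← Nat.mod_eq_of_lt hy, ← bv_natBits, h, bv_natBits]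

lemma natBits_bijective (n : ℕ) : Function.Bijective fun x : Fin (2 ^ n) => natBits n x := by
  rw [Fintype.bijective_iff_injective_and_card]
  refine ⟨fun x y h => Fin.ext (natBits_injOn x.2 y.2 h), by simp⟩

lemma natBits_bv {n : ℕ} (b : Fin n → Bool) : natBits n (bv b) = b := by
  obtain ⟨x, rfl⟩ := (natBits_bijective n).2 b
  simp [bv_natBits, Nat.mod_eq_of_lt x.2]

lemma sum_bits {α : Type*} [AddCommMonoid α] {n : ℕ} (F : (Fin n → Bool) → α) :
    ∑ b, F b = ∑ x ∈ Finset.range (2 ^ n), F (natBits n x) := by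
  rw [Finset.sum_range]
  exact (Fintype.sum_bijective _ (natBits_bijective n) _ _ fun _ => rfl).symm

lemma index_lt {N : ℕ} (x : Fin N) : (x : ℕ) < 2 ^ indexQubits N :=
  x.2.trans_le (Nat.le_pow_clog (by norm_num) N)

/-- The binary digits with the most significant one flipped. -/
def flipTop {k : ℕ} (b : Fin k → Bool) : Fin k → Bool :=
  fun i => if (i : ℕ) + 1 = k then !b i else b i

/-- Flipping the sign bit turns two's complement into offset binary; signed values can then be
compared with the unsigned register `w`. -/
lemma bv_flipTop {k : ℕ} (hk : 0 < k) (b : Fin k → Bool) :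
    (bv (flipTop b) : ℤ) = bitsToInt b + 2 ^ (k - 1) := by
  obtain ⟨k, rfl⟩ := Nat.exists_eq_succ_of_ne_zero hk.ne'
  have h : ∀ i : Fin k, (i : ℕ) ≠ k := fun i => i.2.ne
  simp only [bv, bitsToInt, flipTop, Nat.succ_eq_add_one, Fin.sum_univ_castSucc,
    Fin.val_castSucc, Fin.val_last, Nat.add_right_cancel_iff, h, if_false, if_true]
  cases b (Fin.last k) <;> simp

end Bits

/-! ### Formulas for constants, zero tests and comparison of numbers. -/

namespace Form

variable {κ : Type}

/-- The formula that is always true or always false. -/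
def const (b : Bool) : Form κ := if b then tru else not tru

/-- All the listed qubits are zero. -/
def allZero : List κ → Form κ
  | [] => tru
  | k :: l => and (not (var k)) (allZero l)

/-- The number with the binary digits `a` is less than the one with the binary digits `b`. -/
def lt : {n : ℕ} → (Fin n → Form κ) → (Fin n → Form κ) → Form κ
  | 0, _, _ => not tru
  | n + 1, a, b =>
    xor (and (not (a (Fin.last n))) (b (Fin.last n)))
      (and (not (xor (a (Fin.last n)) (b (Fin.last n))))
        (lt (fun i : Fin n => a i.castSucc) fun i : Fin n => b i.castSucc))

lemma const_eval (s : κ → Bool) (b : Bool) : (const b).eval s = b := by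
  cases b <;> simp [const, eval]

lemma const_size (b : Bool) : (const b : Form κ).size ≤ 2 := by
  cases b <;> simp [const, size]

lemma const_avoids (t : κ) (b : Bool) : (const b).Avoids t := by
  cases b <;> simp [const, Avoids]

lemma allZero_eval (s : κ → Bool) (l : List κ) :
    (allZero l).eval s = true ↔ ∀ k ∈ l, s k = false := by
  induction l with
  | nil => simp [allZero, eval]
  | cons k l ih => simp [allZero, eval, ih]

lemma allZero_size (l : List κ) : (allZero l).size = 3 * l.length + 1 := by
  induction l with
  | nil => simp [allZero, size]
  | cons k l ih => simp [allZero, size, ih]; ring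

lemma lt_eval (s : κ → Bool) {n : ℕ} (a b : Fin n → Form κ) :
    (lt a b).eval s = decide (bv (fun i => (a i).eval s) < bv fun i => (b i).eval s) := by
  induction n with
  | zero => simp [lt, eval, bv]
  | succ n ih =>
    have h1 := bv_lt fun i : Fin n => (a i.castSucc).eval s
    have h2 := bv_lt fun i : Fin n => (b i.castSucc).eval s
    rw [bv_succ, bv_succ]
    simp only [lt, eval, ih]
    cases (a (Fin.last n)).eval s <;> cases (b (Fin.last n)).eval s <;> simp <;> omega

lemma lt_size {n A : ℕ} (a b : Fin n → Form κ) (ha : ∀ i, (a i).size ≤ A)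
    (hb : ∀ i, (b i).size ≤ A) : (lt a b).size ≤ n * (4 * A + 6) + 2 := by
  induction n with
  | zero => simp [lt, size]
  | succ n ih =>
    have := ih (fun i : Fin n => a i.castSucc) (fun i : Fin n => b i.castSucc)
      (fun i => ha _) (fun i => hb _)
    have h1 := ha (Fin.last n)
    have h2 := hb (Fin.last n)
    simp only [lt, size]
    ring_nf at this ⊢
    omega

lemma lt_avoids {t : κ} {n : ℕ} (a b : Fin n → Form κ) (ha : ∀ i, (a i).Avoids t)
    (hb : ∀ i, (b i).Avoids t) : (lt a b).Avoids t := by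
  induction n with
  | zero => simp [lt, Avoids]
  | succ n ih =>
    exact ⟨⟨ha _, hb _⟩, ⟨ha _, hb _⟩, ih _ _ (fun i => ha _) fun i => hb _⟩

end Form

/-! ### The registers of a segment. -/

/-- The parameters of a segment: `n` and `p` low-order and high-order bits of the time index, the
number `kd` of qubits that hold a position `j < d`, and the number `k` of bits of the matrix
entries that are used. -/
structure Params where
  (N d np n p kd k : ℕ)

/-- The registers that a segment works on. -/
inductive Reg (P : Params) : Type
  | x (i : Fin (indexQubits P.N))
  | y (i : Fin (indexQubits P.N))
  | m (i : Fin (P.n + P.p))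
  | m2 (i : Fin P.n)
  | re (i : Fin P.np)
  | im (i : Fin P.np)
  | w (i : Fin P.k)
  | sel
  | h
  | g1
  | g2
  | e
  | a
  deriving DecidableEq, Fintype

namespace Reg

variable (P : Params)

/-- The qubits that a query to `O_f` acts on. -/
def embF : FWire (P.n + P.p) P.N ↪ Reg P :=
  ⟨Sum.elim m (Sum.elim x y), by rintro (_ | _ | _) (_ | _ | _) h <;> simp_all⟩

/-- The qubits that a query to `O_H` acts on. -/
def embH : HWire (P.n + P.p) P.N P.np ↪ Reg P :=
  ⟨Sum.elim m (Sum.elim x (Sum.elim y (Sum.elim re im))), by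
    rintro (_ | _ | _ | _ | _) (_ | _ | _ | _ | _) h <;> simp_all⟩

/-- The qubits that are put into a uniform superposition before a query to `O_f`. -/
def embT (hkd : P.kd ≤ indexQubits P.N) : Fin P.kd ⊕ Fin P.k ⊕ Bool ↪ Reg P :=
  ⟨Sum.elim (fun i => y (i.castLE hkd)) (Sum.elim w fun b => if b then h else sel), by
    rintro (_ | _ | b) (_ | _ | b') hh <;> (try cases b) <;> (try cases b') <;> simp_all⟩

/-- The qubits of the second clock register. -/
def embM2 : Fin P.n ↪ Reg P := ⟨m2, fun _ _ h => by simpa using h⟩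

/-- The pairs of qubits exchanged by the block encoding of the Hamiltonian. -/
def swapsXY : List (Reg P × Reg P) :=
  (g1, g2) :: (List.finRange (indexQubits P.N)).map fun i => (x i, y i)

/-- The pairs of qubits exchanged when the clock is advanced. -/
def swapsM : List (Reg P × Reg P) :=
  (List.finRange P.n).map fun i => (m (i.castAdd P.p), m2 i)

variable {P}

end Reg

/-! ### The effect of a list of swaps. -/

section SwapList

variable {ρ : Type} [Fintype ρ] [DecidableEq ρ]

lemma swapList_of_notMem (l : List (ρ × ρ)) (s : ρ → Bool) (k : ρ)
    (hk : ∀ p ∈ l, p.1 ≠ k ∧ p.2 ≠ k) : swapList l s k = s k := by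
  induction l generalizing s with
  | nil => rfl
  | cons p l ih =>
    rw [swapList, ih _ fun q hq => hk q (by simp [hq])]
    have := hk p (by simp)
    simp [Equiv.swap_apply_of_ne_of_ne this.1.symm this.2.symm]

lemma swapList_map {ι : Type} [DecidableEq ι] (r r' : ι → ρ) (hr : Function.Injective r)
    (hr' : Function.Injective r') (hrr : ∀ i j, r i ≠ r' j) (L : List ι) (hL : L.Nodup)
    (s : ρ → Bool) (i : ι) (hi : i ∈ L) :
    swapList (L.map fun i => (r i, r' i)) s (r i) = s (r' i) ∧
      swapList (L.map fun i => (r i, r' i)) s (r' i) = s (r i) := by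
  induction L generalizing s with
  | nil => simp at hi
  | cons j L ih =>
    simp only [List.map_cons, swapList]
    rw [List.nodup_cons] at hL
    rcases List.mem_cons.1 hi with rfl | hi
    · have h1 : ∀ p ∈ L.map fun j => (r j, r' j), p.1 ≠ r i ∧ p.2 ≠ r i := by
        intro p hp
        obtain ⟨j, hj, rfl⟩ := List.mem_map.1 hp
        exact ⟨fun h => hL.1 (hr h ▸ hj), (hrr _ _).symm⟩
      have h2 : ∀ p ∈ L.map fun j => (r j, r' j), p.1 ≠ r' i ∧ p.2 ≠ r' i := by
        intro p hp
        obtain ⟨j, hj, rfl⟩ := List.mem_map.1 hp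
        exact ⟨hrr _ _, fun h => hL.1 (hr' h ▸ hj)⟩
      rw [swapList_of_notMem _ _ _ h1, swapList_of_notMem _ _ _ h2]
      simp
    · have hij : i ≠ j := fun h => hL.1 (h ▸ hi)
      obtain ⟨h1, h2⟩ := ih hL.2 (s ∘ Equiv.swap (r j) (r' j)) hi
      rw [h1, h2]
      simp [Equiv.swap_apply_of_ne_of_ne, hr.ne hij, hr'.ne hij, hrr, (hrr _ _).symm]

end SwapList

/-! ### The elementary operators of a segment and their costs. -/

section Steps

variable (P : Params)

open Form Reg

/-- Condition a formula on the `ρ`-part of the qubits. -/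
def Form.inl {ρ β : Type} : Form ρ → Form (ρ ⊕ β)
  | .var k => .var (Sum.inl k)
  | .tru => .tru
  | .not φ => .not φ.inl
  | .and φ ψ => .and φ.inl ψ.inl
  | .xor φ ψ => .xor φ.inl ψ.inl

lemma Form.inl_eval {ρ β : Type} (φ : Form ρ) (s : ρ → Bool) (b : β → Bool) :
    (φ.inl).eval (Sum.elim s b) = φ.eval s := by
  induction φ <;> simp_all [Form.inl, Form.eval]

lemma Form.inl_size {ρ β : Type} (φ : Form ρ) : (φ.inl : Form (ρ ⊕ β)).size = φ.size := by
  induction φ <;> simp_all [Form.inl, Form.size]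

lemma Form.inl_avoids {ρ β : Type} {φ : Form ρ} {t : ρ} (h : φ.Avoids t) :
    (φ.inl : Form (ρ ⊕ β)).Avoids (Sum.inl t) := by
  induction φ <;> simp_all [Form.inl, Form.Avoids]

lemma Form.inl_avoids_inr {ρ β : Type} (φ : Form ρ) (t : β) :
    (φ.inl : Form (ρ ⊕ β)).Avoids (Sum.inr t) := by
  induction φ <;> simp_all [Form.inl, Form.Avoids]

/-- The position `j` is not less than `d`. -/
def posForm : Form (Reg P) :=
  lt (fun i => const (natBits (indexQubits P.N) (P.d - 1) i)) fun i => var (y i)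

/-- The integer in the register `w` is not less than the given part of the matrix entry. -/
def valForm (hk : P.k ≤ P.np) (r : Fin P.np → Reg P) : Form (Reg P) :=
  not (lt (fun i => var (w i)) fun i =>
    if (i : ℕ) + 1 = P.k then not (var (r (i.castLE hk))) else var (r (i.castLE hk)))

/-- The second clock does not show a later time than the first one. -/
def clockForm : Form (Reg P) :=
  not (lt (fun i => var (m (i.castAdd P.p))) fun i => var (m2 i))

/-- The list of all qubits except those that hold the index and the time. -/
def cleanList : List (Reg P) :=
  (List.finRange _).map y ++ (List.finRange _).map m2 ++ (List.finRange _).map re ++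
    (List.finRange _).map im ++ (List.finRange _).map w ++ [sel, h, g1, g2, e, a]

/-- All qubits except those for the time are clean and the index is less than `N`. -/
def goodForm : Form (Reg P) :=
  and (not (lt (fun i => const (natBits (indexQubits P.N) (P.N - 1) i)) fun i => var (x i)))
    (allZero (cleanList P))

/-- Preparation of the superposition of the row entries. -/
noncomputable def opT (hkd : P.kd ≤ indexQubits P.N) (Of : QOp (FWire (P.n + P.p) P.N)) :
    QOp (Reg P) :=
  place (embF P) Of * (cOp (fun s => (posForm P).eval s) g1 pauliX *
    place (embT P hkd) (hadAll _))

/-- The phases of a matrix entry, conditioned on `c`. -/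
noncomputable def opPhase (hk : P.k ≤ P.np) (c : Bool) : QOp (Reg P) :=
  phaseOp (fun s => c && ((not (var sel)).and (valForm P hk re)).eval s) (-1) *
  (phaseOp (fun s => c && ((var sel).and (valForm P hk im)).eval s) (-1) *
  (phaseOp (fun s => c && ((var sel).and (var h)).eval s) Complex.I *
  phaseOp (fun s => c && ((var sel).and (not (var h))).eval s) (-Complex.I)))

/-- The operator between the two preparations, conditioned on `c`. -/
noncomputable def opQ (hk : P.k ≤ P.np) (Ra : Matrix Bool Bool ℂ)
    (OH : QOp (HWire (P.n + P.p) P.N P.np)) (c : Bool) : QOp (Reg P) :=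
  permOp (fun s => if c && !s h then swapList (swapsXY P) s else s) *
  (place (embH P) OHᴴ * (opPhase P hk c * (place (embH P) OH *
  (permOp (fun s => if c && s h then swapList (swapsXY P) s else s) *
    cOp (fun _ => c) a Ra))))

/-- The block encoding of the Hamiltonian, conditioned on `c`. -/
noncomputable def opB (hkd : P.kd ≤ indexQubits P.N) (hk : P.k ≤ P.np) (Ra : Matrix Bool Bool ℂ)
    (OH : QOp (HWire (P.n + P.p) P.N P.np)) (Of : QOp (FWire (P.n + P.p) P.N)) (c : Bool) :
    QOp (Reg P) :=
  (opT P hkd Of)ᴴ * (opQ P hk Ra OH c * opT P hkd Of)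

/-- The block encoding of the advancement of the clock, conditioned on `c`. -/
noncomputable def opL (c : Bool) : QOp (Reg P) :=
  place (embM2 P) (hadAll _) *
  (permOp (fun s => if c then swapList (swapsM P) s else s) *
  (cOp (fun s => c && (clockForm P).eval s) e pauliX * place (embM2 P) (hadAll _)))

/-- The total size of the registers. -/
def Params.size : ℕ := indexQubits P.N + P.n + P.p + P.np + 1

variable {P} {β : Type} [Fintype β] [DecidableEq β] {w : ℕ}

lemma posForm_size : (posForm P).size ≤ 14 * P.size := by
  refine (lt_size (A := 2) _ _ (fun i => const_size _) fun i => by simp [Form.size]).trans ?_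
  simp only [Params.size]; omega

lemma valForm_size (hk : P.k ≤ P.np) (r : Fin P.np → Reg P) :
    (valForm P hk r).size ≤ 15 * P.size := by
  simp only [valForm, Form.size]
  refine (Nat.add_le_add_right (lt_size (A := 2) _ _ (fun i => by simp [Form.size])
    fun i => ?_) 1).trans ?_
  · split_ifs <;> simp [Form.size]
  · simp only [Params.size]; omega

lemma clockForm_size : (clockForm P).size ≤ 15 * P.size := by
  simp only [clockForm, Form.size]
  refine (Nat.add_le_add_right (lt_size (A := 2) _ _ (fun i => by simp [Form.size])
    fun i => by simp [Form.size]) 1).trans ?_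
  simp only [Params.size]; omega

lemma goodForm_size (hk : P.k ≤ P.np) : (goodForm P).size ≤ 60 * P.size := by
  simp only [goodForm, Form.size]
  have := lt_size (A := 2) (fun i => const (natBits (indexQubits P.N) (P.N - 1) i))
    (fun i => var (Reg.x (P := P) i)) (fun i => const_size _) (fun i => by simp [Form.size])
  have h2 : (allZero (cleanList P)).size ≤ 3 * (indexQubits P.N + P.n + 3 * P.np + 6) + 1 := by
    rw [allZero_size]
    simp [cleanList]
    omega
  simp only [Params.size]
  omega

/-- A formula on the control qubits with the truth value `bit`. -/
structure IsBit (bf : Form (Reg P ⊕ β)) (bit : (β → Bool) → Bool) : Prop where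
  eval : ∀ s b, bf.eval (Sum.elim s b) = bit b
  avoids : ∀ t, bf.Avoids (Sum.inl t)
  size : bf.size ≤ 2

variable {bf : Form (Reg P ⊕ β)} {bit : (β → Bool) → Bool}

lemma CImpl.cOp_bit (hb : IsBit bf bit) (φ : Form (Reg P)) (t : Reg P) (ht : φ.Avoids t)
    (hw : φ.size + 3 ≤ w) {U : Matrix Bool Bool ℂ} (hU : U ∈ unitaryGroup Bool ℂ) :
    CImpl w (fun (_ : QOp (HWire (P.n + P.p) P.N P.np)) (_ : QOp (FWire (P.n + P.p) P.N))
      (b : β → Bool) => SparseSim.cOp (fun s => bit b && φ.eval s) t U) 0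
      (11 * (φ.size + 3)) := by
  have := hb.size
  have h := CImpl.cOp (nt := P.n + P.p) (N := P.N) (np := P.np) (w := w) (bf.and φ.inl) t
    ⟨hb.avoids t, Form.inl_avoids ht⟩
    (by simp only [Form.size, Form.inl_size]; omega) hU
  simp only [Form.eval, hb.eval, Form.inl_eval] at h
  refine h.mono le_rfl ?_
  simp only [Form.size, Form.inl_size]; omega

lemma CImpl.phase_bit (hb : IsBit bf bit) (φ : Form (Reg P)) (hw : φ.size + 3 ≤ w) {z : ℂ}
    (hz : z * star z = 1) :
    CImpl w (fun (_ : QOp (HWire (P.n + P.p) P.N P.np)) (_ : QOp (FWire (P.n + P.p) P.N))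
      (b : β → Bool) => phaseOp (fun s => bit b && φ.eval s) z) 0 (11 * (φ.size + 3)) := by
  have := hb.size
  have h := CImpl.phase (nt := P.n + P.p) (N := P.N) (np := P.np) (w := w) (bf.and φ.inl)
    (by simp only [Form.size, Form.inl_size]; omega) hz
  simp only [Form.eval, hb.eval, Form.inl_eval] at h
  refine h.mono le_rfl ?_
  simp only [Form.size, Form.inl_size]; omega

lemma CImpl.swap_bit (hb : IsBit bf bit) (φ : Form (Reg P)) (l : List (Reg P × Reg P))
    (hφ : ∀ p ∈ l, p.1 ≠ p.2 ∧ φ.Avoids p.1 ∧ φ.Avoids p.2) (hw : φ.size + 6 ≤ w) :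
    CImpl w (fun (_ : QOp (HWire (P.n + P.p) P.N P.np)) (_ : QOp (FWire (P.n + P.p) P.N))
      (b : β → Bool) => permOp fun s => if bit b && φ.eval s then swapList l s else s) 0
      (11 * (l.length * (φ.size + 7))) := by
  have := hb.size
  have h := CImpl.swap (nt := P.n + P.p) (N := P.N) (np := P.np) (w := w) (bf.and φ.inl) l
    (fun p hp => ⟨(hφ p hp).1, ⟨hb.avoids _, Form.inl_avoids (hφ p hp).2.1⟩,
      ⟨hb.avoids _, Form.inl_avoids (hφ p hp).2.2⟩⟩)
    (by simp only [Form.size, Form.inl_size]; omega)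
  simp only [Form.eval, hb.eval, Form.inl_eval] at h
  refine h.mono le_rfl (Nat.mul_le_mul_left _ (Nat.mul_le_mul_left _ ?_))
  simp only [Form.size, Form.inl_size]; omega

lemma CImpl.opT (hkd : P.kd ≤ indexQubits P.N) (hk : P.k ≤ P.np) (hw : 20 * P.size ≤ w) :
    CImpl w (fun (_ : QOp (HWire (P.n + P.p) P.N P.np)) Of (_ : β → Bool) =>
      SparseSim.opT P hkd Of) 1 (200 * P.size) := by
  have hs := posForm_size (P := P)
  have hp : 1 ≤ P.size := by simp [Params.size]
  have h1 := CImpl.queryF (β := β) (np := P.np) (w := w) false (embF P)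
  have h2 := CImpl.cOp (nt := P.n + P.p) (N := P.N) (np := P.np) (β := β) (w := w)
    (posForm P).inl g1 (Form.inl_avoids (lt_avoids _ _ (fun i => const_avoids _ _)
      (fun i => by simp [Form.Avoids]))) (by rw [Form.inl_size]; omega) pauliX_mem
  simp only [Form.inl_eval] at h2
  have h3 := CImpl.hadAll (nt := P.n + P.p) (N := P.N) (np := P.np) (β := β) (w := w)
    (embT P hkd) (by omega)
  refine (h1.mul (h2.mul h3)).mono (by omega) ?_
  rw [Form.inl_size]
  simp only [Fintype.card_sum, Fintype.card_fin, Fintype.card_bool]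
  have : P.kd + P.k + 2 ≤ 2 * P.size := by simp only [Params.size]; omega
  omega

lemma CImpl.opPhase (hb : IsBit bf bit) (hk : P.k ≤ P.np) (hw : 30 * P.size ≤ w) :
    CImpl w (fun (_ : QOp (HWire (P.n + P.p) P.N P.np)) (_ : QOp (FWire (P.n + P.p) P.N))
      (b : β → Bool) => SparseSim.opPhase P hk (bit b)) 0 (700 * P.size) := by
  have hs := valForm_size hk re
  have hs' := valForm_size hk im
  have hp : 1 ≤ P.size := by simp [Params.size]
  have h1 := CImpl.phase_bit (w := w) hb ((not (var sel)).and (valForm P hk re))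
    (by simp only [Form.size]; omega) (z := -1) (by simp)
  have h2 := CImpl.phase_bit (w := w) hb ((var sel).and (valForm P hk im))
    (by simp only [Form.size]; omega) (z := -1) (by simp)
  have h3 := CImpl.phase_bit (w := w) hb ((var sel).and (var h))
    (by simp only [Form.size]; omega) (z := Complex.I) (by simp)
  have h4 := CImpl.phase_bit (w := w) hb ((var sel).and (not (var h)))
    (by simp only [Form.size]; omega) (z := -Complex.I) (by simp)
  refine (h1.mul (h2.mul (h3.mul h4))).mono (by omega) ?_
  simp only [Form.size]
  omega

lemma CImpl.opQ (hb : IsBit bf bit) (hk : P.k ≤ P.np) {Ra : Matrix Bool Bool ℂ}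
    (hRa : Ra ∈ unitaryGroup Bool ℂ) (hw : 30 * P.size ≤ w) :
    CImpl w (fun OH (_ : QOp (FWire (P.n + P.p) P.N)) (b : β → Bool) =>
      SparseSim.opQ P hk Ra OH (bit b)) 2 (1200 * P.size) := by
  have hp : 1 ≤ P.size := by simp [Params.size]
  have h1 := CImpl.swap_bit (w := w) hb (not (var h)) (swapsXY P)
    (by simp [swapsXY, Form.Avoids]) (by simp only [Form.size]; omega)
  have h2 := CImpl.swap_bit (w := w) hb (var h) (swapsXY P)
    (by simp [swapsXY, Form.Avoids]) (by simp only [Form.size]; omega)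
  have h3 := CImpl.cOp_bit (w := w) hb tru a trivial (by simp only [Form.size]; omega) hRa
  have h4 := CImpl.queryH (β := β) (w := w) true (embH P)
  have h5 := CImpl.queryH (β := β) (w := w) false (embH P)
  have h6 := CImpl.opPhase (w := w) hb hk hw
  have h := h1.mul (h4.mul (h6.mul (h5.mul (h2.mul h3))))
  simp only [Form.eval, Bool.and_true, dagIf, if_true] at h
  refine h.mono (by omega) ?_
  have : (swapsXY P).length ≤ P.size := by simp [swapsXY, Params.size]; omega
  simp only [Form.size]
  omega

lemma CImpl.opB (hb : IsBit bf bit) (hkd : P.kd ≤ indexQubits P.N) (hk : P.k ≤ P.np)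
    {Ra : Matrix Bool Bool ℂ} (hRa : Ra ∈ unitaryGroup Bool ℂ) (hw : 30 * P.size ≤ w) :
    CImpl w (fun OH Of (b : β → Bool) => SparseSim.opB P hkd hk Ra OH Of (bit b)) 4
      (1600 * P.size) := by
  have h1 := CImpl.opT (β := β) (w := w) hkd hk (by omega)
  have h2 := CImpl.opQ (w := w) hb hk hRa hw
  exact (h1.adj.mul (h2.mul h1)).mono (by omega) (by omega)

lemma CImpl.opL (hb : IsBit bf bit) (hw : 30 * P.size ≤ w) :
    CImpl w (fun (_ : QOp (HWire (P.n + P.p) P.N P.np)) (_ : QOp (FWire (P.n + P.p) P.N))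
      (b : β → Bool) => SparseSim.opL P (bit b)) 0 (400 * P.size) := by
  have hp : 1 ≤ P.size := by simp [Params.size]
  have hs := clockForm_size (P := P)
  have h1 := CImpl.hadAll (nt := P.n + P.p) (N := P.N) (np := P.np) (β := β) (w := w)
    (embM2 P) (by omega)
  have h2 := CImpl.swap_bit (w := w) hb tru (swapsM P)
    (by simp [swapsM, Form.Avoids]) (by simp only [Form.size]; omega)
  have h3 := CImpl.cOp_bit (w := w) hb (clockForm P) e
    (lt_avoids _ _ (fun i => by simp [Form.Avoids]) (fun i => by simp [Form.Avoids]))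
    (by omega) pauliX_mem
  have h := h1.mul (h2.mul (h3.mul h1))
  simp only [Form.eval, Bool.and_true] at h
  refine h.mono (by omega) ?_
  have : (swapsM P).length ≤ P.size := by simp [swapsM, Params.size]; omega
  have h' : Fintype.card (Fin P.n) ≤ P.size := by simp [Params.size]; omega
  simp only [Form.size]
  omega

end Steps

/-! ### Operators that change a register in a known way. -/

section Tracks

variable {κ γ : Type} [Fintype κ] [DecidableEq κ]

/-- The operator `A` changes the value of `F` as described by `G`. -/
def Tracks (F : (κ → Bool) → γ) (G : γ → γ) (A : QOp κ) : Prop :=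
  ∀ s' s, A s' s ≠ 0 → F s' = G (F s)

lemma Tracks.mul {F : (κ → Bool) → γ} {G G' : γ → γ} {A A' : QOp κ} (h : Tracks F G A)
    (h' : Tracks F G' A') : Tracks F (G ∘ G') (A * A') := by
  intro s' s hs
  rw [Matrix.mul_apply] at hs
  obtain ⟨z, -, hz⟩ := Finset.exists_ne_zero_of_sum_ne_zero hs
  rw [h _ _ (left_ne_zero_of_mul hz), h' _ _ (right_ne_zero_of_mul hz), Function.comp]

lemma tracks_permOp {F : (κ → Bool) → γ} {G : γ → γ} {f : (κ → Bool) → κ → Bool}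
    (h : ∀ s, F (f s) = G (F s)) : Tracks F G (permOp f) := by
  intro s' s hs
  simp only [permOp, ne_eq, ite_eq_right_iff, one_ne_zero, imp_false, not_not] at hs
  rw [hs, h]

lemma tracks_phaseOp (F : (κ → Bool) → γ) (ψ : (κ → Bool) → Bool) (z : ℂ) :
    Tracks F id (phaseOp ψ z) := by
  intro s' s hs
  by_cases h : s' = s
  · rw [h]; rfl
  · exact (hs (by rw [phaseOp, diagonal_apply_ne _ h])).elim

lemma tracks_place {ι : Type} [Fintype ι] [DecidableEq ι] {F : (κ → Bool) → γ} (e : ι ↪ κ)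
    (A : QOp ι) (h : ∀ s s' : κ → Bool, (∀ k, (∀ i, e i ≠ k) → s' k = s k) → F s' = F s) :
    Tracks F id (place e A) := by
  intro s' s hs
  refine h _ _ ?_
  by_contra hc
  exact hs (if_neg hc)

lemma tracks_cOp {F : (κ → Bool) → γ} (ψ : (κ → Bool) → Bool) (t : κ) (U : Matrix Bool Bool ℂ)
    (h : ∀ s s' : κ → Bool, (∀ k, k ≠ t → s' k = s k) → F s' = F s) :
    Tracks F id (cOp ψ t U) := by
  intro s' s hs
  refine h _ _ ?_
  by_contra hc
  exact hs (if_neg hc)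

lemma Tracks.mulVec {F : (κ → Bool) → γ} {G : γ → γ} {A : QOp κ} (h : Tracks F G A) {c : γ}
    {v : (κ → Bool) → ℂ} (hv : ∀ s, v s ≠ 0 → F s = c) : ∀ s, (A *ᵥ v) s ≠ 0 → F s = G c := by
  intro s hs
  rw [Matrix.mulVec, dotProduct] at hs
  obtain ⟨z, -, hz⟩ := Finset.exists_ne_zero_of_sum_ne_zero hs
  rw [h _ _ (left_ne_zero_of_mul hz), hv _ (right_ne_zero_of_mul hz)]

/-- This disposes of the positions `j ≥ d` by means of their flags alone, whatever the position
oracle does to them, since it is unspecified there. -/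
lemma dotProduct_eq_zero_of_support {F : (κ → Bool) → γ} {c c' : γ} (hc : c ≠ c')
    {u v : (κ → Bool) → ℂ} (hu : ∀ s, u s ≠ 0 → F s = c) (hv : ∀ s, v s ≠ 0 → F s = c') :
    star u ⬝ᵥ v = 0 := by
  refine Finset.sum_eq_zero fun s _ => ?_
  by_cases h1 : u s = 0
  · simp [h1]
  · by_cases h2 : v s = 0
    · simp [h2]
    · exact (hc ((hu s h1).symm.trans (hv s h2))).elim

lemma star_ket_dotProduct (s : κ → Bool) (v : (κ → Bool) → ℂ) : star (ket s) ⬝ᵥ v = v s := by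
  simp [dotProduct, ket_apply, apply_ite (starRingEnd ℂ)]

/-- Entries of a conjugated operator become inner products of two prepared states, with the middle
operator applied to one of them. -/
lemma conjTranspose_mul_mul_apply (A B : QOp κ) (C : QOp κ) (s' s : κ → Bool) :
    (Aᴴ * (B * C)) s' s = star (A *ᵥ ket s') ⬝ᵥ (B *ᵥ (C *ᵥ ket s)) := by
  rw [mulVec_mulVec, Matrix.mul_apply, dotProduct]
  refine Finset.sum_congr rfl fun z _ => ?_
  rw [mulVec_ket, Pi.star_apply, mulVec_ket, conjTranspose_apply]

end Tracks

/-! ### The block encoding of the Hamiltonian on basis states. -/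

section BlockH

variable {P : Params}

open Reg Form

@[simp] lemma embF_apply (i : FWire (P.n + P.p) P.N) :
    embF P i = Sum.elim Reg.m (Sum.elim Reg.x Reg.y) i := rfl

@[simp] lemma embH_apply (i : HWire (P.n + P.p) P.N P.np) :
    embH P i = Sum.elim Reg.m (Sum.elim Reg.x (Sum.elim Reg.y (Sum.elim Reg.re Reg.im))) i := rfl

@[simp] lemma embT_apply (hkd : P.kd ≤ indexQubits P.N) (i : Fin P.kd ⊕ Fin P.k ⊕ Bool) :
    embT P hkd i = Sum.elim (fun i => Reg.y (i.castLE hkd))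
      (Sum.elim Reg.w fun b => if b then Reg.h else Reg.sel) i := rfl

@[simp] lemma embM2_apply (i : Fin P.n) : embM2 P i = Reg.m2 i := rfl

/-- The basis state of the registers with the given contents. -/
def rst (x y : Fin (indexQubits P.N) → Bool) (m : Fin (P.n + P.p) → Bool)
    (θ : Fin P.k ⊕ Bool → Bool) (re im : Fin P.np → Bool) (g1 g2 a : Bool) : Reg P → Bool
  | .x i => x i
  | .y i => y i
  | .m i => m i
  | .m2 _ => false
  | .re i => re i
  | .im i => im i
  | .w i => θ (Sum.inl i)
  | .sel => θ (Sum.inr false)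
  | .h => θ (Sum.inr true)
  | .g1 => g1
  | .g2 => g2
  | .e => false
  | .a => a

/-- The basis state with index `x` and time bits `m` in which all other qubits are clean. -/
def gst (g : Fin P.N × (Fin (P.n + P.p) → Bool)) : Reg P → Bool :=
  rst (natBits _ g.1) (fun _ => false) g.2 (fun _ => false) (fun _ => false) (fun _ => false)
    false false false

lemma rst_injective {x y x' y' : Fin (indexQubits P.N) → Bool} {m m' : Fin (P.n + P.p) → Bool}
    {θ θ' : Fin P.k ⊕ Bool → Bool} {r i r' i' : Fin P.np → Bool} {g1 g2 a g1' g2' a' : Bool} :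
    rst x y m θ r i g1 g2 a = rst x' y' m' θ' r' i' g1' g2' a' ↔
      x = x' ∧ y = y' ∧ m = m' ∧ θ = θ' ∧ r = r' ∧ i = i' ∧ g1 = g1' ∧ g2 = g2' ∧ a = a' := by
  constructor
  · intro h
    have h' := congrFun h
    refine ⟨funext fun j => h' (.x j), funext fun j => h' (.y j), funext fun j => h' (.m j),
      funext fun j => ?_, funext fun j => h' (.re j), funext fun j => h' (.im j), h' .g1, h' .g2,
      h' .a⟩
    rcases j with j | j
    · exact h' (.w j)
    · cases j
      · exact h' .sel
      · exact h' .h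
  · rintro ⟨rfl, rfl, rfl, rfl, rfl, rfl, rfl, rfl, rfl⟩
    rfl

lemma gst_injective : Function.Injective (gst (P := P)) := by
  rintro ⟨x, m⟩ ⟨x', m'⟩ h
  obtain ⟨h1, -, h2, -⟩ := rst_injective.1 h
  simp only at h1 h2
  rw [Fin.ext (natBits_injOn (index_lt x) (index_lt x') h1), h2]

lemma swapList_swapsXY (x y : Fin (indexQubits P.N) → Bool) (m : Fin (P.n + P.p) → Bool)
    (θ : Fin P.k ⊕ Bool → Bool) (r i : Fin P.np → Bool) (g1 g2 a : Bool) :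
    swapList (swapsXY P) (rst x y m θ r i g1 g2 a) = rst y x m θ r i g2 g1 a := by
  rw [swapsXY, swapList]
  have key := swapList_map (Reg.x (P := P)) Reg.y (fun _ _ h => by simpa using h)
    (fun _ _ h => by simpa using h) (by simp) (List.finRange _) (List.nodup_finRange _)
    (rst x y m θ r i g1 g2 a ∘ Equiv.swap Reg.g1 Reg.g2)
  have hne : ∀ k : Reg P, (∀ j, Reg.x j ≠ k) → (∀ j, Reg.y j ≠ k) →
      swapList ((List.finRange (indexQubits P.N)).map fun i => (Reg.x i, Reg.y i))
        (rst x y m θ r i g1 g2 a ∘ Equiv.swap Reg.g1 Reg.g2) k =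
        (rst x y m θ r i g1 g2 a ∘ Equiv.swap Reg.g1 Reg.g2) k := fun k h1 h2 =>
    swapList_of_notMem _ _ _ fun p hp => by
      obtain ⟨j, -, rfl⟩ := List.mem_map.1 hp
      exact ⟨h1 j, h2 j⟩
  ext k
  cases k with
  | x j => rw [(key j (List.mem_finRange j)).1]; simp [Equiv.swap_apply_of_ne_of_ne, rst]
  | y j => rw [(key j (List.mem_finRange j)).2]; simp [Equiv.swap_apply_of_ne_of_ne, rst]
  | _ => rw [hne _ (by simp) (by simp)]; simp [Equiv.swap_apply_of_ne_of_ne, rst]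

lemma extend_embF (x y : Fin (indexQubits P.N) → Bool) (m : Fin (P.n + P.p) → Bool)
    (θ : Fin P.k ⊕ Bool → Bool) (r i : Fin P.np → Bool) (g1 g2 a : Bool)
    (x' y' : Fin (indexQubits P.N) → Bool) (m' : Fin (P.n + P.p) → Bool) :
    Function.extend (embF P) (Sum.elim m' (Sum.elim x' y')) (rst x y m θ r i g1 g2 a) =
      rst x' y' m' θ r i g1 g2 a := by
  ext k
  cases k with
  | x j => exact (embF P).injective.extend_apply _ _ (Sum.inr (Sum.inl j))
  | y j => exact (embF P).injective.extend_apply _ _ (Sum.inr (Sum.inr j))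
  | m j => exact (embF P).injective.extend_apply _ _ (Sum.inl j)
  | _ => rw [Function.extend_apply' _ _ _ (by simp)]; rfl

lemma extend_embH (x y : Fin (indexQubits P.N) → Bool) (m : Fin (P.n + P.p) → Bool)
    (θ : Fin P.k ⊕ Bool → Bool) (r i : Fin P.np → Bool) (g1 g2 a : Bool)
    (x' y' : Fin (indexQubits P.N) → Bool) (m' : Fin (P.n + P.p) → Bool)
    (r' i' : Fin P.np → Bool) :
    Function.extend (embH P) (Sum.elim m' (Sum.elim x' (Sum.elim y' (Sum.elim r' i'))))
      (rst x y m θ r i g1 g2 a) = rst x' y' m' θ r' i' g1 g2 a := by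
  ext k
  cases k with
  | x j => exact (embH P).injective.extend_apply _ _ (Sum.inr (Sum.inl j))
  | y j => exact (embH P).injective.extend_apply _ _ (Sum.inr (Sum.inr (Sum.inl j)))
  | m j => exact (embH P).injective.extend_apply _ _ (Sum.inl j)
  | re j => exact (embH P).injective.extend_apply _ _ (Sum.inr (Sum.inr (Sum.inr (Sum.inl j))))
  | im j => exact (embH P).injective.extend_apply _ _ (Sum.inr (Sum.inr (Sum.inr (Sum.inr j))))
  | _ => rw [Function.extend_apply' _ _ _ (by simp)]; rfl

lemma testBit_bv {n : ℕ} (b : Fin n → Bool) (i : ℕ) :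
    (bv b).testBit i = if h : i < n then b ⟨i, h⟩ else false := by
  split_ifs with h
  · exact congrFun (natBits_bv b) ⟨i, h⟩
  · exact Nat.testBit_lt_two_pow ((bv_lt b).trans_le (Nat.pow_le_pow_right (by norm_num)
      (not_lt.1 h)))

lemma extend_embT (hkd : P.kd ≤ indexQubits P.N) (x : Fin (indexQubits P.N) → Bool)
    (m : Fin (P.n + P.p) → Bool) (r i : Fin P.np → Bool) (g1 g2 a : Bool)
    (u : Fin P.kd ⊕ Fin P.k ⊕ Bool → Bool) :
    Function.extend (embT P hkd) u (rst x (fun _ => false) m (fun _ => false) r i g1 g2 a) =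
      rst x (natBits _ (bv (u ∘ Sum.inl))) m (u ∘ Sum.inr) r i g1 g2 a := by
  ext k
  cases k with
  | y j =>
    simp only [rst, natBits, testBit_bv]
    split_ifs with h
    · exact (embT P hkd).injective.extend_apply _ _ (Sum.inl ⟨j, h⟩)
    · rw [Function.extend_apply']
      · rfl
      rintro ⟨t | t | t, ht⟩
      · have h1 : t.castLE hkd = j := by simpa using ht
        exact h (by rw [← h1]; exact t.2)
      · simp at ht
      · cases t <;> simp at ht
  | w j => exact (embT P hkd).injective.extend_apply _ _ (Sum.inr (Sum.inl j))
  | sel => exact (embT P hkd).injective.extend_apply _ _ (Sum.inr (Sum.inr false))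
  | h => exact (embT P hkd).injective.extend_apply _ _ (Sum.inr (Sum.inr true))
  | _ =>
    rw [Function.extend_apply']
    · rfl
    · rintro ⟨t | t | t, ht⟩
      · simp at ht
      · simp at ht
      · cases t <;> simp at ht

lemma posForm_eval (hd : 0 < P.d) (hdN : P.d ≤ P.N) (x y : Fin (indexQubits P.N) → Bool)
    (m : Fin (P.n + P.p) → Bool) (θ : Fin P.k ⊕ Bool → Bool) (r i : Fin P.np → Bool)
    (g1 g2 a : Bool) :
    (posForm P).eval (rst x y m θ r i g1 g2 a) = decide (P.d ≤ bv y) := by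
  have h : P.d - 1 < 2 ^ indexQubits P.N :=
    (by omega : P.d - 1 < P.N).trans_le (Nat.le_pow_clog (by norm_num) _)
  simp only [posForm, lt_eval, const_eval, eval, rst]
  rw [bv_natBits, Nat.mod_eq_of_lt h]
  change decide (P.d - 1 < bv y) = _
  congr 1
  rw [eq_iff_iff]
  omega

/-- The state after the preparation of one position `j`. -/
noncomputable def vecT (Of : QOp (FWire (P.n + P.p) P.N)) (x : Fin (indexQubits P.N) → Bool)
    (m : Fin (P.n + P.p) → Bool) (j : Fin P.kd → Bool) (θ : Fin P.k ⊕ Bool → Bool) :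
    (Reg P → Bool) → ℂ :=
  place (embF P) Of *ᵥ ket (rst x (natBits _ (bv j)) m θ (fun _ => false) (fun _ => false)
    (decide (P.d ≤ bv j)) false false)

lemma opT_mulVec (hd : 0 < P.d) (hdN : P.d ≤ P.N) (hkd : P.kd ≤ indexQubits P.N)
    (Of : QOp (FWire (P.n + P.p) P.N)) (g : Fin P.N × (Fin (P.n + P.p) → Bool)) :
    opT P hkd Of *ᵥ ket (gst g) =
      ∑ u : (Fin P.kd → Bool) × (Fin P.k ⊕ Bool → Bool),
        (((√2 : ℝ) : ℂ)⁻¹ ^ (P.kd + (P.k + 2))) • vecT Of (natBits _ g.1) g.2 u.1 u.2 := by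
  have h0 : gst g ∘ embT P hkd = fun _ => false := by
    ext i
    rcases i with i | i | i
    · rfl
    · rfl
    · cases i <;> rfl
  rw [opT, ← mulVec_mulVec, ← mulVec_mulVec, place_mulVec_ket, h0]
  simp_rw [hadAll_zero, gst, extend_embT]
  rw [mulVec_sum_smul_ket, flip_eq_permOp]
  simp_rw [permOp_mulVec_ket, posForm_eval hd hdN, bv_natBits]
  rw [mulVec_sum_smul_ket]
  refine (Fintype.sum_equiv (Equiv.sumArrowEquivProdArrow _ _ _) _ _ fun u => ?_)
  have hlt : bv (u ∘ Sum.inl) < 2 ^ indexQubits P.N :=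
    (bv_lt _).trans_le (Nat.pow_le_pow_right (by norm_num) hkd)
  have hj : ((Equiv.sumArrowEquivProdArrow (Fin P.kd) (Fin P.k ⊕ Bool) Bool) u).1 =
    u ∘ Sum.inl := rfl
  have hθ : ((Equiv.sumArrowEquivProdArrow (Fin P.kd) (Fin P.k ⊕ Bool) Bool) u).2 =
    u ∘ Sum.inr := rfl
  rw [hj, hθ, vecT, Nat.mod_eq_of_lt hlt]
  congr 1
  · simp
  · congr 2
    by_cases h : P.d ≤ bv (u ∘ Sum.inl)
    · simp only [h, decide_true, if_true]
      ext k
      cases k <;> simp [rst]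
    · simp [h]

/-- The content of the flags of the two row superpositions and of the qubit `h`. -/
def flags (s : Reg P → Bool) : Bool × Bool × Bool := (s .h, s .g1, s .g2)

lemma tracks_embF (A : QOp (FWire (P.n + P.p) P.N)) : Tracks flags id (place (embF P) A) := by
  refine tracks_place _ _ fun s s' h => ?_
  simp only [flags]
  rw [h .h, h .g1, h .g2] <;> simp

lemma tracks_embH (A : QOp (HWire (P.n + P.p) P.N P.np)) :
    Tracks flags id (place (embH P) A) := by
  refine tracks_place _ _ fun s s' h => ?_
  simp only [flags]
  rw [h .h, h .g1, h .g2] <;> simp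

lemma swapList_swapsXY_flags (s : Reg P → Bool) :
    flags (swapList (swapsXY P) s) = (s .h, s .g2, s .g1) := by
  have hne : ∀ k : Reg P, (∀ j, Reg.x j ≠ k) → (∀ j, Reg.y j ≠ k) →
      swapList (swapsXY P) s k = (s ∘ Equiv.swap Reg.g1 Reg.g2) k := fun k h1 h2 => by
    rw [swapsXY, swapList]
    refine swapList_of_notMem _ _ _ fun p hp => ?_
    · obtain ⟨j, -, rfl⟩ := List.mem_map.1 hp
      exact ⟨h1 j, h2 j⟩
  simp only [flags]
  rw [hne, hne, hne] <;> simp [Equiv.swap_apply_of_ne_of_ne]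

/-- Exactly one of the two conditional exchanges takes place, before the query if `h` is set and
after it otherwise; nothing else touches these qubits. -/
lemma tracks_opQ (hk : P.k ≤ P.np) (Ra : Matrix Bool Bool ℂ)
    (OH : QOp (HWire (P.n + P.p) P.N P.np)) :
    Tracks flags (fun f => (f.1, f.2.2, f.2.1)) (opQ P hk Ra OH true) := by
  have h1 : Tracks flags (fun f => if !f.1 then (f.1, f.2.2, f.2.1) else f)
      (permOp fun s : Reg P → Bool => if true && !s h then swapList (swapsXY P) s else s) := by
    refine tracks_permOp fun s => ?_
    by_cases h : s .h <;> simp [h, swapList_swapsXY_flags] <;> simp [flags, h]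
  have h2 : Tracks flags (fun f => if f.1 then (f.1, f.2.2, f.2.1) else f)
      (permOp fun s : Reg P → Bool => if true && s h then swapList (swapsXY P) s else s) := by
    refine tracks_permOp fun s => ?_
    by_cases h : s .h <;> simp [h, swapList_swapsXY_flags] <;> simp [flags, h]
  have h3 : Tracks flags id (cOp (fun _ => true) (Reg.a (P := P)) Ra) := by
    refine tracks_cOp _ _ _ fun s s' h => ?_
    simp only [flags]
    rw [h .h, h .g1, h .g2] <;> simp
  have h4 : Tracks flags id (opPhase P hk true) :=
    (tracks_phaseOp _ _ _).mul ((tracks_phaseOp _ _ _).mul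
      ((tracks_phaseOp _ _ _).mul (tracks_phaseOp _ _ _)))
  have h5 := h1.mul ((tracks_embH OHᴴ).mul (h4.mul ((tracks_embH OH).mul (h2.mul h3))))
  intro s' s hs
  rw [h5 s' s hs]
  obtain ⟨f1, f2, f3⟩ := flags s
  cases f1 <;> simp

/-- The integer encoded by the low-order digits of a part of a matrix entry. -/
def lowInt (hk : P.k ≤ P.np) (b : Fin P.np → Bool) : ℤ :=
  bitsToInt fun i : Fin P.k => b (i.castLE hk)

/-- The phase that represents a matrix entry. -/
noncomputable def entryPhase (hk : P.k ≤ P.np) (re im : Fin P.np → Bool)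
    (θ : Fin P.k ⊕ Bool → Bool) : ℂ :=
  (if θ (Sum.inr false) then
    (if (bv fun i => θ (Sum.inl i)) < bv (flipTop fun i : Fin P.k => im (i.castLE hk)) then 1 else -1) *
      (if θ (Sum.inr true) then Complex.I else -Complex.I)
  else if (bv fun i => θ (Sum.inl i)) < bv (flipTop fun i : Fin P.k => re (i.castLE hk)) then 1 else -1)

lemma valForm_eval (hk : P.k ≤ P.np) (r : Fin P.np → Reg P) (s : Reg P → Bool) :
    (valForm P hk r).eval s =
      !decide (bv (fun i => s (w i)) < bv (flipTop fun i : Fin P.k => s (r (i.castLE hk)))) := by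
  simp only [valForm, eval, lt_eval]
  congr 4
  ext i
  simp only [flipTop]
  split_ifs <;> simp [eval]

lemma opPhase_mulVec (hk : P.k ≤ P.np) (x y : Fin (indexQubits P.N) → Bool)
    (m : Fin (P.n + P.p) → Bool) (θ : Fin P.k ⊕ Bool → Bool) (r i : Fin P.np → Bool)
    (g1 g2 a : Bool) :
    opPhase P hk true *ᵥ ket (rst x y m θ r i g1 g2 a) =
      entryPhase hk r i θ • ket (rst x y m θ r i g1 g2 a) := by
  rw [opPhase, ← mulVec_mulVec, ← mulVec_mulVec, ← mulVec_mulVec]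
  simp only [phaseOp_mulVec_ket, mulVec_smul, smul_smul]
  congr 1
  simp only [eval, valForm_eval, Bool.true_and, rst, entryPhase]
  cases θ (Sum.inr false) <;> cases θ (Sum.inr true) <;> simp <;>
    split_ifs <;> simp_all

variable (OH : QOp (HWire (P.n + P.p) P.N P.np)) (Of : QOp (FWire (P.n + P.p) P.N))

/-- The contents of the value oracle. -/
structure ValData (vre vim : (Fin (P.n + P.p) → Bool) → Fin P.N → Fin P.N → Fin P.np → Bool) :
    Prop where
  unitary : OH ∈ unitaryGroup (HWire (P.n + P.p) P.N P.np → Bool) ℂ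
  spec : ∀ m (x y : Fin P.N), OH *ᵥ ket (Sum.elim m (Sum.elim (natBits _ x) (Sum.elim (natBits _ y)
    (Sum.elim (fun _ => false) fun _ => false)))) = ket (Sum.elim m (Sum.elim (natBits _ x)
      (Sum.elim (natBits _ y) (Sum.elim (vre m x y) (vim m x y)))))

/-- The contents of the position oracle. -/
structure PosData (f : (Fin (P.n + P.p) → Bool) → Fin P.N → Fin P.d → Fin P.N) : Prop where
  unitary : Of ∈ unitaryGroup (FWire (P.n + P.p) P.N → Bool) ℂ
  inj : ∀ m x, Function.Injective (f m x)
  spec : ∀ m (x : Fin P.N) (j : Fin P.d), Of *ᵥ ket (Sum.elim m (Sum.elim (natBits _ x)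
    (natBits _ j))) = ket (Sum.elim m (Sum.elim (natBits _ x) (natBits _ (f m x j))))

variable {OH Of} {vre vim : (Fin (P.n + P.p) → Bool) → Fin P.N → Fin P.N → Fin P.np → Bool}
  {f : (Fin (P.n + P.p) → Bool) → Fin P.N → Fin P.d → Fin P.N}

/-- Query, phase, inverse query: the value registers return to zero and only the phase remains. -/
lemma place_embH_conj (hk : P.k ≤ P.np) (hV : ValData OH vre vim) (x y : Fin P.N)
    (m : Fin (P.n + P.p) → Bool) (θ : Fin P.k ⊕ Bool → Bool) (g1 g2 a : Bool) :
    place (embH P) OHᴴ *ᵥ opPhase P hk true *ᵥ place (embH P) OH *ᵥ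
      ket (rst (natBits _ x) (natBits _ y) m θ (fun _ => false) (fun _ => false) g1 g2 a) =
    entryPhase hk (vre m x y) (vim m x y) θ •
      ket (rst (natBits _ x) (natBits _ y) m θ (fun _ => false) (fun _ => false) g1 g2 a) := by
  have hc : ∀ r i : Fin P.np → Bool, rst (natBits _ x) (natBits _ y) m θ r i g1 g2 a ∘ embH P =
      Sum.elim m (Sum.elim (natBits _ x) (Sum.elim (natBits _ y) (Sum.elim r i))) := by
    intro r i
    ext k
    rcases k with k | k | k | k | k <;> rfl
  have hinv : OHᴴ *ᵥ ket (Sum.elim m (Sum.elim (natBits _ x)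
      (Sum.elim (natBits _ y) (Sum.elim (vre m x y) (vim m x y))))) =
      ket (Sum.elim m (Sum.elim (natBits _ x) (Sum.elim (natBits _ y)
        (Sum.elim (fun _ => false) fun _ => false)))) := by
    have := mem_unitaryGroup_iff'.1 hV.unitary
    rw [star_eq_conjTranspose] at this
    rw [← hV.spec m x y, mulVec_mulVec, this, one_mulVec]
  rw [place_mulVec_ket_of_ket _ _ _ _ ((hc _ _).symm ▸ hV.spec m x y), extend_embH,
    opPhase_mulVec, mulVec_smul, place_mulVec_ket_of_ket _ _ _ _ ((hc _ _).symm ▸ hinv),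
    extend_embH]

/-- If `h` is set, the registers are exchanged before the query, so the entry read is the one in the
transposed position. Averaging over `h` will make the encoded matrix Hermitian even if the oracle
values are not. -/
lemma opQ_mulVec (hk : P.k ≤ P.np) (Ra : Matrix Bool Bool ℂ) (hV : ValData OH vre vim)
    (x y : Fin P.N) (m : Fin (P.n + P.p) → Bool) (θ : Fin P.k ⊕ Bool → Bool) :
    opQ P hk Ra OH true *ᵥ ket (rst (natBits _ x) (natBits _ y) m θ (fun _ => false)
        (fun _ => false) false false false) =
      ∑ c, (Ra c false * if θ (Sum.inr true) then entryPhase hk (vre m y x) (vim m y x) θ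
          else entryPhase hk (vre m x y) (vim m x y) θ) •
        ket (rst (natBits _ y) (natBits _ x) m θ (fun _ => false) (fun _ => false)
          false false c) := by
  have hu : ∀ c, Function.update (rst (natBits _ x) (natBits _ y) m θ (fun _ => false)
      (fun _ => false) false false false) .a c = rst (P := P) (natBits _ x) (natBits _ y) m θ
      (fun _ => false) (fun _ => false) false false c := by
    intro c
    ext k
    cases k <;> simp [rst]
  rw [opQ]
  simp only [← mulVec_mulVec]
  rw [cOp_mulVec_ket, if_pos rfl]
  simp_rw [hu]
  simp only [mulVec_sum, mulVec_smul, permOp_mulVec_ket]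
  refine Finset.sum_congr rfl fun c _ => ?_
  rw [mul_smul]
  congr 1
  have hh : ∀ x y c, rst (P := P) x y m θ (fun _ => false) (fun _ => false) false false c .h =
    θ (Sum.inr true) := fun _ _ _ => rfl
  by_cases h : θ (Sum.inr true)
  · simp only [hh, h, Bool.and_true, if_true, swapList_swapsXY]
    rw [place_embH_conj hk hV, mulVec_smul, permOp_mulVec_ket]
    simp [hh, h]
  · simp only [hh, h, Bool.and_false, Bool.false_eq_true, if_false]
    rw [place_embH_conj hk hV, mulVec_smul, permOp_mulVec_ket]
    simp [hh, h, swapList_swapsXY]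

lemma vecT_support (x : Fin (indexQubits P.N) → Bool) (m : Fin (P.n + P.p) → Bool)
    (j : Fin P.kd → Bool) (θ : Fin P.k ⊕ Bool → Bool) :
    ∀ s, vecT Of x m j θ s ≠ 0 → flags s = (θ (Sum.inr true), decide (P.d ≤ bv j), false) := by
  refine (tracks_embF Of).mulVec (c := (θ (Sum.inr true), decide (P.d ≤ bv j), false))
    fun s hs => ?_
  rw [ket_apply] at hs
  split_ifs at hs with h
  · rw [h]; rfl
  · exact (hs rfl).elim

lemma vecT_eq (hF : PosData Of f) (x : Fin P.N) (m : Fin (P.n + P.p) → Bool)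
    (j : Fin P.kd → Bool) (θ : Fin P.k ⊕ Bool → Bool) (hj : bv j < P.d) :
    vecT Of (natBits _ x) m j θ = ket (rst (natBits _ x) (natBits _ (f m x ⟨bv j, hj⟩)) m θ
      (fun _ => false) (fun _ => false) false false false) := by
  have hc : ∀ g1, rst (natBits _ x) (natBits _ (bv j)) m θ (fun _ => false) (fun _ => false)
      g1 false false ∘ embF P = Sum.elim m (Sum.elim (natBits _ x) (natBits _ (bv j))) := by
    intro g1
    ext k
    rcases k with k | k | k <;> rfl
  rw [vecT, place_mulVec_ket_of_ket _ _ _ _ ((hc _).symm ▸ hF.spec m x ⟨bv j, hj⟩), extend_embF,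
    decide_eq_false (not_le.2 hj)]

/-- For genuine positions both sides are basis states, and after the exchange they agree only if
each row lists the other and the times and the auxiliary qubits coincide. All other contributions
are removed by the flags. -/
lemma vecT_dotProduct (hk : P.k ≤ P.np) (Ra : Matrix Bool Bool ℂ) (hV : ValData OH vre vim)
    (hF : PosData Of f) (x x' : Fin P.N) (m m' : Fin (P.n + P.p) → Bool)
    (j j' : Fin P.kd → Bool) (θ θ' : Fin P.k ⊕ Bool → Bool) :
    star (vecT Of (natBits _ x') m' j' θ') ⬝ᵥ
        (opQ P hk Ra OH true *ᵥ vecT Of (natBits _ x) m j θ) =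
      if h : bv j < P.d ∧ bv j' < P.d then
        if f m x ⟨bv j, h.1⟩ = x' ∧ f m x' ⟨bv j', h.2⟩ = x ∧ m' = m ∧ θ' = θ then
          Ra false false * if θ (Sum.inr true) then entryPhase hk (vre m x' x) (vim m x' x) θ
            else entryPhase hk (vre m x x') (vim m x x') θ
        else 0
      else 0 := by
  split_ifs with h h2 h3
  · obtain ⟨h4, h5, rfl, rfl⟩ := h2
    rw [vecT_eq hF _ _ _ _ h.1, vecT_eq hF _ _ _ _ h.2, star_ket_dotProduct, opQ_mulVec hk Ra hV,
      h4, h5]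
    simp [ket_apply, rst_injective, h3]
  · obtain ⟨h4, h5, rfl, rfl⟩ := h2
    rw [vecT_eq hF _ _ _ _ h.1, vecT_eq hF _ _ _ _ h.2, star_ket_dotProduct, opQ_mulVec hk Ra hV,
      h4, h5]
    simp [ket_apply, rst_injective, h3]
  · rw [vecT_eq hF _ _ _ _ h.1, vecT_eq hF _ _ _ _ h.2, star_ket_dotProduct, opQ_mulVec hk Ra hV,
      Finset.sum_apply]
    refine Finset.sum_eq_zero fun c _ => ?_
    suffices h6 : ¬ rst (P := P) (natBits _ x') (natBits _ (f m' x' ⟨bv j', h.2⟩)) m' θ'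
        (fun _ => false) (fun _ => false) false false false = rst (natBits _ (f m x ⟨bv j, h.1⟩))
          (natBits _ x) m θ (fun _ => false) (fun _ => false) false false c by
      rw [Pi.smul_apply, ket_apply, if_neg h6, smul_zero]
    intro h6
    obtain ⟨e1, e2, e3, e4, -⟩ := rst_injective.1 h6
    subst e3 e4
    have e1' := Fin.ext (natBits_injOn (index_lt _) (index_lt _) e1)
    have e2' := Fin.ext (natBits_injOn (index_lt _) (index_lt _) e2)
    exact h2 ⟨e1'.symm, e2', rfl, rfl⟩
  -- After the exchange the flags `(g1, g2)` of the right vector are `(false, d ≤ j)`, while those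
  -- of the left vector are `(d ≤ j', false)`; they agree only if both positions are less than `d`.
  · refine dotProduct_eq_zero_of_support (F := flags) ?_ (vecT_support _ _ _ _)
      ((tracks_opQ hk Ra OH).mulVec (vecT_support _ _ _ _))
    simp only [ne_eq, Prod.mk.injEq, decide_eq_false_iff_not, not_and]
    intro _ h1 h2
    have h2' := h2.symm
    simp only [decide_eq_false_iff_not] at h2'
    exact h ⟨by omega, by omega⟩

end BlockH

/-! ### Entries of the two block encodings. -/

section BlockEntries

variable {P : Params}

open Reg Form

lemma sum_bv {α : Type*} [AddCommMonoid α] {n : ℕ} (F : ℕ → α) :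
    ∑ b : Fin n → Bool, F (bv b) = ∑ x ∈ Finset.range (2 ^ n), F x := by
  rw [sum_bits]
  refine Finset.sum_congr rfl fun x hx => ?_
  rw [bv_natBits, Nat.mod_eq_of_lt (Finset.mem_range.1 hx)]

lemma sum_bv_dite {n d : ℕ} (hd : d ≤ 2 ^ n) (F : Fin d → ℂ) :
    ∑ b : Fin n → Bool, (if h : bv b < d then F ⟨bv b, h⟩ else 0) = ∑ j, F j := by
  rw [sum_bv fun t => if h : t < d then F ⟨t, h⟩ else 0,
    ← Finset.sum_subset (Finset.range_subset_range.2 hd), Finset.sum_range]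
  · exact Finset.sum_congr rfl fun j _ => by simp
  · intro x _ hx
    rw [dif_neg (by simpa using hx)]

/-- There are `V` positive and `2 ^ k - V` negative signs. -/
lemma sum_sign (k V : ℕ) (hV : V ≤ 2 ^ k) :
    ∑ b : Fin k → Bool, (if bv b < V then (1 : ℂ) else -1) = 2 * V - 2 ^ k := by
  have h2 : ∀ V, V ≤ 2 ^ k →
      ∑ x ∈ Finset.range (2 ^ k), (if x < V then (2 : ℂ) else 0) = 2 * V := by
    intro V hV
    rw [← Finset.sum_subset (Finset.range_subset_range.2 hV)]
    · rw [Finset.sum_congr rfl fun x hx => if_pos (Finset.mem_range.1 hx)]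
      simp [mul_comm]
    · intro x _ hx
      rw [if_neg (by simpa using hx)]
  rw [sum_bv fun t => if t < V then (1 : ℂ) else -1, ← h2 V hV]
  have : (2 : ℂ) ^ k = ∑ x ∈ Finset.range (2 ^ k), (1 : ℂ) := by simp
  rw [this, ← Finset.sum_sub_distrib]
  refine Finset.sum_congr rfl fun x _ => ?_
  split_ifs <;> norm_num

/-- The offset of `flipTop` is half of `2 ^ k`, so it cancels the constant term in `sum_sign`. -/
lemma sum_sign_lowInt (hk : P.k ≤ P.np) (hk0 : 0 < P.k) (b : Fin P.np → Bool) :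
    ∑ w : Fin P.k → Bool,
      (if bv w < bv (flipTop fun i : Fin P.k => b (i.castLE hk)) then (1 : ℂ) else -1) =
      2 * lowInt hk b := by
  rw [sum_sign _ _ (bv_lt _).le]
  have h := bv_flipTop hk0 fun i : Fin P.k => b (i.castLE hk)
  have h' : ((bv (flipTop fun i : Fin P.k => b (i.castLE hk)) : ℕ) : ℂ) =
      lowInt hk b + 2 ^ (P.k - 1) := by
    rw [lowInt]
    exact_mod_cast congrArg (Int.cast : ℤ → ℂ) h
  rw [h']
  obtain ⟨k, hk'⟩ := Nat.exists_eq_succ_of_ne_zero hk0.ne'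
  rw [hk', Nat.succ_sub_one, Nat.succ_eq_add_one, pow_succ]
  ring

/-- The complex integer encoded by the low-order digits of a matrix entry. -/
noncomputable def lowVal (hk : P.k ≤ P.np) (re im : Fin P.np → Bool) : ℂ :=
  lowInt hk re + lowInt hk im * Complex.I

variable {OH : QOp (HWire (P.n + P.p) P.N P.np)} {Of : QOp (FWire (P.n + P.p) P.N)}
variable {vre vim : (Fin (P.n + P.p) → Bool) → Fin P.N → Fin P.N → Fin P.np → Bool}
  {f : (Fin (P.n + P.p) → Bool) → Fin P.N → Fin P.d → Fin P.N}

/-- The qubit `sel` chooses between the real and the imaginary part. The imaginary part gets the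
phase `i` or `-i` according to `h`; the second choice conjugates the entry read in the other
position. -/
lemma sum_entryPhase (hk : P.k ≤ P.np) (hk0 : 0 < P.k) (r i r' i' : Fin P.np → Bool) :
    ∑ θ : Fin P.k ⊕ Bool → Bool,
      (if θ (Sum.inr true) then entryPhase hk r i θ else entryPhase hk r' i' θ) =
      2 * (lowVal hk r i + star (lowVal hk r' i')) := by
  have e : ∑ θ : Fin P.k ⊕ Bool → Bool,
      (if θ (Sum.inr true) then entryPhase hk r i θ else entryPhase hk r' i' θ) =
      ∑ u : (Fin P.k → Bool) × (Bool × Bool),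
        (if u.2.2 then
          (if u.2.1 then (if bv u.1 < bv (flipTop fun i_1 : Fin P.k => i (i_1.castLE hk)) then 1
              else -1) * Complex.I
            else if bv u.1 < bv (flipTop fun i_1 : Fin P.k => r (i_1.castLE hk)) then 1 else -1)
        else
          (if u.2.1 then (if bv u.1 < bv (flipTop fun i_1 : Fin P.k => i' (i_1.castLE hk)) then 1
              else -1) * -Complex.I
            else if bv u.1 < bv (flipTop fun i_1 : Fin P.k => r' (i_1.castLE hk)) then 1
              else -1)) := by
    refine Fintype.sum_equiv ((Equiv.sumArrowEquivProdArrow _ _ _).trans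
      ((Equiv.refl _).prodCongr (Equiv.boolArrowEquivProd _))) _ _ fun θ => ?_
    simp only [entryPhase, Equiv.trans_apply, Equiv.prodCongr_apply, Equiv.boolArrowEquivProd,
      Equiv.sumArrowEquivProdArrow, Equiv.coe_fn_mk, Prod.map, Equiv.refl_apply,
      Function.comp_def]
    cases θ (Sum.inr true) <;> cases θ (Sum.inr false) <;> simp
  rw [e, Fintype.sum_prod_type_right]
  simp only [Fintype.sum_prod_type, Fintype.sum_bool, if_true, Bool.false_eq_true, if_false,
    ← Finset.sum_mul, sum_sign_lowInt hk hk0, lowVal]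
  simp only [star_add, star_mul', Complex.star_def, Complex.conj_I, map_intCast]
  ring

/-- The indicator of the columns listed by the position oracle. -/
def listed (f : (Fin (P.n + P.p) → Bool) → Fin P.N → Fin P.d → Fin P.N)
    (m : Fin (P.n + P.p) → Bool) (x y : Fin P.N) : Prop := ∃ j, f m x j = y

open Classical in
/-- The Hermitian matrix, in units of the encoding, that the oracles define. -/
noncomputable def oracleMatrix (hk : P.k ≤ P.np)
    (vre vim : (Fin (P.n + P.p) → Bool) → Fin P.N → Fin P.N → Fin P.np → Bool)
    (f : (Fin (P.n + P.p) → Bool) → Fin P.N → Fin P.d → Fin P.N) (m : Fin (P.n + P.p) → Bool) :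
    Matrix (Fin P.N) (Fin P.N) ℂ := fun x' x =>
  if listed f m x x' ∧ listed f m x' x then
    (lowVal hk (vre m x' x) (vim m x' x) + star (lowVal hk (vre m x x') (vim m x x'))) / 2 else 0

open Classical in
lemma sum_listed (hF : PosData Of f) (m : Fin (P.n + P.p) → Bool) (x y : Fin P.N) :
    ∑ j : Fin P.d, (if f m x j = y then (1 : ℂ) else 0) = if listed f m x y then 1 else 0 := by
  split_ifs with h
  · obtain ⟨j, hj⟩ := h
    rw [Finset.sum_eq_single j]
    · rw [if_pos hj]
    · intro i _ hi
      rw [if_neg fun h' => hi (hF.inj m x (h'.trans hj.symm))]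
    · simp
  · exact Finset.sum_eq_zero fun j _ => if_neg fun h' => h ⟨j, h'⟩

lemma inv_sqrt_two_pow (r : ℕ) :
    star (((√2 : ℝ) : ℂ)⁻¹ ^ r) * ((√2 : ℝ) : ℂ)⁻¹ ^ r = (2 ^ r)⁻¹ := by
  have : ((√2 : ℝ) : ℂ) * (√2 : ℝ) = 2 := by
    rw [← Complex.ofReal_mul, Real.mul_self_sqrt (by norm_num)]; norm_num
  simp only [Complex.star_def, map_pow, map_inv₀, Complex.conj_ofReal]
  rw [← mul_pow, ← mul_inv, this, inv_pow]

lemma star_sum_dotProduct_sum {ι κ : Type} [Fintype ι] [Fintype κ] (A : Matrix κ κ ℂ) (c : ℂ)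
    (u v : ι → κ → ℂ) :
    star (∑ i, c • u i) ⬝ᵥ (A *ᵥ ∑ i, c • v i) =
      star c * c * ∑ i, ∑ j, star (u i) ⬝ᵥ (A *ᵥ v j) := by
  rw [star_sum, Matrix.mulVec_sum, sum_dotProduct]
  simp_rw [dotProduct_sum, mulVec_smul, star_smul, smul_dotProduct, dotProduct_smul, smul_eq_mul,
    Finset.mul_sum, mul_assoc]

/-- The uniform amplitudes of the two preparations give `2 ^ -(kd + k + 2)`, and the sum of the
phases is four times the Hermitian average in `oracleMatrix`. The sparsity enters only through `2 ^
kd`. -/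
lemma opB_true_apply (hd : 0 < P.d) (hdN : P.d ≤ P.N) (hdk : P.d ≤ 2 ^ P.kd)
    (hkd : P.kd ≤ indexQubits P.N) (hk : P.k ≤ P.np) (hk0 : 0 < P.k) (Ra : Matrix Bool Bool ℂ)
    (hV : ValData OH vre vim) (hF : PosData Of f) (g' g : Fin P.N × (Fin (P.n + P.p) → Bool)) :
    opB P hkd hk Ra OH Of true (gst g') (gst g) =
      if g'.2 = g.2 then Ra false false * (2 ^ (P.kd + P.k))⁻¹ *
        oracleMatrix hk vre vim f g.2 g'.1 g.1 else 0 := by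
  classical
  obtain ⟨x', m'⟩ := g'
  obtain ⟨x, m⟩ := g
  rw [opB, conjTranspose_mul_mul_apply, opT_mulVec hd hdN hkd, opT_mulVec hd hdN hkd,
    star_sum_dotProduct_sum, inv_sqrt_two_pow]
  simp_rw [vecT_dotProduct hk Ra hV hF]
  -- Rewritten as a product of factors in separate variables, so that the double sum factorizes.
  have key : ∀ u' u : (Fin P.kd → Bool) × (Fin P.k ⊕ Bool → Bool),
      (if h : bv u.1 < P.d ∧ bv u'.1 < P.d then
        if f m x ⟨bv u.1, h.1⟩ = x' ∧ f m x' ⟨bv u'.1, h.2⟩ = x ∧ m' = m ∧ u'.2 = u.2 then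
          Ra false false * if u.2 (Sum.inr true) then entryPhase hk (vre m x' x) (vim m x' x) u.2
            else entryPhase hk (vre m x x') (vim m x x') u.2
        else 0
      else 0) =
      (if m' = m then 1 else 0) * Ra false false *
      (if h : bv u'.1 < P.d then (if f m x' ⟨bv u'.1, h⟩ = x then (1 : ℂ) else 0) else 0) *
      (if h : bv u.1 < P.d then (if f m x ⟨bv u.1, h⟩ = x' then (1 : ℂ) else 0) else 0) *
      (if u'.2 = u.2 then (if u.2 (Sum.inr true) then
        entryPhase hk (vre m x' x) (vim m x' x) u.2
            else entryPhase hk (vre m x x') (vim m x x') u.2) else 0) := by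
    intro u' u
    by_cases h1 : bv u.1 < P.d
    · by_cases h2 : bv u'.1 < P.d
      · rw [dif_pos ⟨h1, h2⟩, dif_pos h1, dif_pos h2]
        by_cases h3 : f m x ⟨bv u.1, h1⟩ = x'
        · by_cases h4 : f m x' ⟨bv u'.1, h2⟩ = x
          · by_cases h5 : m' = m
            · by_cases h6 : u'.2 = u.2
              · rw [if_pos ⟨h3, h4, h5, h6⟩, if_pos h3, if_pos h4, if_pos h5, if_pos h6]
                ring
              · rw [if_neg fun h => h6 h.2.2.2, if_neg h6]; ring
            · rw [if_neg fun h => h5 h.2.2.1, if_neg h5]; ring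
          · rw [if_neg fun h => h4 h.2.1, if_neg h4]; ring
        · rw [if_neg fun h => h3 h.1, if_neg h3]; ring
      · rw [dif_neg fun h => h2 h.2, dif_neg h2]; ring
    · rw [dif_neg fun h => h1 h.1, dif_neg h1]; ring
  simp_rw [key]
  have hsum : ∀ (c : ℂ) (A B : (Fin P.kd → Bool) → ℂ) (G : (Fin P.k ⊕ Bool → Bool) → ℂ),
      ∑ u' : (Fin P.kd → Bool) × (Fin P.k ⊕ Bool → Bool),
        ∑ u : (Fin P.kd → Bool) × (Fin P.k ⊕ Bool → Bool),
        c * A u'.1 * B u.1 * (if u'.2 = u.2 then G u.2 else 0) =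
        c * (∑ j, A j) * (∑ j, B j) * ∑ θ, G θ := by
    intro c A B G
    simp_rw [Fintype.sum_prod_type, ← Finset.mul_sum, Finset.sum_ite_eq, Finset.mem_univ, if_true,
      ← Finset.sum_mul, ← Finset.mul_sum, ← Finset.sum_mul, ← Finset.mul_sum]
  rw [hsum _ (fun j => if h : bv j < P.d then (if f m x' ⟨bv j, h⟩ = x then (1 : ℂ) else 0) else 0)
      (fun j => if h : bv j < P.d then (if f m x ⟨bv j, h⟩ = x' then (1 : ℂ) else 0) else 0)
      (fun θ => if θ (Sum.inr true) then entryPhase hk (vre m x' x) (vim m x' x) θ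
            else entryPhase hk (vre m x x') (vim m x x') θ),
    sum_bv_dite hdk fun j => if f m x' j = x then (1 : ℂ) else 0,
    sum_bv_dite hdk fun j => if f m x j = x' then (1 : ℂ) else 0,
    sum_listed hF, sum_listed hF, sum_entryPhase hk hk0, oracleMatrix, pow_add, pow_add, pow_add]
  have h2 : (2 : ℂ) ^ P.kd ≠ 0 := pow_ne_zero _ two_ne_zero
  have h3 : (2 : ℂ) ^ P.k ≠ 0 := pow_ne_zero _ two_ne_zero
  by_cases h5 : m' = m
  · rw [if_pos h5, if_pos h5]
    by_cases h6 : listed f m x x'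
    · by_cases h7 : listed f m x' x
      · rw [if_pos h7, if_pos h6, if_pos ⟨h6, h7⟩]
        field_simp
      · simp [h7]
    · simp [h6]
  · rw [if_neg h5, if_neg h5]; ring

lemma cOp_false {κ : Type} [Fintype κ] [DecidableEq κ] (t : κ) (U : Matrix Bool Bool ℂ) :
    cOp (fun _ => false) t U = 1 := by
  refine ext_ket fun s => ?_
  rw [cOp_mulVec_ket, one_mulVec]
  simp

lemma phaseOp_false {κ : Type} [Fintype κ] [DecidableEq κ] (z : ℂ) :
    phaseOp (fun _ : κ → Bool => false) z = 1 := by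
  simp [phaseOp]

lemma permOp_id {κ : Type} [Fintype κ] [DecidableEq κ] :
    permOp (fun s : κ → Bool => s) = 1 := by
  refine ext_ket fun s => ?_
  rw [permOp_mulVec_ket, one_mulVec]

lemma opT_conjTranspose_mul (hkd : P.kd ≤ indexQubits P.N)
    (hOf : Of ∈ unitaryGroup (FWire (P.n + P.p) P.N → Bool) ℂ) :
    (opT P hkd Of)ᴴ * opT P hkd Of = 1 := by
  have h1 := place_mem_unitary (embF P) hOf
  have h2 : cOp (fun s => (posForm P).eval s) Reg.g1 pauliX ∈ unitaryGroup _ ℂ :=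
    cOp_mem_unitary (Form.Avoids.indepOf (lt_avoids _ _ (fun i => const_avoids _ _)
      fun i => by simp [Form.Avoids])) pauliX_mem
  have h3 : place (embT P hkd) (hadAll _) ∈ unitaryGroup _ ℂ :=
    place_mem_unitary _ (by
      rw [mem_unitaryGroup_iff, star_eq_conjTranspose, hadAll_conjTranspose, hadAll_mul_self])
  have h := mul_mem h1 (mul_mem h2 h3)
  rw [mem_unitaryGroup_iff', star_eq_conjTranspose] at h
  exact h

/-- Only the operators enclosed by a preparation and its inverse, or by a query and its inverse,
carry the condition. Without them the enclosing pairs cancel, so the queries need no control. -/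
lemma opB_false (hkd : P.kd ≤ indexQubits P.N) (hk : P.k ≤ P.np) (Ra : Matrix Bool Bool ℂ)
    (hOH : OH ∈ unitaryGroup (HWire (P.n + P.p) P.N P.np → Bool) ℂ)
    (hOf : Of ∈ unitaryGroup (FWire (P.n + P.p) P.N → Bool) ℂ) :
    opB P hkd hk Ra OH Of false = 1 := by
  have h1 := mem_unitaryGroup_iff'.1 hOH
  rw [star_eq_conjTranspose] at h1
  rw [opB, opQ, opPhase]
  simp only [Bool.false_and, phaseOp_false, cOp_false, Matrix.one_mul, Matrix.mul_one,
    Bool.false_eq_true, if_false, permOp_id]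
  rw [place_mul, h1, place_one, Matrix.one_mul, opT_conjTranspose_mul hkd hOf]

lemma opL_false : opL P false = 1 := by
  rw [opL]
  simp only [Bool.false_and, cOp_false, Matrix.one_mul, Bool.false_eq_true, if_false, permOp_id]
  rw [place_mul, hadAll_mul_self, place_one]

/-- The low-order bits of the time index. -/
def lowBits (m : Fin (P.n + P.p) → Bool) : Fin P.n → Bool := fun i => m (i.castAdd P.p)

/-- The high-order bits of the time index. -/
def topBits (m : Fin (P.n + P.p) → Bool) : Fin P.p → Bool := fun i => m (i.natAdd P.n)

/-- A good basis state with given contents of the second clock and the flag of the comparison. -/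
def cst (g : Fin P.N × (Fin (P.n + P.p) → Bool)) (a : Fin P.n → Bool) (e : Bool) : Reg P → Bool
  | .m2 i => a i
  | .e => e
  | k => gst g k

lemma cst_injective {g g' : Fin P.N × (Fin (P.n + P.p) → Bool)} {a a' : Fin P.n → Bool}
    {e e' : Bool} : cst g a e = cst g' a' e' ↔ g = g' ∧ a = a' ∧ e = e' := by
  constructor
  · intro h
    have h' := congrFun h
    refine ⟨gst_injective (funext fun k => ?_), funext fun i => h' (.m2 i), h' .e⟩
    cases k with
    | m2 i => rfl
    | e => rfl
    | x i => exact h' (.x i)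
    | m i => exact h' (.m i)
    | _ => rfl
  · rintro ⟨rfl, rfl, rfl⟩
    rfl

lemma swapList_swapsM (x : Fin P.N) (m : Fin (P.n + P.p) → Bool) (a : Fin P.n → Bool) (e : Bool) :
    swapList (swapsM P) (cst (x, m) a e) = cst (x, Fin.append a (topBits m)) (lowBits m) e := by
  have key := swapList_map (fun i : Fin P.n => Reg.m (P := P) (i.castAdd P.p)) Reg.m2
    (fun _ _ h => by simpa using h) (fun _ _ h => by simpa using h) (by simp) (List.finRange _)
    (List.nodup_finRange _) (cst (x, m) a e)
  have hne : ∀ k : Reg P, (∀ j : Fin P.n, Reg.m (j.castAdd P.p) ≠ k) → (∀ j, Reg.m2 j ≠ k) →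
      swapList (swapsM P) (cst (x, m) a e) k = cst (x, m) a e k := fun k h1 h2 =>
    swapList_of_notMem _ _ _ fun p hp => by
      obtain ⟨j, -, rfl⟩ := List.mem_map.1 hp
      exact ⟨h1 j, h2 j⟩
  ext k
  cases k with
  | m j =>
    refine Fin.addCases (fun i => ?_) (fun i => ?_) j
    · rw [swapsM, (key i (List.mem_finRange i)).1]
      simp [cst, gst, rst]
    · rw [hne _ (fun j h => by simp [Fin.ext_iff] at h; omega) (by simp)]
      simp [cst, gst, rst, topBits]
  | m2 j => rw [swapsM, (key j (List.mem_finRange j)).2]; rfl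
  | _ => rw [hne _ (by simp) (by simp)]; rfl

lemma clockForm_eval (x : Fin P.N) (m : Fin (P.n + P.p) → Bool) (a : Fin P.n → Bool) (e : Bool) :
    (clockForm P).eval (cst (x, m) a e) = !decide (bv (lowBits m) < bv a) := by
  simp only [clockForm, eval, lt_eval]
  rfl

lemma place_embM2_mulVec (g : Fin P.N × (Fin (P.n + P.p) → Bool)) :
    place (embM2 P) (hadAll _) *ᵥ ket (gst g) =
      ∑ a, ((√2 : ℝ) : ℂ)⁻¹ ^ P.n • ket (cst g a false) := by
  have h0 : gst g ∘ embM2 P = fun _ => false := rfl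
  have h1 : ∀ a, Function.extend (embM2 P) a (gst g) = cst g a false := by
    intro a
    ext k
    cases k with
    | m2 i => exact (embM2 P).injective.extend_apply _ _ i
    | _ => rw [Function.extend_apply' _ _ _ (by simp)]; rfl
  rw [place_mulVec_ket, h0]
  simp_rw [hadAll_zero, h1, Fintype.card_fin]

/-- The preparation of the new time and the projection of the old one, which the exchange leaves in
`m2`, each contribute an amplitude `2 ^ (-n / 2)`. The flag `e` removes the pairs in which the new
time is not later. -/
lemma opL_true_apply (g' g : Fin P.N × (Fin (P.n + P.p) → Bool)) :
    opL P true (gst g') (gst g) =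
      if g'.1 = g.1 ∧ topBits g'.2 = topBits g.2 ∧ bv (lowBits g.2) < bv (lowBits g'.2) then
        (2 ^ P.n)⁻¹ else 0 := by
  obtain ⟨x', m'⟩ := g'
  obtain ⟨x, m⟩ := g
  have happ : ∀ (u : Fin P.n → Bool) (v : Fin P.p → Bool), m' = Fin.append u v ↔
      u = lowBits m' ∧ topBits m' = v := by
    intro u v
    constructor
    · rintro rfl
      exact ⟨by ext i; simp [lowBits], by ext i; simp [topBits]⟩
    · rintro ⟨rfl, rfl⟩
      ext j
      refine Fin.addCases (fun i => ?_) (fun i => ?_) j <;> simp [lowBits, topBits]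
  have hA : (place (embM2 P) (hadAll _))ᴴ = place (embM2 P) (hadAll _) := by
    rw [place_conjTranspose, hadAll_conjTranspose]
  rw [opL, ← Matrix.mul_assoc (permOp _)]
  nth_rewrite 1 [← hA]
  rw [conjTranspose_mul_mul_apply, place_embM2_mulVec, place_embM2_mulVec,
    star_sum_dotProduct_sum, inv_sqrt_two_pow]
  have key : ∀ a : Fin P.n → Bool,
      ((permOp fun s : Reg P → Bool => if true then swapList (swapsM P) s else s) *
        cOp (fun s => true && (clockForm P).eval s) Reg.e pauliX) *ᵥ ket (cst (x, m) a false) =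
      ket (cst (x, Fin.append a (topBits m)) (lowBits m) (!decide (bv (lowBits m) < bv a))) := by
    intro a
    rw [← mulVec_mulVec, flip_mulVec_ket, permOp_mulVec_ket, if_pos rfl, Bool.true_and,
      clockForm_eval, ← swapList_swapsM]
    congr 2
    by_cases h : bv (lowBits m) < bv a
    · simp [h]
    · simp only [h, decide_false, Bool.not_false, if_true]
      ext k
      cases k <;> simp [cst, gst, rst]
  simp_rw [if_true] at key ⊢
  simp_rw [key, star_ket_dotProduct, ket_apply, cst_injective, Prod.mk.injEq, happ]
  split_ifs with h
  · obtain ⟨h1, h2, h3⟩ := h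
    rw [Finset.sum_eq_single (lowBits m), Finset.sum_eq_single (lowBits m')]
    · rw [if_pos]
      · simp
      · simp [h1, h2, h3]
    · intro a _ ha
      rw [if_neg]
      rintro ⟨⟨-, h, -⟩, -⟩
      exact ha h
    · simp
    · intro a _ ha
      refine Finset.sum_eq_zero fun b _ => if_neg ?_
      rintro ⟨-, h, -⟩
      exact ha h
    · simp
  · rw [Finset.sum_eq_zero, mul_zero]
    intro a _
    refine Finset.sum_eq_zero fun b _ => if_neg ?_
    rintro ⟨⟨h1, h2, h3⟩, h4, h5⟩
    subst h2
    refine h ⟨h1, h3, ?_⟩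
    simpa using h5

end BlockEntries

/-! ### Sequences of operators with flags for failure. -/

section Flags

variable {ρ β : Type} [Fintype ρ] [DecidableEq ρ] [Fintype β] [DecidableEq β]

lemma flip_mul_apply {ψ : (ρ → Bool) → Bool} {t : ρ} (h : IndepOf t ψ) (A : QOp ρ)
    (x y : ρ → Bool) : (cOp ψ t pauliX * A) x y =
      A (if ψ x then Function.update x t (!x t) else x) y := by
  have h1 : (cOp ψ t pauliX)ᴴ = cOp ψ t pauliX := by
    rw [cOp_conjTranspose h]
    congr 1
    ext a b
    cases a <;> cases b <;> simp [pauliX]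
  rw [← conjTranspose_conjTranspose (cOp ψ t pauliX * A), conjTranspose_mul, h1,
    conjTranspose_apply, ← mulVec_ket (Aᴴ * _), ← mulVec_mulVec, flip_mulVec_ket, mulVec_ket,
    conjTranspose_apply, star_star]

lemma ctrlLift_mul_apply (u : (β → Bool) → QOp ρ) (A : QOp (ρ ⊕ β)) (s : ρ → Bool) (b : β → Bool)
    (y : ρ ⊕ β → Bool) :
    (ctrlLift u * A) (Sum.elim s b) y = ∑ a, u b s a * A (Sum.elim a b) y := by
  rw [← conjTranspose_conjTranspose (ctrlLift u * A), conjTranspose_mul, conjTranspose_apply,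
    ← mulVec_ket (Aᴴ * _), ← mulVec_mulVec, ctrlLift_conjTranspose, ctrlLift_mulVec_ket,
    mulVec_sum_smul_ket, Finset.sum_apply, star_sum]
  refine Finset.sum_congr rfl fun a _ => ?_
  rw [Pi.smul_apply, mulVec_ket, smul_eq_mul, star_mul', conjTranspose_apply, conjTranspose_apply,
    star_star, star_star, Sum.elim_comp_inl, Sum.elim_comp_inr]

variable {K L : ℕ}

/-- The operators `u 0, u 1, …`, each followed by setting a flag qubit if the state is not good. -/
noncomputable def seqOp (good : (ρ → Bool) → Bool) (u : ℕ → (Fin K → Bool) → QOp ρ) :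
    ℕ → QOp (ρ ⊕ (Fin K ⊕ Fin L))
  | 0 => 1
  | i + 1 =>
    (if h : i < L then cOp (fun s => !good (s ∘ Sum.inl)) (Sum.inr (Sum.inr ⟨i, h⟩)) pauliX else 1) *
      (ctrlLift (fun b => u i (b ∘ Sum.inl)) * seqOp good u i)

/-- The operators `u 0, u 1, …`, each followed by the projection onto the good states. -/
noncomputable def goodProd (good : (ρ → Bool) → Bool) (u : ℕ → (Fin K → Bool) → QOp ρ)
    (b : Fin K → Bool) : ℕ → QOp ρ
  | 0 => 1
  | i + 1 => diagonal (fun s => if good s then 1 else 0) * (u i b * goodProd good u b i)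

/-- Each flag is touched only by its own step, so clear flags at the end mean that the state was
good after every step. The first claim, that the flags of future steps are still clear, is what
makes the induction for the second work. -/
lemma seqOp_apply (good : (ρ → Bool) → Bool) (u : ℕ → (Fin K → Bool) → QOp ρ) {i : ℕ} (hi : i ≤ L)
    (s s0 : ρ → Bool) (b b0 : Fin K → Bool) :
    (∀ f : Fin L → Bool, (∃ j : Fin L, i ≤ j ∧ f j = true) → seqOp good u i
      (Sum.elim s (Sum.elim b f)) (Sum.elim s0 (Sum.elim b0 fun _ => false)) = 0) ∧
    seqOp (L := L) good u i (Sum.elim s (Sum.elim b fun _ => false))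
      (Sum.elim s0 (Sum.elim b0 fun _ => false)) =
        if b = b0 then goodProd good u b0 i s s0 else 0 := by
  induction i generalizing s b with
  | zero =>
    constructor
    · rintro f ⟨j, -, hj⟩
      rw [seqOp, one_apply, if_neg]
      intro h
      have := congrFun h (Sum.inr (Sum.inr j))
      simp [hj] at this
    · rw [seqOp, goodProd, one_apply, one_apply]
      have : (Sum.elim s (Sum.elim b fun _ : Fin L => false) =
          Sum.elim s0 (Sum.elim b0 fun _ => false)) ↔ b = b0 ∧ s = s0 := by
        constructor
        · intro h
          exact ⟨funext fun k => congrFun h (Sum.inr (Sum.inl k)),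
            funext fun k => congrFun h (Sum.inl k)⟩
        · rintro ⟨rfl, rfl⟩; rfl
      simp only [this, ite_and]
  | succ i ih =>
    have hiL : i < L := hi
    have hind : IndepOf (Sum.inr (Sum.inr ⟨i, hiL⟩) : ρ ⊕ (Fin K ⊕ Fin L))
        (fun s : ρ ⊕ (Fin K ⊕ Fin L) → Bool => !good (s ∘ Sum.inl)) := by
      intro x c
      simp only
      congr 2
    have hupd : ∀ (f : Fin L → Bool) (c : Bool), Function.update (Sum.elim s (Sum.elim b f))
        (Sum.inr (Sum.inr ⟨i, hiL⟩)) c = Sum.elim s (Sum.elim b (Function.update f ⟨i, hiL⟩ c)) := by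
      intro f c
      rw [Sum.update_elim_inr, Sum.update_elim_inr]
    simp only [seqOp, dif_pos hiL, flip_mul_apply hind, Sum.elim_comp_inl, hupd]
    constructor
    · rintro f ⟨j, hj, hfj⟩
      have hne : j ≠ ⟨i, hiL⟩ := by
        rintro rfl
        simp at hj
      split_ifs
      · rw [ctrlLift_mul_apply]
        refine Finset.sum_eq_zero fun a _ => ?_
        rw [(ih hiL.le a b).1 _ ⟨j, by omega, by rw [Function.update_of_ne hne, hfj]⟩, mul_zero]
      · rw [ctrlLift_mul_apply]
        refine Finset.sum_eq_zero fun a _ => ?_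
        rw [(ih hiL.le a b).1 _ ⟨j, by omega, hfj⟩, mul_zero]
    · rw [goodProd, diagonal_mul]
      by_cases hg : good s
      · simp only [hg, Bool.not_true, Bool.false_eq_true, if_false, if_true, one_mul]
        rw [ctrlLift_mul_apply]
        simp_rw [fun a => (ih hiL.le a b).2, Sum.elim_comp_inl]
        by_cases hb : b = b0
        · subst hb
          simp [Matrix.mul_apply]
        · simp [hb]
      · simp only [hg, Bool.not_false, if_true, Bool.false_eq_true, if_false, zero_mul, ite_self]
        rw [ctrlLift_mul_apply]
        refine Finset.sum_eq_zero fun a _ => ?_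
        -- In a bad state, a clear flag after the flip was set before it, which the first claim
        -- excludes.
        rw [(ih hiL.le a b).1 _ ⟨⟨i, hiL⟩, le_rfl, by simp⟩, mul_zero]

/-- The entries of `A` in the states `g`. -/
def blk {γ : Type} (g : γ → ρ → Bool) (A : QOp ρ) : Matrix γ γ ℂ := A.submatrix g g

variable {γ : Type} [Fintype γ] [DecidableEq γ]

/-- The product of the blocks of `u 0, u 1, …`. -/
noncomputable def blkProd (g : γ → ρ → Bool) (u : ℕ → (Fin K → Bool) → QOp ρ) (b : Fin K → Bool) :
    ℕ → Matrix γ γ ℂ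
  | 0 => 1
  | i + 1 => blk g (u i b) * blkProd g u b i

lemma goodProd_eq_zero {good : (ρ → Bool) → Bool} {g : γ → ρ → Bool}
    (hgood : ∀ s, good s = true ↔ ∃ a, g a = s) (u : ℕ → (Fin K → Bool) → QOp ρ)
    (b : Fin K → Bool) (i : ℕ) {s : ρ → Bool} (hs : good s = false) (a : γ) :
    goodProd good u b i s (g a) = 0 := by
  cases i with
  | zero =>
    rw [goodProd, one_apply, if_neg]
    rintro rfl
    rw [(hgood _).2 ⟨a, rfl⟩] at hs
    simp at hs
  | succ i => rw [goodProd, diagonal_mul, hs]; simp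

/-- States outside the range of `g` have been projected away, so the sums over intermediate states
reduce to sums over `γ`. -/
lemma blk_goodProd {good : (ρ → Bool) → Bool} {g : γ → ρ → Bool} (hg : Function.Injective g)
    (hgood : ∀ s, good s = true ↔ ∃ a, g a = s) (u : ℕ → (Fin K → Bool) → QOp ρ)
    (b : Fin K → Bool) (i : ℕ) : blk g (goodProd good u b i) = blkProd g u b i := by
  induction i with
  | zero =>
    ext a a'
    simp [blk, goodProd, blkProd, one_apply, hg.eq_iff]
  | succ i ih =>
    ext a a'
    rw [blkProd, ← ih, blk, submatrix_apply, goodProd, diagonal_mul, (hgood _).2 ⟨a, rfl⟩,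
      if_pos rfl, one_mul, Matrix.mul_apply, Matrix.mul_apply]
    simp only [blk, submatrix_apply]
    rw [← Finset.sum_image (s := Finset.univ) (g := g)
      (f := fun s => u i b (g a) s * goodProd good u b i s (g a')) (fun x _ y _ h => hg h)]
    refine (Finset.sum_subset (Finset.subset_univ _) fun s _ hs => ?_).symm
    rw [goodProd_eq_zero hgood, mul_zero]
    rw [Bool.eq_false_iff]
    intro h
    obtain ⟨c, rfl⟩ := (hgood s).1 h
    exact hs (Finset.mem_image_of_mem _ (Finset.mem_univ _))

lemma seqOp_apply_of_good {good : (ρ → Bool) → Bool} {g : γ → ρ → Bool} (hg : Function.Injective g)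
    (hgood : ∀ s, good s = true ↔ ∃ a, g a = s) (u : ℕ → (Fin K → Bool) → QOp ρ) (a a0 : γ)
    (b b0 : Fin K → Bool) :
    seqOp (L := L) good u L (Sum.elim (g a) (Sum.elim b fun _ => false))
      (Sum.elim (g a0) (Sum.elim b0 fun _ => false)) =
        if b = b0 then blkProd g u b0 L a a0 else 0 := by
  rw [(seqOp_apply good u le_rfl _ _ _ _).2, ← blk_goodProd hg hgood]
  rfl

end Flags

/-! ### Good states, and preparation of the clock. -/

section Good

variable {P : Params}

open Reg Form

lemma goodForm_eval (hN : 0 < P.N) (s : Reg P → Bool) :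
    (goodForm P).eval s = true ↔ ∃ g, gst g = s := by
  have hN1 : P.N - 1 < 2 ^ indexQubits P.N := index_lt (N := P.N) ⟨P.N - 1, by omega⟩
  have h1 : bv (fun i => (const (natBits (indexQubits P.N) (P.N - 1) i) : Form (Reg P)).eval s) =
      P.N - 1 := by
    simp_rw [const_eval]
    rw [bv_natBits, Nat.mod_eq_of_lt hN1]
  simp only [goodForm, eval, lt_eval, h1, Bool.and_eq_true, Bool.not_eq_true', decide_eq_false_iff_not,
    not_lt, allZero_eval]
  constructor
  · rintro ⟨h2, h3⟩
    refine ⟨(⟨bv fun i => s (.x i), by omega⟩, fun i => s (.m i)), ?_⟩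
    have h4 : ∀ k ∈ cleanList P, gst (⟨bv fun i => s (.x i), by omega⟩, fun i => s (.m i)) k = s k := by
      intro k hk
      rw [h3 k hk]
      simp only [cleanList, List.mem_append, List.mem_map, List.mem_cons, List.not_mem_nil,
        or_false] at hk
      rcases hk with ((((⟨i, -, rfl⟩ | ⟨i, -, rfl⟩) | ⟨i, -, rfl⟩) | ⟨i, -, rfl⟩) | ⟨i, -, rfl⟩) | hk
      on_goal 6 => rcases hk with rfl | rfl | rfl | rfl | rfl | rfl
      all_goals rfl
    ext k
    cases k with
    | x i => exact congrFun (natBits_bv fun i => s (.x i)) i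
    | m i => rfl
    | _ => exact h4 _ (by simp [cleanList])
  · rintro ⟨⟨x, m⟩, rfl⟩
    constructor
    · have : bv (natBits (indexQubits P.N) x) = x := by
        rw [bv_natBits, Nat.mod_eq_of_lt (index_lt x)]
      change bv (natBits (indexQubits P.N) x) ≤ _
      omega
    · intro k hk
      simp only [cleanList, List.mem_append, List.mem_map, List.mem_cons, List.not_mem_nil,
        or_false] at hk
      rcases hk with ((((⟨i, -, rfl⟩ | ⟨i, -, rfl⟩) | ⟨i, -, rfl⟩) | ⟨i, -, rfl⟩) | ⟨i, -, rfl⟩) | hk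
      on_goal 6 => rcases hk with rfl | rfl | rfl | rfl | rfl | rfl
      all_goals rfl

/-- The qubits of the low-order bits of the time index. -/
def embMlow : Fin P.n ↪ Reg P :=
  ⟨fun i => m (i.castAdd P.p), fun _ _ h => by simpa using h⟩

@[simp] lemma embMlow_apply (i : Fin P.n) : (embMlow i : Reg P) = m (i.castAdd P.p) := rfl

variable (P) in
/-- Flip those high-order bits of the time index in the list that are set in `l`. -/
noncomputable def setTop (l : ℕ) : List (Fin P.p) → QOp (Reg P)
  | [] => 1
  | i :: L => cOp (fun _ => l.testBit i) (m (i.natAdd P.n)) pauliX * setTop l L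

variable (P) in
/-- Preparation of the uniform superposition of the times in segment `l`. -/
noncomputable def opClock (l : ℕ) : QOp (Reg P) :=
  place embMlow (hadAll _) * setTop P l (List.finRange _)

/-- The state with index `x`, segment `l` and time `a` within the segment. -/
def tst (l : ℕ) (x : Fin P.N) (a : Fin P.n → Bool) : Fin P.N × (Fin (P.n + P.p) → Bool) :=
  (x, Fin.append a (natBits P.p l))

lemma setTop_mulVec (l : ℕ) (x : Fin P.N) (a : Fin P.n → Bool) (L : List (Fin P.p))
    (hL : L.Nodup) : setTop P l L *ᵥ ket (gst (x, Fin.append a fun _ => false)) =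
      ket (gst (x, Fin.append a fun i => decide (i ∈ L) && l.testBit i)) := by
  induction L with
  | nil => simp [setTop]
  | cons i L ih =>
    have hi : i ∉ L := (List.nodup_cons.1 hL).1
    rw [setTop, ← mulVec_mulVec, ih (List.nodup_cons.1 hL).2, flip_mulVec_ket]
    congr 1
    have h0 : gst (x, Fin.append a fun i => decide (i ∈ L) && l.testBit i) (m (i.natAdd P.n)) =
        false := by
      simp [gst, rst, hi]
    rw [h0]
    ext k
    cases k with
    | m j =>
      refine Fin.addCases (fun j => ?_) (fun j => ?_) j
      · have : (Fin.castAdd P.p j) ≠ Fin.natAdd P.n i := by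
          intro h
          have := congrArg Fin.val h
          simp at this
          omega
        split_ifs <;> simp [gst, rst, this]
      · by_cases hj : j = i
        · subst hj
          by_cases ht : l.testBit j <;> simp [gst, rst, ht, hi]
        · by_cases ht : l.testBit i <;> simp [gst, rst, ht, hj]
    | _ => split_ifs <;> simp [gst, rst]

lemma opClock_mulVec (l : ℕ) (x : Fin P.N) :
    opClock P l *ᵥ ket (gst (x, fun _ => false)) =
      ∑ a, ((√2 : ℝ) : ℂ)⁻¹ ^ P.n • ket (gst (tst l x a)) := by
  have h0 : (fun _ => false : Fin (P.n + P.p) → Bool) =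
      Fin.append (fun _ => false) fun _ => false := by
    ext j
    refine Fin.addCases (fun j => ?_) (fun j => ?_) j <;> simp
  have h1 : (fun i : Fin P.p => decide (i ∈ List.finRange P.p) && l.testBit i) = natBits P.p l := by
    ext i; simp [natBits]
  rw [opClock, ← mulVec_mulVec, h0, setTop_mulVec l x _ _ (List.nodup_finRange _), h1,
    place_mulVec_ket]
  have h2 : (gst (x, Fin.append (fun _ => false) (natBits P.p l)) : Reg P → Bool) ∘ embMlow =
      fun _ => false := by
    ext i
    simp [gst, rst]
  rw [h2]
  refine Finset.sum_congr rfl fun a _ => ?_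
  rw [hadAll_zero, Fintype.card_fin]
  congr 2
  ext k
  cases k with
  | m j =>
    refine Fin.addCases (fun j => ?_) (fun j => ?_) j
    · rw [← embMlow_apply, embMlow.injective.extend_apply]
      simp [gst, rst, tst]
    · rw [Function.extend_apply' _ _ _ (by
        rintro ⟨i, hi⟩
        simp only [embMlow_apply, m.injEq] at hi
        have := congrArg Fin.val hi
        simp at this
        omega)]
      simp [gst, rst, tst]
  | _ => rw [Function.extend_apply' _ _ _ (by rintro ⟨i, hi⟩; simp at hi)]; rfl

end Good

/-! ### Preparation of the unary control register. -/

section Chain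

variable {ρ : Type} [Fintype ρ] [DecidableEq ρ] {K L : ℕ}

/-- The control state in which the first `k` qubits are set. -/
def un (K k : ℕ) : Fin K → Bool := fun i => decide ((i : ℕ) < k)

/-- The condition for the Hadamard gate on control qubit `j`. -/
def chainForm (ρ : Type) (L : ℕ) {j : ℕ} (h : j < K) : Form (ρ ⊕ (Fin K ⊕ Fin L)) :=
  if j = 0 then .tru else .var (.inr (.inl ⟨j - 1, by omega⟩))

variable (ρ L) in
/-- Preparation of the control qubits `0, …, j - 1`. -/
noncomputable def chain : ℕ → QOp (ρ ⊕ (Fin K ⊕ Fin L))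
  | 0 => 1
  | j + 1 => (if h : j < K then cOp (fun s => (chainForm ρ L h).eval s) (.inr (.inl ⟨j, h⟩)) hadamard
      else 1) * chain j

/-- The amplitudes that `chain` produces. -/
noncomputable def chainCoef (j k : ℕ) : ℂ :=
  if k < j then ((√2 : ℝ) : ℂ)⁻¹ ^ (k + 1) else ((√2 : ℝ) : ℂ)⁻¹ ^ j

/-- The Hadamard gate on qubit `j` acts only if qubit `j - 1` is set, so it splits only the longest
unary state and leaves the shorter ones alone. The squared amplitudes are therefore geometric, which
later cancels the powers of two in the scale of the Hamiltonian block. -/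
lemma chain_mulVec (s : ρ → Bool) {j : ℕ} (hj : j ≤ K) :
    chain ρ L j *ᵥ ket (Sum.elim s (Sum.elim (un K 0) fun _ => false)) =
      ∑ k ∈ Finset.range (j + 1), chainCoef j k •
        ket (Sum.elim s (Sum.elim (un K k) fun _ => false)) := by
  induction j with
  | zero => simp [chain, chainCoef]
  | succ j ih =>
    have hjK : j < K := hj
    rw [chain, dif_pos hjK, ← mulVec_mulVec, ih hjK.le, mulVec_sum, Finset.sum_range_succ,
      Finset.sum_range_succ _ (j + 1), Finset.sum_range_succ _ j, add_assoc]
    congr 1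
    · refine Finset.sum_congr rfl fun k hk => ?_
      have hk' : k < j := Finset.mem_range.1 hk
      have he : (chainForm ρ L hjK).eval (Sum.elim s (Sum.elim (un K k) fun _ => false)) = false := by
        rw [chainForm, if_neg (by omega)]
        simp only [Form.eval, un, Sum.elim_inr, Sum.elim_inl]
        simp only [decide_eq_false_iff_not]
        omega
      have hc : chainCoef j k = chainCoef (j + 1) k := by
        simp only [chainCoef, hk', hk'.trans j.lt_succ_self, if_true]
      rw [mulVec_smul, cOp_mulVec_ket, he, hc, if_neg Bool.false_ne_true]
    · have he : (chainForm ρ L hjK).eval (Sum.elim s (Sum.elim (un K j) fun _ => false)) = true := by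
        rw [chainForm]
        split_ifs with h
        · rfl
        · simp only [Form.eval, un, Sum.elim_inr, Sum.elim_inl]
          simp only [decide_eq_true_eq]
          omega
      have hu : ∀ c, Function.update (Sum.elim s (Sum.elim (un K j) fun _ : Fin L => false))
          (.inr (.inl ⟨j, hjK⟩)) c =
          Sum.elim s (Sum.elim (un K (if c then j + 1 else j)) fun _ => false) := by
        intro c
        rw [Sum.update_elim_inr, Sum.update_elim_inl]
        congr 2
        ext i
        rw [Function.update_apply]
        have : i = ⟨j, hjK⟩ ↔ (i : ℕ) = j := Fin.ext_iff
        cases c <;> by_cases hij : (i : ℕ) = j <;> simp [this, hij, un] <;> omega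
      have hz : Sum.elim s (Sum.elim (un K j) fun _ : Fin L => false) (.inr (.inl ⟨j, hjK⟩)) = false := by
        simp [un]
      rw [mulVec_smul, cOp_mulVec_ket, he, if_pos rfl, hz, Fintype.sum_bool, hu, hu, if_pos rfl,
        if_neg (by simp)]
      simp only [hadamard, Bool.and_false, Bool.false_eq_true, if_false, chainCoef, lt_irrefl,
        Nat.lt_succ_self, if_true, smul_add, smul_smul, one_div, pow_succ]
      rw [add_comm]

lemma chainCoef_conj (k j : ℕ) :
    star (chainCoef j k) * chainCoef j k = if k < j then (2 ^ (k + 1))⁻¹ else (2 ^ j)⁻¹ := by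
  rw [chainCoef]
  split_ifs <;> rw [inv_sqrt_two_pow]

lemma ctrlLift_mulVec_elim {β ι : Type} [Fintype β] [DecidableEq β] [Fintype ι] {A : QOp ρ}
    {s : ρ → Bool} {z : ι → ℂ} {f : ι → ρ → Bool} (h : A *ᵥ ket s = ∑ i, z i • ket (f i))
    (b : β → Bool) : ctrlLift (fun _ => A) *ᵥ ket (Sum.elim s b) =
      ∑ i, z i • ket (Sum.elim (f i) b) := by
  rw [ctrlLift_mulVec_ket]
  simp only [Sum.elim_comp_inl, Sum.elim_comp_inr]
  have h' : ∀ a, A a s = ∑ i, z i * if a = f i then 1 else 0 := by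
    intro a
    rw [← mulVec_ket A, h, Finset.sum_apply]
    simp [ket_apply]
  simp_rw [h', Finset.sum_smul]
  rw [Finset.sum_comm]
  simp

end Chain

/-! ### The operator of a segment and its action on clock states. -/

/-- The sum of the products `A m_k ⋯ A m_1` over all `m_1 < ⋯ < m_k < m`. -/
def orderedSum {R : Type*} [Semiring R] (A : ℕ → R) : ℕ → ℕ → R
  | 0, _ => 1
  | k + 1, m => ∑ i ∈ Finset.range m, A i * orderedSum A k i

section Segment

variable {P : Params} {K : ℕ}

open Reg Form

/-- The qubits of a segment: the registers, the control qubits and the flags. -/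
abbrev Wires (P : Params) (K : ℕ) : Type := Reg P ⊕ (Fin K ⊕ Fin (2 * K))

/-- The value of control qubit `j`, if there is one. -/
def ctlBit (b : Fin K → Bool) (j : ℕ) : Bool := if h : j < K then b ⟨j, h⟩ else false

variable (P K) in
/-- The formula for `ctlBit`. -/
def ctlForm (j : ℕ) : Form (Wires P K) := if h : j < K then var (.inr (.inl ⟨j, h⟩)) else not tru

lemma isBit_ctlForm (j : ℕ) : IsBit (ctlForm P K j) fun b => ctlBit (b ∘ Sum.inl) j := by
  constructor <;> intros <;> simp only [ctlForm, ctlBit] <;> split_ifs <;>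
    simp [eval, Avoids, Form.size]

lemma ctlBit_un {j k : ℕ} (hk : k ≤ K) : ctlBit (un K k) j = decide (j < k) := by
  rw [ctlBit]
  split_ifs with h
  · rfl
  · exact (decide_eq_false (by omega)).symm

lemma un_injOn {k k' : ℕ} (hk : k ≤ K) (hk' : k' ≤ K) (h : un K k = un K k') : k = k' := by
  by_contra hne
  rcases lt_or_gt_of_ne hne with h1 | h1
  · have := congrFun h ⟨k, by omega⟩
    simp [un] at this
    omega
  · have := congrFun h ⟨k', by omega⟩
    simp [un] at this
    omega

variable (hkd : P.kd ≤ indexQubits P.N) (hk : P.k ≤ P.np) (Ra : Matrix Bool Bool ℂ)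
  (OH : QOp (HWire (P.n + P.p) P.N P.np)) (Of : QOp (FWire (P.n + P.p) P.N))

/-- Alternately, the block encodings of the Hamiltonian and of the advancement of the clock. -/
noncomputable def stepOp (i : ℕ) (b : Fin K → Bool) : QOp (Reg P) :=
  if i % 2 = 0 then opB P hkd hk Ra OH Of (ctlBit b (i / 2)) else opL P (ctlBit b (i / 2 + 1))

variable (P K) in
/-- Preparation of the control qubits and the clock. -/
noncomputable def opPrep (l : ℕ) : QOp (Wires P K) :=
  ctrlLift (fun _ => opClock P l) * chain (Reg P) (2 * K) K

/-- The block encoding of a truncated Dyson series for segment `l`. -/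
noncomputable def opW (l : ℕ) : QOp (Wires P K) :=
  (opPrep P K l)ᴴ *
    (seqOp (fun s => (goodForm P).eval s) (stepOp hkd hk Ra OH Of) (2 * K) * opPrep P K l)

/-- The state with index `x` in which all other qubits are clean. -/
def sst (K : ℕ) (x : Fin P.N) : Wires P K → Bool :=
  Sum.elim (gst (x, fun _ => false)) (Sum.elim (fun _ => false) fun _ => false)

lemma opPrep_mulVec (l : ℕ) (x : Fin P.N) : opPrep P K l *ᵥ ket (sst K x) =
    ∑ i : Fin (K + 1) × (Fin P.n → Bool), (chainCoef K i.1 * ((√2 : ℝ) : ℂ)⁻¹ ^ P.n) •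
      ket (Sum.elim (gst (tst l x i.2)) (Sum.elim (un K i.1) fun _ => false)) := by
  have h0 : sst K x = Sum.elim (gst (x, fun _ => false))
      (Sum.elim (un K 0) fun _ => false) := by
    rw [sst]; congr 2
  rw [opPrep, ← mulVec_mulVec, h0, chain_mulVec _ le_rfl, mulVec_sum, Fintype.sum_prod_type,
    ← Fin.sum_univ_eq_sum_range (fun k => _ *ᵥ (chainCoef K k • _)) (K + 1)]
  refine Finset.sum_congr rfl fun k _ => ?_
  rw [mulVec_smul, ctrlLift_mulVec_elim (opClock_mulVec l x), Finset.smul_sum]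
  simp_rw [smul_smul]

lemma sum_append {α : Type*} [AddCommMonoid α] {n p : ℕ} (F : (Fin (n + p) → Bool) → α) :
    ∑ m, F m = ∑ a : Fin n → Bool, ∑ t : Fin p → Bool, F (Fin.append a t) := by
  rw [← (Fin.appendEquiv n p).sum_comp, Fintype.sum_prod_type]
  rfl

/-- A vector supported on the times of segment `l`. -/
noncomputable def segVec (l : ℕ) (Y : ℕ → Fin P.N → ℂ) (g : Fin P.N × (Fin (P.n + P.p) → Bool)) : ℂ :=
  if topBits g.2 = natBits P.p l then Y (bv (lowBits g.2)) g.1 else 0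

@[simp] lemma topBits_append (a : Fin P.n → Bool) (t : Fin P.p → Bool) :
    topBits (Fin.append a t) = t := by ext i; simp [topBits]

@[simp] lemma lowBits_append (a : Fin P.n → Bool) (t : Fin P.p → Bool) :
    lowBits (Fin.append a t) = a := by ext i; simp [lowBits]

lemma append_lowBits_topBits (m : Fin (P.n + P.p) → Bool) :
    Fin.append (lowBits m) (topBits m) = m := by
  ext j
  refine Fin.addCases (fun i => ?_) (fun i => ?_) j <;> simp [lowBits, topBits]

variable {OH Of} {vre vim : (Fin (P.n + P.p) → Bool) → Fin P.N → Fin P.N → Fin P.np → Bool}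
  {f : (Fin (P.n + P.p) → Bool) → Fin P.N → Fin P.d → Fin P.N}

/-- The oracle matrix for time `m` in segment `l`. -/
noncomputable def segMatrix
    (vre vim : (Fin (P.n + P.p) → Bool) → Fin P.N → Fin P.N → Fin P.np → Bool)
    (f : (Fin (P.n + P.p) → Bool) → Fin P.N → Fin P.d → Fin P.N) (l m : ℕ) :
    Matrix (Fin P.N) (Fin P.N) ℂ :=
  oracleMatrix hk vre vim f (Fin.append (natBits P.n m) (natBits P.p l))

lemma blk_opB_mulVec (hd : 0 < P.d) (hdN : P.d ≤ P.N) (hdk : P.d ≤ 2 ^ P.kd) (hk0 : 0 < P.k)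
    (hV : ValData OH vre vim) (hF : PosData Of f) (l : ℕ) (Y : ℕ → Fin P.N → ℂ) :
    blk gst (opB P hkd hk Ra OH Of true) *ᵥ segVec l Y =
      segVec l fun m => (Ra false false * (2 ^ (P.kd + P.k))⁻¹) •
        (segMatrix hk vre vim f l m *ᵥ Y m) := by
  ext ⟨x, m⟩
  simp only [mulVec, dotProduct, blk, submatrix_apply,
    opB_true_apply hd hdN hdk hkd hk hk0 Ra hV hF, Fintype.sum_prod_type, ite_mul, zero_mul,
    Finset.sum_ite_eq, Finset.mem_univ, if_true]
  simp only [segVec]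
  split_ifs with h
  · have : Fin.append (natBits P.n (bv (lowBits m))) (natBits P.p l) = m := by
      rw [natBits_bv, ← h, append_lowBits_topBits]
    simp only [Pi.smul_apply, smul_eq_mul, mulVec, dotProduct, Finset.mul_sum, segMatrix, this,
      mul_assoc]
  · simp only [mul_zero, Finset.sum_const_zero]

/-- In terms of the time register, `opB` multiplies by the matrix of the current time and `opL` sums
over all earlier times; alternating them builds the nested sums of `orderedSum`. -/
lemma blk_opL_mulVec (l : ℕ) (Y : ℕ → Fin P.N → ℂ) :
    blk gst (opL P true) *ᵥ segVec l Y =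
      segVec l fun m => ((2 : ℂ) ^ P.n)⁻¹ • ∑ i ∈ Finset.range m, Y i := by
  ext ⟨x, m⟩
  simp only [mulVec, dotProduct, blk, submatrix_apply, opL_true_apply, Fintype.sum_prod_type,
    segVec, ite_and]
  rw [Finset.sum_eq_single x (by
    intro y _ hy
    refine Finset.sum_eq_zero fun m' _ => ?_
    rw [if_neg (Ne.symm hy), zero_mul]) (by simp), sum_append]
  simp only [topBits_append, lowBits_append, if_true]
  have h1 : ∀ a : Fin P.n → Bool, ∑ t : Fin P.p → Bool,
      (if topBits m = t then (if bv a < bv (lowBits m) then ((2 : ℂ) ^ P.n)⁻¹ else 0) else 0) *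
        (if t = natBits P.p l then Y (bv a) x else 0) =
      if topBits m = natBits P.p l then (if bv a < bv (lowBits m) then
        ((2 : ℂ) ^ P.n)⁻¹ * Y (bv a) x else 0) else 0 := by
    intro a
    simp only [ite_mul, zero_mul, Finset.sum_ite_eq, Finset.mem_univ, if_true]
    split_ifs <;> simp
  simp_rw [h1]
  split_ifs with h
  · rw [sum_bv (fun j => if j < bv (lowBits m) then ((2 : ℂ) ^ P.n)⁻¹ * Y j x else 0),
      ← Finset.sum_filter]
    have : Finset.filter (fun j => j < bv (lowBits m)) (Finset.range (2 ^ P.n)) =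
        Finset.range (bv (lowBits m)) := by
      have := bv_lt (lowBits m)
      ext j
      simp only [Finset.mem_filter, Finset.mem_range]
      omega
    rw [this, Pi.smul_apply, Finset.sum_apply, smul_eq_mul, Finset.mul_sum]
  · simp

end Segment

/-! ### The truncated Dyson series as a block of `opW`. -/

section Segment

variable {P : Params} {K : ℕ}

open Reg Form

variable {hkd : P.kd ≤ indexQubits P.N} {hk : P.k ≤ P.np} {Ra : Matrix Bool Bool ℂ}
  {OH : QOp (HWire (P.n + P.p) P.N P.np)} {Of : QOp (FWire (P.n + P.p) P.N)}
  {vre vim : (Fin (P.n + P.p) → Bool) → Fin P.N → Fin P.N → Fin P.np → Bool}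
  {f : (Fin (P.n + P.p) → Bool) → Fin P.N → Fin P.d → Fin P.N}

lemma blk_one {γ ρ : Type} [Fintype ρ] [DecidableEq ρ] [DecidableEq γ] {g : γ → ρ → Bool}
    (hg : Function.Injective g) : blk g (1 : QOp ρ) = 1 := by
  ext a b
  simp [blk, one_apply, hg.eq_iff]

/-- The result of the first `i` steps with `k` active terms in segment `l`. -/
noncomputable def stepVec (Ht : ℕ → Matrix (Fin P.N) (Fin P.N) ℂ) (z : ℂ) (k : ℕ)
    (x : Fin P.N) (i m : ℕ) : Fin P.N → ℂ :=
  if i < 2 * k then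
    if i % 2 = 0 then (z / 2 ^ P.n) ^ (i / 2) • (orderedSum Ht (i / 2) m *ᵥ Pi.single x 1)
    else z • (Ht m *ᵥ ((z / 2 ^ P.n) ^ (i / 2) • (orderedSum Ht (i / 2) m *ᵥ Pi.single x 1)))
  else if k = 0 then Pi.single x 1
  else z • (Ht m *ᵥ ((z / 2 ^ P.n) ^ (k - 1) • (orderedSum Ht (k - 1) m *ᵥ Pi.single x 1)))

lemma stepVec_even (Ht : ℕ → Matrix (Fin P.N) (Fin P.N) ℂ) (z : ℂ) {k j : ℕ} (h : j < k)
    (x : Fin P.N) (m : ℕ) : stepVec Ht z k x (2 * j) m =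
      (z / 2 ^ P.n) ^ j • (orderedSum Ht j m *ᵥ Pi.single x 1) := by
  rw [stepVec, if_pos (by omega), if_pos (by omega), show 2 * j / 2 = j by omega]

lemma stepVec_odd (Ht : ℕ → Matrix (Fin P.N) (Fin P.N) ℂ) (z : ℂ) {k j : ℕ} (h : j < k)
    (x : Fin P.N) (m : ℕ) : stepVec Ht z k x (2 * j + 1) m =
      z • (Ht m *ᵥ ((z / 2 ^ P.n) ^ j • (orderedSum Ht j m *ᵥ Pi.single x 1))) := by
  rw [stepVec, if_pos (by omega), if_neg (by omega), show (2 * j + 1) / 2 = j by omega]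

lemma stepVec_last (Ht : ℕ → Matrix (Fin P.N) (Fin P.N) ℂ) (z : ℂ) {k i : ℕ} (h : 2 * k + 1 ≤ i)
    (x : Fin P.N) (m : ℕ) : stepVec Ht z (k + 1) x i m =
      z • (Ht m *ᵥ ((z / 2 ^ P.n) ^ k • (orderedSum Ht k m *ᵥ Pi.single x 1))) := by
  rcases h.eq_or_lt with rfl | h
  · exact stepVec_odd Ht z k.lt_succ_self x m
  · rw [stepVec, if_neg (by omega), if_neg (by omega), Nat.add_sub_cancel]

lemma stepVec_zero (Ht : ℕ → Matrix (Fin P.N) (Fin P.N) ℂ) (z : ℂ) (i : ℕ) (x : Fin P.N) (m : ℕ) :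
    stepVec Ht z 0 x i m = Pi.single x 1 := by
  rw [stepVec, if_neg (by omega), if_pos rfl]

/-- With `k` control qubits set, `k` Hamiltonian blocks act and only the `k - 1` clock steps between
them, so nothing changes from step `2 * k - 1` on. -/
lemma stepVec_succ (Ht : ℕ → Matrix (Fin P.N) (Fin P.N) ℂ) (z : ℂ) {k i : ℕ} (h : 2 * k ≤ i + 1)
    (x : Fin P.N) : stepVec Ht z k x (i + 1) = stepVec Ht z k x i := by
  ext m : 1
  rcases k with _ | k
  · rw [stepVec_zero, stepVec_zero]
  · rw [stepVec_last _ _ (by omega), stepVec_last _ _ (by omega)]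

lemma blkProd_mulVec (hd : 0 < P.d) (hdN : P.d ≤ P.N) (hdk : P.d ≤ 2 ^ P.kd) (hk0 : 0 < P.k)
    (hV : ValData OH vre vim) (hF : PosData Of f) {z : ℂ}
    (hz : Ra false false * (2 ^ (P.kd + P.k))⁻¹ = z) (l : ℕ) (x : Fin P.N) {k : ℕ} (hkK : k ≤ K)
    (i : ℕ) :
    blkProd gst (stepOp hkd hk Ra OH Of) (un K k) i *ᵥ segVec l (fun _ => Pi.single x 1) =
      segVec l (stepVec (segMatrix hk vre vim f l) z k x i) := by
  induction i with
  | zero =>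
    rw [blkProd, one_mulVec]
    congr 1
    ext m : 1
    rcases k.eq_zero_or_pos with rfl | h
    · rw [stepVec_zero]
    · rw [← Nat.mul_zero 2, stepVec_even _ _ h]
      simp only [pow_zero, one_smul, orderedSum, one_mulVec]
  | succ i ih =>
    rw [blkProd, ← mulVec_mulVec, ih, stepOp, ctlBit_un hkK, ctlBit_un hkK]
    rcases Nat.even_or_odd' i with ⟨j, rfl | rfl⟩
    · rw [if_pos (by omega), show 2 * j / 2 = j by omega]
      by_cases hj : j < k
      · rw [decide_eq_true hj, blk_opB_mulVec hkd hk Ra hd hdN hdk hk0 hV hF, hz]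
        congr 1
        ext m : 1
        rw [stepVec_even _ _ hj, stepVec_odd _ _ hj]
      · rw [decide_eq_false hj, opB_false hkd hk Ra hV.unitary hF.unitary, blk_one gst_injective,
          one_mulVec, stepVec_succ (i := 2 * j) _ _ (by omega)]
    · rw [if_neg (by omega), show (2 * j + 1) / 2 = j by omega]
      by_cases hj : j + 1 < k
      · rw [decide_eq_true hj, blk_opL_mulVec]
        congr 1
        ext m : 1
        rw [show 2 * j + 1 + 1 = 2 * (j + 1) by ring, stepVec_even _ _ hj, orderedSum, sum_mulVec,
          Finset.smul_sum, Finset.smul_sum]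
        refine Finset.sum_congr rfl fun m' _ => ?_
        rw [stepVec_odd _ _ (by omega), mulVec_smul, smul_smul, smul_smul, mulVec_mulVec, pow_succ]
        congr 1
        ring
      · rw [decide_eq_false hj, opL_false, blk_one gst_injective, one_mulVec,
          stepVec_succ (i := 2 * j + 1) _ _ (by omega)]

/-- The clock steps supply only `k - 1` of the `k` sums; the outermost one is the sum over the final
time `a'`, that is, the projection of the clock onto the uniform superposition. It brings a factor
`2 ^ n` that cancels the normalization of the clock. -/
lemma sum_blkProd (hd : 0 < P.d) (hdN : P.d ≤ P.N) (hdk : P.d ≤ 2 ^ P.kd) (hk0 : 0 < P.k)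
    (hV : ValData OH vre vim) (hF : PosData Of f) {z : ℂ}
    (hz : Ra false false * (2 ^ (P.kd + P.k))⁻¹ = z) (l : ℕ) (x' x : Fin P.N) {k : ℕ}
    (hkK : k ≤ K) :
    ∑ a', ∑ a, blkProd gst (stepOp hkd hk Ra OH Of) (un K k) (2 * K) (tst l x' a') (tst l x a) =
      2 ^ P.n * ((z / 2 ^ P.n) ^ k * orderedSum (segMatrix hk vre vim f l) k (2 ^ P.n) x' x) := by
  have h1 : ∀ a', ∑ a, blkProd gst (stepOp hkd hk Ra OH Of) (un K k) (2 * K) (tst l x' a')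
      (tst l x a) = stepVec (segMatrix hk vre vim f l) z k x (2 * K) (bv a') x' := by
    intro a'
    have := congrFun (blkProd_mulVec (hkd := hkd) (hk := hk) hd hdN hdk hk0 hV hF hz l x hkK (2 * K)) (tst l x' a')
    rw [segVec, if_pos (by simp [tst])] at this
    simp only [tst, lowBits_append] at this
    rw [← this, mulVec, dotProduct, Fintype.sum_prod_type, Finset.sum_eq_single x, sum_append]
    · refine Finset.sum_congr rfl fun a _ => ?_
      rw [Finset.sum_eq_single (natBits P.p l)]
      · simp [segVec, tst]
      · intro t _ ht
        simp [segVec, ht]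
      · simp
    · intro y _ hy
      refine Finset.sum_eq_zero fun m _ => ?_
      simp [segVec, hy]
    · simp
  simp_rw [h1]
  rw [sum_bv fun m => stepVec (segMatrix hk vre vim f l) z k x (2 * K) m x']
  have hM : (2 : ℂ) ^ P.n ≠ 0 := pow_ne_zero _ two_ne_zero
  rcases k with _ | k
  · have e : ∀ m, orderedSum (segMatrix hk vre vim f l) 0 m = 1 := fun m => rfl
    simp only [stepVec_zero, pow_zero, e, one_apply, Finset.sum_const, Finset.card_range,
      Pi.single_apply, one_mul, nsmul_eq_mul]
    push_cast
    rfl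
  · have e : ∀ m, stepVec (segMatrix hk vre vim f l) z (k + 1) x (2 * K) m x' =
        2 ^ P.n * (z / 2 ^ P.n) ^ (k + 1) *
          (segMatrix hk vre vim f l m * orderedSum (segMatrix hk vre vim f l) k m) x' x := by
      intro m
      rw [stepVec_last _ _ (by omega), mulVec_smul, mulVec_mulVec, smul_smul, Pi.smul_apply,
        smul_eq_mul, mulVec_single_one, pow_succ]
      change _ * (segMatrix hk vre vim f l m * orderedSum (segMatrix hk vre vim f l) k m) x' x = _
      congr 1
      field_simp
    simp_rw [e]
    rw [← Finset.mul_sum, ← mul_assoc, orderedSum, Matrix.sum_apply]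

/-- The steps do not change the control register, so the same unary state occurs in both
preparations and its squared amplitude is the weight of the term of order `k`. -/
lemma opW_apply (hd : 0 < P.d) (hdN : P.d ≤ P.N) (hdk : P.d ≤ 2 ^ P.kd) (hk0 : 0 < P.k)
    (hV : ValData OH vre vim) (hF : PosData Of f) {z : ℂ}
    (hz : Ra false false * (2 ^ (P.kd + P.k))⁻¹ = z) (l : ℕ) (x' x : Fin P.N) :
    opW (K := K) hkd hk Ra OH Of l (sst K x') (sst K x) =
      ∑ k ∈ Finset.range (K + 1), (if k < K then ((2 : ℂ) ^ (k + 1))⁻¹ else (2 ^ K)⁻¹) *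
        ((z / 2 ^ P.n) ^ k * orderedSum (segMatrix hk vre vim f l) k (2 ^ P.n) x' x) := by
  set A := seqOp (L := 2 * K) (fun s => (goodForm P).eval s) (stepOp (K := K) hkd hk Ra OH Of) (2 * K) with hAdef
  have hA : ∀ (k' k : Fin (K + 1)) (a' a), A
      (Sum.elim (gst (tst l x' a')) (Sum.elim (un K k') fun _ => false))
      (Sum.elim (gst (tst l x a)) (Sum.elim (un K k) fun _ => false)) =
      if k = k' then blkProd gst (stepOp hkd hk Ra OH Of) (un K k) (2 * K) (tst l x' a') (tst l x a)
      else 0 := by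
    intro k' k a' a
    rw [hAdef, seqOp_apply_of_good gst_injective (goodForm_eval (by omega))]
    have : un K k' = un K k ↔ k = k' := by
      constructor
      · intro h
        exact Fin.ext (un_injOn (by omega) (by omega) h.symm)
      · rintro rfl; rfl
    simp only [this]
  rw [opW, ← hAdef, conjTranspose_mul_mul_apply, opPrep_mulVec, opPrep_mulVec, star_sum, mulVec_sum,
    sum_dotProduct]
  simp_rw [dotProduct_sum, mulVec_smul, star_smul, smul_dotProduct, dotProduct_smul, smul_eq_mul,
    star_ket_dotProduct]
  simp only [Fintype.sum_prod_type, mulVec_ket]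
  simp_rw [hA]
  rw [← Fin.sum_univ_eq_sum_range (fun k => (if k < K then ((2 : ℂ) ^ (k + 1))⁻¹ else (2 ^ K)⁻¹) *
        ((z / 2 ^ P.n) ^ k * orderedSum (segMatrix hk vre vim f l) k (2 ^ P.n) x' x)) (K + 1)]
  refine Finset.sum_congr rfl fun k' _ => ?_
  have h1 : ∀ a' : Fin P.n → Bool, ∑ k : Fin (K + 1), ∑ a : Fin P.n → Bool,
      star (chainCoef K k' * ((√2 : ℝ) : ℂ)⁻¹ ^ P.n) * (chainCoef K k * ((√2 : ℝ) : ℂ)⁻¹ ^ P.n *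
        if k = k' then blkProd gst (stepOp hkd hk Ra OH Of) (un K k) (2 * K) (tst l x' a')
          (tst l x a) else 0) =
      (star (chainCoef K k') * chainCoef K k' * (2 ^ P.n)⁻¹) * ∑ a : Fin P.n → Bool,
        blkProd gst (stepOp hkd hk Ra OH Of) (un K k') (2 * K) (tst l x' a') (tst l x a) := by
    intro a'
    rw [Finset.sum_eq_single k']
    · rw [Finset.mul_sum]
      refine Finset.sum_congr rfl fun a _ => ?_
      rw [if_pos rfl, star_mul', ← inv_sqrt_two_pow]
      ring
    · intro k _ hk
      simp [hk]
    · simp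
  simp_rw [h1]
  rw [← Finset.mul_sum, sum_blkProd hd hdN hdk hk0 hV hF hz l x' x (by omega), chainCoef_conj]
  field_simp

end Segment

/-! ### Costs of a segment and of the whole simulation. -/

section Costs

variable {P : Params} {K : ℕ}

open Reg Form

variable (hkd : P.kd ≤ indexQubits P.N) (hk : P.k ≤ P.np) {Ra : Matrix Bool Bool ℂ}
  {w : ℕ}

lemma CImpl.stepOp (hRa : Ra ∈ unitaryGroup Bool ℂ) (hw : 30 * P.size ≤ w) (i : ℕ) :
    CImpl w (fun OH Of (b : Fin K ⊕ Fin (2 * K) → Bool) =>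
      SparseSim.stepOp hkd hk Ra OH Of i (b ∘ Sum.inl)) 4 (1600 * P.size) := by
  unfold SparseSim.stepOp
  split_ifs
  · exact CImpl.opB (isBit_ctlForm (i / 2)) hkd hk hRa hw
  · exact (CImpl.opL (isBit_ctlForm (i / 2 + 1)) hw).mono (by omega) (by omega)

lemma Impl.seqOp (hRa : Ra ∈ unitaryGroup Bool ℂ) (hw : 80 * P.size ≤ w) {i : ℕ}
    (hi : i ≤ 2 * K) :
    Impl w (fun OH Of => seqOp (L := 2 * K) (fun s => (goodForm P).eval s)
      (SparseSim.stepOp (K := K) hkd hk Ra OH Of) i) (i * 4) (i * (2300 * P.size)) := by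
  induction i with
  | zero => exact Impl.one.mono (by omega) (by omega)
  | succ i ih =>
    have hs := goodForm_size hk
    have hp : 1 ≤ P.size := by simp [Params.size]
    have hiK : i < 2 * K := hi
    have h1 := CImpl.stepOp (K := K) (w := w) hkd hk hRa (by omega) i
    have h2 := Impl.cOp (nt := P.n + P.p) (N := P.N) (np := P.np) (w := w)
      (Form.not ((goodForm P).inl : Form (Wires P K))) (.inr (.inr ⟨i, hiK⟩))
      (Form.inl_avoids_inr _ _) (by simp only [Form.size, Form.inl_size]; omega) pauliX_mem
    have h3 := h2.mul (Impl.mul h1 (ih hiK.le))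
    have e : (fun s : Wires P K → Bool => (Form.not ((goodForm P).inl : Form (Wires P K))).eval s) =
        fun s => !(goodForm P).eval (s ∘ Sum.inl) := by
      ext s
      conv_lhs => rw [← Sum.elim_comp_inl_inr s]
      simp only [Form.eval, Form.inl_eval]
    rw [e] at h3
    simp only [SparseSim.seqOp, dif_pos hiK]
    refine h3.mono (by omega) ?_
    simp only [Form.size, Form.inl_size]
    have : (i + 1) * (2300 * P.size) = i * (2300 * P.size) + 2300 * P.size := by ring
    omega

lemma CImpl.setTop {β : Type} [Fintype β] [DecidableEq β] (hw : 2 ≤ w) (l : ℕ)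
    (L : List (Fin P.p)) :
    CImpl w (fun (_ : QOp (HWire (P.n + P.p) P.N P.np)) (_ : QOp (FWire (P.n + P.p) P.N))
      (_ : β → Bool) => SparseSim.setTop P l L) 0 (22 * L.length) := by
  induction L with
  | nil => exact CImpl.one
  | cons i L ih =>
    have hc := const_size (κ := Reg P ⊕ β) (l.testBit i)
    have h1 := CImpl.cOp (nt := P.n + P.p) (N := P.N) (np := P.np) (β := β) (w := w)
      (const (l.testBit i)) (m (i.natAdd P.n)) (const_avoids _ _) (by omega) pauliX_mem
    simp only [const_eval] at h1
    refine (h1.mul ih).mono (by omega) ?_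
    rw [List.length_cons]
    omega

lemma CImpl.opClock {β : Type} [Fintype β] [DecidableEq β] (hw : 2 ≤ w) (l : ℕ) :
    CImpl w (fun (_ : QOp (HWire (P.n + P.p) P.N P.np)) (_ : QOp (FWire (P.n + P.p) P.N))
      (_ : β → Bool) => SparseSim.opClock P l) 0 (33 * P.size) := by
  refine ((CImpl.hadAll embMlow (by omega)).mul (CImpl.setTop hw l _)).mono (by omega) ?_
  simp only [Fintype.card_fin, List.length_finRange, Params.size]
  omega

lemma Impl.chain {ρ : Type} [Fintype ρ] [DecidableEq ρ] {L nt N np : ℕ} (hw : 1 ≤ w) {j : ℕ}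
    (hj : j ≤ K) :
    Impl w (fun (_ : QOp (HWire nt N np)) (_ : QOp (FWire nt N)) =>
      chain (K := K) ρ L j) 0 (11 * j) := by
  induction j with
  | zero => exact Impl.one
  | succ j ih =>
    have hjK : j < K := hj
    have hs : (chainForm ρ L hjK).size = 1 := by
      rw [chainForm]; split_ifs <;> rfl
    have ha : (chainForm ρ L hjK).Avoids (.inr (.inl ⟨j, hjK⟩)) := by
      rw [chainForm]
      split_ifs
      · trivial
      · simp [Avoids]; omega
    have h1 := Impl.cOp (nt := nt) (N := N) (np := np) (w := w) _ _ ha (by omega) hadamard_mem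
    simp only [SparseSim.chain, dif_pos hjK]
    refine (h1.mul (ih hjK.le)).mono (by omega) (by omega)

lemma Impl.opPrep (hw : 2 ≤ w) (l : ℕ) :
    Impl w (fun (_ : QOp (HWire (P.n + P.p) P.N P.np)) (_ : QOp (FWire (P.n + P.p) P.N)) =>
      SparseSim.opPrep P K l) 0 (33 * P.size + 11 * K) :=
  (Impl.mul (CImpl.opClock hw l) (Impl.chain (by omega) le_rfl)).mono (by omega) (by omega)

lemma Impl.opW (hRa : Ra ∈ unitaryGroup Bool ℂ) (hw : 80 * P.size ≤ w) (l : ℕ) :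
    Impl w (fun OH Of => SparseSim.opW (K := K) hkd hk Ra OH Of l) (8 * K)
      (4600 * (K * P.size) + 66 * P.size + 22 * K) := by
  have hp : 1 ≤ P.size := by simp [Params.size]
  have h1 := Impl.opPrep (P := P) (K := K) (w := w) (by omega) l
  have h2 := Impl.seqOp (K := K) (w := w) hkd hk hRa hw le_rfl
  refine (h1.adj.mul (h2.mul h1)).mono (by omega) ?_
  have : 2 * K * (2300 * P.size) = 4600 * (K * P.size) := by ring
  omega

variable (P K) in
/-- All qubits are clean except those that hold the index, which is less than `N`. -/
def startForm : Form (Wires P K) :=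
  (goodForm P).inl.and (allZero ((List.finRange _).map (fun i => .inl (m i)) ++
    (List.finRange _).map (fun i => .inr (.inl i)) ++ (List.finRange _).map fun i => .inr (.inr i)))

lemma startForm_size (hk : P.k ≤ P.np) : (startForm P K).size ≤ 66 * P.size + 9 * K := by
  have hs := goodForm_size hk
  have hp : 1 ≤ P.size := by simp [Params.size]
  simp only [startForm, Form.size, Form.inl_size, allZero_size, List.length_append,
    List.length_map, List.length_finRange]
  have : P.n + P.p + 1 ≤ P.size := by simp only [Params.size]; omega
  omega

lemma startForm_eval (hN : 0 < P.N) (s : Wires P K → Bool) :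
    (startForm P K).eval s = true ↔ ∃ x, sst K x = s := by
  have h1 : (goodForm P).inl.eval s = (goodForm P).eval (s ∘ Sum.inl) := by
    conv_lhs => rw [← Sum.elim_comp_inl_inr s]
    rw [Form.inl_eval]
  simp only [startForm, eval, Bool.and_eq_true, h1, goodForm_eval hN, allZero_eval,
    List.mem_append, List.mem_map, List.mem_finRange, true_and]
  constructor
  · rintro ⟨⟨⟨x, t⟩, hg⟩, h0⟩
    refine ⟨x, ?_⟩
    have ht : t = fun _ => false := by
      ext i
      rw [← h0 _ (Or.inl (Or.inl ⟨i, rfl⟩))]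
      exact congrFun hg (m i)
    subst ht
    ext k
    rcases k with k | k | k
    · exact congrFun hg k
    · exact (h0 _ (Or.inl (Or.inr ⟨k, rfl⟩))).symm
    · exact (h0 _ (Or.inr ⟨k, rfl⟩)).symm
  · rintro ⟨x, rfl⟩
    refine ⟨⟨_, rfl⟩, ?_⟩
    rintro k ((⟨i, rfl⟩ | ⟨i, rfl⟩) | ⟨i, rfl⟩) <;> rfl

/-- The block encoding of a truncated Dyson series after oblivious amplitude amplification. -/
noncomputable def opA (hkd : P.kd ≤ indexQubits P.N) (hk : P.k ≤ P.np) (K : ℕ)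
    (Ra : Matrix Bool Bool ℂ) (OH : QOp (HWire (P.n + P.p) P.N P.np))
    (Of : QOp (FWire (P.n + P.p) P.N)) (l : ℕ) : QOp (Wires P K) :=
  opW hkd hk Ra OH Of l * (phaseOp (fun s => (Form.not (startForm P K)).eval s) (-1) *
    ((opW hkd hk Ra OH Of l)ᴴ * (phaseOp (fun s => (startForm P K).eval s) (-1) *
      opW hkd hk Ra OH Of l)))

/-- The amplification uses `opW` or its adjoint three times, with at most `8 * K` queries each. -/
lemma Impl.opA (hRa : Ra ∈ unitaryGroup Bool ℂ) (hw : 80 * (P.size + K) ≤ w) (l : ℕ) :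
    Impl w (fun OH Of => SparseSim.opA hkd hk K Ra OH Of l) (24 * K)
      (20000 * ((K + 1) * P.size)) := by
  have hp : 1 ≤ P.size := by simp [Params.size]
  have hs := startForm_size (K := K) hk
  have h1 := Impl.opW (K := K) (w := w) hkd hk hRa (by omega) l
  have h2 := Impl.phase (nt := P.n + P.p) (N := P.N) (np := P.np) (w := w)
    (Form.not (startForm P K)) (by simp only [Form.size]; omega) (z := -1) (by simp)
  have h3 := Impl.phase (nt := P.n + P.p) (N := P.N) (np := P.np) (w := w)
    (startForm P K) (by omega) (z := -1) (by simp)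
  refine (h1.mul (h2.mul (h1.adj.mul (h3.mul h1)))).mono (by omega) ?_
  have e : (K + 1) * P.size = K * P.size + P.size := by ring
  have : K ≤ K * P.size := Nat.le_mul_of_pos_right _ hp
  simp only [Form.size]
  omega

/-- The product of the segments `0, …, r - 1`. -/
noncomputable def opTotal (hkd : P.kd ≤ indexQubits P.N) (hk : P.k ≤ P.np) (K : ℕ)
    (Ra : Matrix Bool Bool ℂ) (OH : QOp (HWire (P.n + P.p) P.N P.np))
    (Of : QOp (FWire (P.n + P.p) P.N)) : ℕ → QOp (Wires P K)
  | 0 => 1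
  | r + 1 => opA hkd hk K Ra OH Of r * opTotal hkd hk K Ra OH Of r

lemma Impl.opTotal (hRa : Ra ∈ unitaryGroup Bool ℂ) (hw : 80 * (P.size + K) ≤ w) (r : ℕ) :
    Impl w (fun OH Of => SparseSim.opTotal hkd hk K Ra OH Of r) (r * (24 * K))
      (r * (20000 * ((K + 1) * P.size))) := by
  induction r with
  | zero => exact Impl.one.mono (by omega) (by omega)
  | succ r ih =>
    refine ((Impl.opA hkd hk hRa hw r).mul ih).mono ?_ ?_ <;> rw [Nat.succ_mul r] <;> omega

end Costs

/-! ### From implementations to circuits with system and ancilla qubits. -/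

section Relabel

variable {nt N np : ℕ} {κ κ' : Type}

/-- The gate with its qubits renamed. -/
def Gate.map (e : κ ↪ κ') : Gate nt N np κ → Gate nt N np κ'
  | .one u f => .one u (f.trans e)
  | .two u f => .two u (f.trans e)
  | .queryH adj f => .queryH adj (f.trans e)
  | .queryF adj f => .queryF adj (f.trans e)
  | .ctrlQueryH adj f => .ctrlQueryH adj (f.trans e)
  | .ctrlQueryF adj f => .ctrlQueryF adj (f.trans e)

variable [Fintype κ] [DecidableEq κ] [Fintype κ'] [DecidableEq κ']

lemma place_trans_equiv {ι : Type} [Fintype ι] (e : κ ≃ κ') (f : ι ↪ κ) (A : QOp ι) :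
    place (f.trans e.toEmbedding) A = (place f A).submatrix (· ∘ e) (· ∘ e) := by
  ext x y
  simp only [place, submatrix_apply]
  have : (∀ k : κ', (∀ i, (f.trans e.toEmbedding) i ≠ k) → x k = y k) ↔
      ∀ k : κ, (∀ i, f i ≠ k) → (x ∘ e) k = (y ∘ e) k := by
    constructor
    · intro h k hk
      exact h (e k) fun i => by simpa using hk i
    · intro h k hk
      have := h (e.symm k) fun i hi => hk i (by simp [hi])
      simpa using this
  simp only [this]
  rfl

lemma Gate.op_map (OH : QOp (HWire nt N np)) (Of : QOp (FWire nt N)) (e : κ ≃ κ')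
    (g : Gate nt N np κ) :
    (g.map e.toEmbedding).op OH Of = (g.op OH Of).submatrix (· ∘ e) (· ∘ e) := by
  cases g <;> exact place_trans_equiv _ _ _

lemma gatesOp_map (OH : QOp (HWire nt N np)) (Of : QOp (FWire nt N)) (e : κ ≃ κ')
    (c : List (Gate nt N np κ)) :
    gatesOp OH Of (c.map (Gate.map e.toEmbedding)) =
      (gatesOp OH Of c).submatrix (· ∘ e) (· ∘ e) := by
  have he : Function.Bijective fun x : κ' → Bool => x ∘ e := (e.arrowCongr (Equiv.refl _)).symm.bijective
  induction c with
  | nil => exact (submatrix_one_equiv (e.arrowCongr (Equiv.refl Bool)).symm).symm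
  | cons g c ih =>
    rw [List.map_cons, gatesOp, gatesOp, ih, Gate.op_map, submatrix_mul _ _ _ _ _ he]

lemma countP_map_isQuery (e : κ ↪ κ') (p : Bool → Bool) (c : List (Gate nt N np κ)) :
    (c.map (Gate.map e)).countP (fun g => p g.isQuery) = c.countP fun g => p g.isQuery := by
  rw [List.countP_map]
  congr 1
  ext g
  cases g <;> rfl

lemma exists_equiv_sum {q : ℕ} (f : Fin q ↪ κ) :
    ∃ (a : ℕ) (e : κ ≃ Fin q ⊕ Fin a), q + a = Fintype.card κ ∧ ∀ i, e (f i) = Sum.inl i := by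
  classical
  refine ⟨Fintype.card ((Set.range f)ᶜ : Set κ), (Equiv.Set.sumCompl (Set.range f)).symm.trans
    (Equiv.sumCongr (Equiv.ofInjective f f.injective).symm (Fintype.equivFin _)), ?_, fun i => ?_⟩
  · have := Fintype.card_congr ((Equiv.Set.sumCompl (Set.range f)).symm.trans
      (Equiv.sumCongr (Equiv.ofInjective f f.injective).symm
        (Fintype.equivFin ((Set.range f)ᶜ : Set κ))))
    rw [this]
    simp
  · rw [Equiv.trans_apply, Equiv.Set.sumCompl_symm_apply_of_mem (Set.mem_range_self i), Equiv.sumCongr_apply,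
      Sum.map_inl, Equiv.ofInjective_symm_apply]

/-- The qubits are renamed so that those selected by `f` become the system; all others, including
the work qubits, become ancillas. Between states with clean ancillas, the circuit has the entries of
`F`. -/
lemma exists_circuit {w Q G : ℕ} {F : QOp (HWire nt N np) → QOp (FWire nt N) → QOp κ}
    (h : Impl w F Q G) (f : Fin (indexQubits N) ↪ κ) :
    ∃ (a : ℕ) (c : Circuit nt N np a), c.queries ≤ Q ∧ c.primitiveGates ≤ G ∧
      c.qubits = Fintype.card κ + w ∧
      ∀ OH ∈ unitaryGroup (HWire nt N np → Bool) ℂ, ∀ Of ∈ unitaryGroup (FWire nt N → Bool) ℂ,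
        ∀ x y : Fin N, c.implemented OH Of x y =
          F OH Of (Function.extend f (natBits _ x) fun _ => false)
            (Function.extend f (natBits _ y) fun _ => false) := by
  obtain ⟨c, hQ, hG, hc⟩ := h
  obtain ⟨a, e, ha, he⟩ := exists_equiv_sum (f.trans Function.Embedding.inl : _ ↪ κ ⊕ Fin w)
  refine ⟨a, c.map (Gate.map e.toEmbedding), ?_, ?_, ?_, ?_⟩
  · rw [Circuit.queries]
    exact (countP_map_isQuery _ id c).trans_le hQ
  · rw [Circuit.primitiveGates]
    exact (countP_map_isQuery _ not c).trans_le hG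
  · rw [Circuit.qubits, ha, Fintype.card_sum, Fintype.card_fin]
  · intro OH hOH Of hOf x y
    have hop : ∀ c : Circuit nt N np a, Circuit.op OH Of c = gatesOp OH Of c := by
      intro c
      induction c with
      | nil => rfl
      | cons g c ih => rw [Circuit.op, gatesOp, ih]
    have hst : ∀ x : Fin N, (Sum.elim (natBits (indexQubits N) x) (fun _ => false) :
        Fin (indexQubits N) ⊕ Fin a → Bool) ∘ e =
        clean w (Function.extend f (natBits _ x) fun _ => false) := by
      intro x
      ext k
      by_cases hk : ∃ i, f.trans Function.Embedding.inl i = k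
      · obtain ⟨i, rfl⟩ := hk
        rw [Function.comp, he]
        exact (f.injective.extend_apply (natBits _ x) (fun _ => false) i).symm
      · rcases hek : e k with i | i
        · exact (hk ⟨i, e.injective ((he i).trans hek.symm)⟩).elim
        · rw [Function.comp, hek]
          rcases k with k | k
          · rw [clean, Sum.elim_inl, Function.extend_apply', Sum.elim_inr]
            rintro ⟨i, rfl⟩
            exact hk ⟨i, rfl⟩
          · rfl
    rw [Circuit.implemented, hop, gatesOp_map, submatrix_apply]
    simp only [hst]
    have := congrFun (congrFun (hc OH hOH Of hOf).2
      (clean w (Function.extend f (natBits _ x) fun _ => false)))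
      (Function.extend f (natBits _ y) fun _ => false)
    rw [← mulVec_ket (gatesOp OH Of c * _), ← mulVec_mulVec, cleanEmb_mulVec_ket, mulVec_ket,
      Matrix.mul_apply] at this
    rw [this]
    simp only [cleanEmb, clean_injective.eq_iff, ite_mul, one_mul, zero_mul]
    simp

end Relabel

/-! ### Oblivious amplitude amplification, leakage and failure probability. -/

section Amplification

variable {m n : Type} [Fintype m] [DecidableEq m] [Fintype n] [DecidableEq n]

lemma norm_one_le : ‖(1 : Matrix n n ℂ)‖ ≤ 1 := by
  have h := l2_opNorm_conjTranspose_mul_self (1 : Matrix n n ℂ)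
  rw [conjTranspose_one, one_mul] at h
  nlinarith [norm_nonneg (1 : Matrix n n ℂ)]

lemma norm_le_one_of_isometry {A : Matrix m n ℂ} (h : Aᴴ * A = 1) : ‖A‖ ≤ 1 := by
  have h1 := l2_opNorm_conjTranspose_mul_self A
  rw [h] at h1
  have := norm_one_le (n := n)
  nlinarith [norm_nonneg A]

/-- The operator version of `sin 3θ = 3 sin θ - 4 sin³ θ`: two reflections about the range of `J`
alternate with `W` and its adjoint, and `Wᴴ * W = 1` removes all terms except words in the block
`w`. -/
lemma amplification_block {W : Matrix m m ℂ} (hW : Wᴴ * W = 1) {J : Matrix m n ℂ}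
    (hJ : Jᴴ * J = 1) {w : Matrix n n ℂ} (hw : Jᴴ * W * J = w) :
    Jᴴ * (W * (((2 : ℂ) • (J * Jᴴ) - 1) * (Wᴴ * ((1 - (2 : ℂ) • (J * Jᴴ)) * W)))) * J =
      (3 : ℂ) • w - (4 : ℂ) • (w * wᴴ * w) := by
  have hW' : W * Wᴴ = 1 := mul_eq_one_comm.1 hW
  have hw1 : Jᴴ * (W * J) = w := by rw [← hw, Matrix.mul_assoc]
  have hw2 : Jᴴ * (Wᴴ * J) = wᴴ := by
    rw [← hw1]; simp only [conjTranspose_mul, conjTranspose_conjTranspose, Matrix.mul_assoc]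
  have e1 : Wᴴ * ((1 - (2 : ℂ) • (J * Jᴴ)) * W) * J = J - (2 : ℂ) • (Wᴴ * (J * w)) := by
    rw [← hw1]
    simp only [Matrix.mul_assoc, Matrix.sub_mul, Matrix.mul_sub, Matrix.one_mul, Matrix.smul_mul, Matrix.mul_smul]
    rw [← Matrix.mul_assoc Wᴴ W, hW, Matrix.one_mul]
  have e2 : ((2 : ℂ) • (J * Jᴴ) - 1) * (J - (2 : ℂ) • (Wᴴ * (J * w))) =
      J - (4 : ℂ) • (J * (wᴴ * w)) + (2 : ℂ) • (Wᴴ * (J * w)) := by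
    have h3 : J * Jᴴ * (Wᴴ * (J * w)) = J * (wᴴ * w) := by
      rw [← hw2]; simp only [Matrix.mul_assoc]
    have h4 : J * Jᴴ * J = J := by rw [Matrix.mul_assoc, hJ, Matrix.mul_one]
    simp only [Matrix.sub_mul, Matrix.mul_sub, Matrix.one_mul, Matrix.smul_mul, Matrix.mul_smul, h3, h4]
    module
  have e3 : W * (J - (4 : ℂ) • (J * (wᴴ * w)) + (2 : ℂ) • (Wᴴ * (J * w))) =
      W * J - (4 : ℂ) • (W * (J * (wᴴ * w))) + (2 : ℂ) • (J * w) := by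
    simp only [Matrix.mul_sub, Matrix.mul_add, Matrix.mul_smul]
    rw [← Matrix.mul_assoc W Wᴴ, hW', Matrix.one_mul]
  rw [Matrix.mul_assoc, Matrix.mul_assoc W, Matrix.mul_assoc ((2 : ℂ) • (J * Jᴴ) - 1), e1, e2, e3]
  have h5 : Jᴴ * (W * (J * (wᴴ * w))) = w * wᴴ * w := by
    rw [← Matrix.mul_assoc W, ← Matrix.mul_assoc, hw1, Matrix.mul_assoc]
  have h6 : Jᴴ * (J * w) = w := by rw [← Matrix.mul_assoc, hJ, Matrix.one_mul]
  simp only [Matrix.mul_sub, Matrix.mul_add, Matrix.mul_smul, hw1, h5, h6]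
  module

/-- For `w = U / 2` the polynomial gives `3 / 2 - 4 / 8 = 1` times `U` exactly. Expanding around
`U`, with `V = U + E`, leaves half of six terms, each of norm at most `η` because `η ≤ 1`. -/
lemma norm_amplification_sub_le {U V : Matrix n n ℂ} (hU : Uᴴ * U = 1) {η : ℝ} (h : ‖V - U‖ ≤ η)
    (hη : η ≤ 1) {w : Matrix n n ℂ} (hw : w = (1 / 2 : ℂ) • V) :
    ‖(3 : ℂ) • w - (4 : ℂ) • (w * wᴴ * w) - U‖ ≤ 3 * η := by
  have hU' : U * Uᴴ = 1 := mul_eq_one_comm.1 hU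
  obtain ⟨E, rfl⟩ : ∃ E, V = U + E := ⟨V - U, by abel⟩
  rw [add_sub_cancel_left] at h
  have hUn := norm_le_one_of_isometry hU
  have key : (3 : ℂ) • w - (4 : ℂ) • (w * wᴴ * w) - U = (1 / 2 : ℂ) • (E - U * Eᴴ * U - E * Eᴴ * U -
      E * Uᴴ * E - U * Eᴴ * E - E * Eᴴ * E) := by
    have h1 : (U + E) * (U + E)ᴴ * (U + E) = U + (2 : ℂ) • E + U * Eᴴ * U + E * Eᴴ * U +
        E * Uᴴ * E + U * Eᴴ * E + E * Eᴴ * E := by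
      rw [conjTranspose_add]
      simp only [Matrix.mul_add, Matrix.add_mul, hU', Matrix.one_mul]
      rw [Matrix.mul_assoc E Uᴴ U, hU, Matrix.mul_one]
      module
    have h2 : w * wᴴ * w = (1 / 8 : ℂ) • ((U + E) * (U + E)ᴴ * (U + E)) := by
      rw [hw, conjTranspose_smul]
      simp only [Matrix.smul_mul, Matrix.mul_smul, smul_smul]
      rw [show star (1 / 2 : ℂ) = 1 / 2 by simp]
      norm_num
    rw [h2, h1, hw]
    module
  have hE0 := norm_nonneg E
  have hEs : ‖Eᴴ‖ ≤ η := by rw [l2_opNorm_conjTranspose]; exact h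
  have hUs : ‖Uᴴ‖ ≤ 1 := by rw [l2_opNorm_conjTranspose]; exact hUn
  have hη0 : 0 ≤ η := hE0.trans h
  have b3 : ∀ {A B C : Matrix n n ℂ} {a b c : ℝ}, ‖A‖ ≤ a → ‖B‖ ≤ b → ‖C‖ ≤ c → 0 ≤ a → 0 ≤ b →
      ‖A * B * C‖ ≤ a * b * c := by
    intro A B C a b c hA hB hC ha hb
    refine (norm_mul_le _ _).trans (mul_le_mul ((norm_mul_le _ _).trans
      (mul_le_mul hA hB (norm_nonneg _) ha)) hC (norm_nonneg _) (mul_nonneg ha hb))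
  have t1 := b3 hUn hEs hUn zero_le_one hη0
  have t2 := b3 h hEs hUn hη0 hη0
  have t3 := b3 h hUs h hη0 zero_le_one
  have t4 := b3 hUn hEs h zero_le_one hη0
  have t5 := b3 h hEs h hη0 hη0
  have hn : ‖E - U * Eᴴ * U - E * Eᴴ * U - E * Uᴴ * E - U * Eᴴ * E - E * Eᴴ * E‖ ≤ 6 * η := by
    refine (norm_sub_le _ _).trans ?_
    have s1 := norm_sub_le (E - U * Eᴴ * U - E * Eᴴ * U - E * Uᴴ * E) (U * Eᴴ * E)
    have s2 := norm_sub_le (E - U * Eᴴ * U - E * Eᴴ * U) (E * Uᴴ * E)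
    have s3 := norm_sub_le (E - U * Eᴴ * U) (E * Eᴴ * U)
    have s4 := norm_sub_le E (U * Eᴴ * U)
    nlinarith
  rw [key, norm_smul]
  norm_num
  linarith

/-- Both `A * J` and `J * U` are isometries, so the squared distance has no terms besides the cross
terms, which involve the block only. Leakage out of the range of `J` is thus controlled by the
block, at the price of a square root. -/
lemma norm_mul_isometry_sub_sq_le {A : Matrix m m ℂ} (hA : Aᴴ * A = 1) {J : Matrix m n ℂ}
    (hJ : Jᴴ * J = 1) {U : Matrix n n ℂ} (hU : Uᴴ * U = 1) :
    ‖A * J - J * U‖ ^ 2 ≤ 2 * ‖Jᴴ * A * J - U‖ := by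
  have key : (A * J - J * U)ᴴ * (A * J - J * U) =
      -((Jᴴ * A * J - U)ᴴ * U) - Uᴴ * (Jᴴ * A * J - U) := by
    simp only [conjTranspose_sub, conjTranspose_mul, conjTranspose_conjTranspose, Matrix.sub_mul,
      Matrix.mul_sub, hU]
    have h1 : Jᴴ * Aᴴ * (A * J) = 1 := by
      rw [Matrix.mul_assoc, ← Matrix.mul_assoc Aᴴ, hA, Matrix.one_mul, hJ]
    have h2 : Uᴴ * Jᴴ * (J * U) = 1 := by
      rw [Matrix.mul_assoc, ← Matrix.mul_assoc Jᴴ, hJ, Matrix.one_mul, hU]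
    rw [h1, h2]
    simp only [Matrix.mul_assoc]
    abel
  have hUn := norm_le_one_of_isometry hU
  have hUs : ‖Uᴴ‖ ≤ 1 := by rw [l2_opNorm_conjTranspose]; exact hUn
  rw [sq, ← l2_opNorm_conjTranspose_mul_self, key]
  refine (norm_sub_le _ _).trans ?_
  rw [norm_neg]
  have h1 := norm_mul_le (Jᴴ * A * J - U)ᴴ U
  have h2 := norm_mul_le Uᴴ (Jᴴ * A * J - U)
  rw [l2_opNorm_conjTranspose (Jᴴ * A * J - U)] at h1
  have := norm_nonneg (Jᴴ * A * J - U)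
  nlinarith

/-- `U` preserves the norm of `ψ`, so `W` shrinks it by at most `ε`, and `1 - (1 - ε) ^ 2 ≤ 2 * ε`.
-/
lemma failureProb_le {N : ℕ} {W U : Matrix (Fin N) (Fin N) ℂ} (hU : Uᴴ * U = 1) {ε : ℝ}
    (h : ‖W - U‖ ≤ ε) {ψ : Fin N → ℂ} (hψ : ∑ x, ‖ψ x‖ ^ 2 = 1) : failureProb W ψ ≤ 2 * ε := by
  have hn : ∀ φ : Fin N → ℂ, ∑ x, ‖φ x‖ ^ 2 = ‖WithLp.toLp 2 φ‖ ^ 2 := by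
    intro φ
    rw [EuclideanSpace.norm_sq_eq]
  have h1 : ‖WithLp.toLp 2 ψ‖ = 1 := by
    have := hn ψ
    rw [hψ] at this
    nlinarith [norm_nonneg (WithLp.toLp 2 ψ)]
  have h2 : ‖WithLp.toLp 2 ((W - U) *ᵥ ψ)‖ ≤ ε := by
    have := l2_opNorm_mulVec (W - U) (WithLp.toLp 2 ψ)
    rw [h1, mul_one] at this
    exact this.trans h
  have h3 : ‖WithLp.toLp 2 (U *ᵥ ψ)‖ = 1 := by
    have e := l2_opNorm_mulVec Uᴴ (WithLp.toLp 2 (U *ᵥ ψ))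
    have e' : Uᴴ *ᵥ (U *ᵥ ψ) = ψ := by rw [mulVec_mulVec, hU, one_mulVec]
    have f := l2_opNorm_mulVec U (WithLp.toLp 2 ψ)
    have hUn := norm_le_one_of_isometry hU
    have hUs : ‖Uᴴ‖ ≤ 1 := by rw [l2_opNorm_conjTranspose]; exact hUn
    simp only at e f
    rw [h1, mul_one] at f
    have e2 : ‖WithLp.toLp 2 ψ‖ ≤ ‖Uᴴ‖ * ‖WithLp.toLp 2 (U *ᵥ ψ)‖ := by
      rw [e'] at e; exact e
    rw [h1] at e2
    have := norm_nonneg (WithLp.toLp 2 (U *ᵥ ψ))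
    have f' : ‖WithLp.toLp 2 (U *ᵥ ψ)‖ ≤ ‖U‖ := f
    nlinarith
  have h4 : WithLp.toLp 2 (U *ᵥ ψ) = WithLp.toLp 2 (W *ᵥ ψ) - WithLp.toLp 2 ((W - U) *ᵥ ψ) := by
    rw [← WithLp.toLp_sub, sub_mulVec, sub_sub_cancel]
  have h5 : 1 ≤ ‖WithLp.toLp 2 (W *ᵥ ψ)‖ + ε := by
    rw [← h3, h4]
    exact (norm_sub_le _ _).trans (by linarith)
  rw [failureProb, hn]
  -- For `ε ≥ 1` the claimed bound exceeds `1` and holds trivially.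
  rcases le_total ε 1 with h6 | h6
  · have : (1 - ε) ^ 2 ≤ ‖WithLp.toLp 2 (W *ᵥ ψ)‖ ^ 2 :=
      pow_le_pow_left₀ (by linarith) (by linarith) 2
    nlinarith [sq_nonneg ε]
  · nlinarith [norm_nonneg (WithLp.toLp 2 (W *ᵥ ψ))]

end Amplification

/-! ### The reflection about the clean states. -/

section Start

variable {κ γ : Type} [Fintype κ] [DecidableEq κ] [Fintype γ] [DecidableEq γ]

/-- The isometry onto the span of the basis states `g`. -/
def basisEmb (g : γ → κ → Bool) : Matrix (κ → Bool) γ ℂ := fun s x => if s = g x then 1 else 0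

lemma basisEmb_conjTranspose_mul {g : γ → κ → Bool} (hg : Function.Injective g) :
    (basisEmb g)ᴴ * basisEmb g = 1 := by
  ext x y
  simp [Matrix.mul_apply, basisEmb, Matrix.one_apply, hg.eq_iff, eq_comm]

lemma basisEmb_mul_conjTranspose {g : γ → κ → Bool} (hg : Function.Injective g)
    {ψ : (κ → Bool) → Bool} (hψ : ∀ s, ψ s = true ↔ ∃ x, g x = s) :
    basisEmb g * (basisEmb g)ᴴ = diagonal fun s => if ψ s then 1 else 0 := by
  ext s t
  simp only [Matrix.mul_apply, basisEmb, conjTranspose_apply, diagonal_apply]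
  by_cases h : ψ s = true
  · obtain ⟨x, rfl⟩ := (hψ s).1 h
    rw [Finset.sum_eq_single x]
    · simp [h, eq_comm, apply_ite (starRingEnd ℂ)]
    · intro y _ hy
      rw [if_neg fun h' => hy (hg h'.symm), zero_mul]
    · simp
  · rw [Finset.sum_eq_zero]
    · simp [h]
    · intro x _
      rw [if_neg, zero_mul]
      rintro rfl
      exact h ((hψ _).2 ⟨x, rfl⟩)

lemma basisEmb_block (g : γ → κ → Bool) (A : QOp κ) (x y : γ) :
    ((basisEmb g)ᴴ * A * basisEmb g) x y = A (g x) (g y) := by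
  simp [Matrix.mul_apply, basisEmb, apply_ite (starRingEnd ℂ)]

lemma phaseOp_start {g : γ → κ → Bool} (hg : Function.Injective g)
    {ψ : (κ → Bool) → Bool} (hψ : ∀ s, ψ s = true ↔ ∃ x, g x = s) :
    phaseOp ψ (-1) = 1 - (2 : ℂ) • (basisEmb g * (basisEmb g)ᴴ) ∧
    phaseOp (fun s => !ψ s) (-1) = (2 : ℂ) • (basisEmb g * (basisEmb g)ᴴ) - 1 := by
  rw [basisEmb_mul_conjTranspose hg hψ]
  constructor <;> ext s t <;> by_cases hst : s = t
  · subst hst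
    by_cases h : ψ s <;> simp [phaseOp, h] <;> norm_num
  · simp [phaseOp, hst]
  · subst hst
    by_cases h : ψ s <;> simp [phaseOp, h] <;> norm_num
  · simp [phaseOp, hst]

end Start

/-! ### Composition of the segments. -/

/-- The product `U (r - 1) ⋯ U 0`. -/
def timeProd {R : Type*} [Monoid R] (U : ℕ → R) : ℕ → R
  | 0 => 1
  | r + 1 => U r * timeProd U r

lemma timeProd_isometry {n : Type} [Fintype n] [DecidableEq n] {U : ℕ → Matrix n n ℂ} {r : ℕ}
    (hU : ∀ l < r, (U l)ᴴ * U l = 1) : (timeProd U r)ᴴ * timeProd U r = 1 := by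
  induction r with
  | zero => simp [timeProd]
  | succ r ih =>
    rw [timeProd, conjTranspose_mul, Matrix.mul_assoc, ← Matrix.mul_assoc (U r)ᴴ,
      hU r r.lt_succ_self, Matrix.one_mul, ih fun l hl => hU l (by omega)]

section Total

variable {P : Params} {K : ℕ}

lemma sst_injective : Function.Injective (sst (P := P) K) := by
  intro x y h
  have h1 : gst (x, fun _ => false) = gst (y, fun _ => false) :=
    funext fun k => congrFun h (Sum.inl k)
  exact congrArg Prod.fst (gst_injective h1)

variable {hkd : P.kd ≤ indexQubits P.N} {hk : P.k ≤ P.np} {Ra : Matrix Bool Bool ℂ}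
  {OH : QOp (HWire (P.n + P.p) P.N P.np)} {Of : QOp (FWire (P.n + P.p) P.N)}

/-- The deviations `A * J - J * U` of the segments add up, because multiplication by isometries does
not enlarge them. Working with these instead of blocks makes it unnecessary to project the ancillas
after each segment. -/
lemma norm_opTotal_block_sub_le (hN : 0 < P.N) (hRa : Ra ∈ unitaryGroup Bool ℂ)
    (hOH : OH ∈ unitaryGroup (HWire (P.n + P.p) P.N P.np → Bool) ℂ)
    (hOf : Of ∈ unitaryGroup (FWire (P.n + P.p) P.N → Bool) ℂ) {r : ℕ}
    {U : ℕ → Matrix (Fin P.N) (Fin P.N) ℂ} {η : ℝ} (hη : η ≤ 1)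
    (hU : ∀ l < r, (U l)ᴴ * U l = 1)
    (hV : ∀ l < r, ‖(2 : ℂ) • blk (sst K) (opW (K := K) hkd hk Ra OH Of l) - U l‖ ≤ η) :
    ‖blk (sst K) (opTotal hkd hk K Ra OH Of r) - timeProd U r‖ ≤ r * √(6 * η) := by
  set J := basisEmb (sst (P := P) K) with hJdef
  have hJ : Jᴴ * J = 1 := basisEmb_conjTranspose_mul sst_injective
  have hblk : ∀ A : QOp (Wires P K), blk (sst K) A = Jᴴ * A * J := by
    intro A
    ext x y
    rw [hJdef, basisEmb_block, blk, submatrix_apply]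
  have hJn := norm_le_one_of_isometry hJ
  have hJs : ‖Jᴴ‖ ≤ 1 := by rw [l2_opNorm_conjTranspose]; exact hJn
  have hA : ∀ l, (opA hkd hk K Ra OH Of l)ᴴ * opA hkd hk K Ra OH Of l = 1 := fun l =>
    (Impl.opA (K := K) hkd hk hRa le_rfl l).conjTranspose_mul_self hOH hOf
  have hstep : ∀ l < r, ‖opA hkd hk K Ra OH Of l * J - J * U l‖ ≤ √(6 * η) := by
    intro l hl
    have hW : (opW (K := K) hkd hk Ra OH Of l)ᴴ * opW hkd hk Ra OH Of l = 1 :=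
      (Impl.opW (K := K) hkd hk hRa le_rfl l).conjTranspose_mul_self hOH hOf
    obtain ⟨h1, h2⟩ := phaseOp_start (sst_injective (K := K)) (startForm_eval (K := K) hN)
    have h3 : ∀ W : Matrix (Wires P K → Bool) (Wires P K → Bool) ℂ, Wᴴ * W = 1 →
        ‖(2 : ℂ) • (Jᴴ * W * J) - U l‖ ≤ η →
        ‖Jᴴ * (W * (phaseOp (fun s => !(startForm P K).eval s) (-1) * (Wᴴ *
          (phaseOp (fun s => (startForm P K).eval s) (-1) * W)))) * J - U l‖ ≤ 3 * η := by
      intro W hW h4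
      rw [h1, h2, amplification_block hW hJ rfl]
      exact norm_amplification_sub_le (hU l hl) h4 hη (by rw [smul_smul]; norm_num)
    have h4 := hV l hl
    rw [hblk] at h4
    refine Real.le_sqrt_of_sq_le ((norm_mul_isometry_sub_sq_le (hA l) hJ (hU l hl)).trans ?_)
    have h6 : ‖Jᴴ * opA hkd hk K Ra OH Of l * J - U l‖ ≤ 3 * η := h3 _ hW h4
    linarith
  have key : ∀ k ≤ r, ‖opTotal hkd hk K Ra OH Of k * J - J * timeProd U k‖ ≤ k * √(6 * η) := by
    intro k hkr
    induction k with
    | zero => simp [opTotal, timeProd]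
    | succ k ih =>
      have e : opTotal hkd hk K Ra OH Of (k + 1) * J - J * timeProd U (k + 1) =
          opA hkd hk K Ra OH Of k * (opTotal hkd hk K Ra OH Of k * J - J * timeProd U k) +
          (opA hkd hk K Ra OH Of k * J - J * U k) * timeProd U k := by
        rw [opTotal, timeProd, Matrix.mul_sub, Matrix.sub_mul, Matrix.mul_assoc, ← Matrix.mul_assoc J,
          Matrix.mul_assoc (opA hkd hk K Ra OH Of k) J]
        abel
      have n1 := norm_le_one_of_isometry (hA k)
      have n2 := norm_le_one_of_isometry (timeProd_isometry (r := k) fun l hl => hU l (by omega : l < r))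
      have i1 := ih (by omega)
      have i2 := hstep k (by omega)
      rw [e]
      refine (norm_add_le _ _).trans ?_
      have j1 := l2_opNorm_mul (opA hkd hk K Ra OH Of k)
        (opTotal hkd hk K Ra OH Of k * J - J * timeProd U k)
      have j2 := l2_opNorm_mul (opA hkd hk K Ra OH Of k * J - J * U k) (timeProd U k)
      have k1 := mul_le_mul n1 i1 (norm_nonneg _) zero_le_one
      have k2 := mul_le_mul i2 n2 (norm_nonneg _) (Real.sqrt_nonneg _)
      push_cast
      linarith
  have hfin := key r le_rfl
  rw [hblk]
  have e : Jᴴ * opTotal hkd hk K Ra OH Of r * J - timeProd U r =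
      Jᴴ * (opTotal hkd hk K Ra OH Of r * J - J * timeProd U r) := by
    rw [Matrix.mul_sub, ← Matrix.mul_assoc Jᴴ J, hJ, Matrix.one_mul, Matrix.mul_assoc]
  rw [e]
  refine (l2_opNorm_mul _ _).trans ?_
  have := mul_le_mul hJs hfin (norm_nonneg _) zero_le_one
  linarith

end Total

/-! ### The Dyson series and the time-ordered exponential. -/

section Dyson

variable {N : ℕ} {H : ℝ → Matrix (Fin N) (Fin N) ℂ}

lemma dysonTerm_congr {H' : ℝ → Matrix (Fin N) (Fin N) ℂ} {t : ℝ} (h : ∀ s ∈ Set.Icc 0 t, H s = H' s)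
    (k : ℕ) : ∀ s ∈ Set.Icc 0 t, dysonTerm H k s = dysonTerm H' k s := by
  induction k with
  | zero => intro s _; rfl
  | succ k ih =>
    intro s hs
    refine intervalIntegral.integral_congr fun r hr => ?_
    rw [Set.uIcc_of_le hs.1] at hr
    have hr' : r ∈ Set.Icc 0 t := ⟨hr.1, hr.2.trans hs.2⟩
    rw [h r hr', ih r hr']

lemma continuous_dysonTerm (hH : Continuous H) (k : ℕ) : Continuous (dysonTerm H k) := by
  induction k with
  | zero => exact continuous_const
  | succ k ih =>
    exact intervalIntegral.continuous_primitive (fun a b => (hH.mul ih).intervalIntegrable a b) 0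

lemma hasDerivAt_dysonTerm (hH : Continuous H) (k : ℕ) (s : ℝ) :
    HasDerivAt (dysonTerm H (k + 1)) (H s * dysonTerm H k s) s :=
  ((hH.mul (continuous_dysonTerm hH k)).integral_hasStrictDerivAt 0 s).hasDerivAt

lemma norm_dysonTerm_le (hH : Continuous H) {B : ℝ} (hB : ∀ s, ‖H s‖ ≤ B) (k : ℕ) (s : ℝ) :
    ‖dysonTerm H k s‖ ≤ (B * |s|) ^ k / k.factorial := by
  have hB0 : 0 ≤ B := (norm_nonneg _).trans (hB 0)
  induction k generalizing s with
  | zero => simpa [dysonTerm] using norm_one_le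
  | succ k ih =>
    have h1 : ∀ r, ‖H r * dysonTerm H k r‖ ≤ B ^ (k + 1) / k.factorial * |r - 0| ^ k := by
      intro r
      refine (norm_mul_le _ _).trans ((mul_le_mul (hB r) (ih r) (norm_nonneg _) hB0).trans_eq ?_)
      rw [sub_zero]; ring
    have hc : Continuous fun r => H r * dysonTerm H k r := hH.mul (continuous_dysonTerm hH k)
    have hint : ∀ f : ℝ → ℝ, Continuous f →
        MeasureTheory.IntegrableOn f (Set.uIoc 0 s) := fun f hf =>
      (intervalIntegrable_iff.1 (hf.intervalIntegrable 0 s))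
    refine (intervalIntegral.norm_integral_le_integral_norm_uIoc).trans
      ((MeasureTheory.integral_mono (hint _ hc.norm) (hint _ (by fun_prop)) h1).trans_eq ?_)
    rw [MeasureTheory.integral_const_mul, integral_pow_abs_sub_uIoc, sub_zero, Nat.factorial_succ]
    push_cast
    rw [mul_pow]
    field_simp

lemma summable_dyson (hH : Continuous H) {B : ℝ} (hB : ∀ s, ‖H s‖ ≤ B) (s : ℝ) :
    Summable fun k => (-Complex.I) ^ k • dysonTerm H k s := by
  refine Summable.of_norm_bounded (Real.summable_pow_div_factorial (B * |s|)) fun k => ?_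
  rw [norm_smul, norm_pow, norm_neg, Complex.norm_I, one_pow, one_mul]
  exact norm_dysonTerm_le hH hB k s

/-- Termwise differentiation, on a ball around `0` in which the derivatives are dominated by an
exponential series. -/
lemma hasDerivAt_timeOrderedExp (hH : Continuous H) {B : ℝ} (hB : ∀ s, ‖H s‖ ≤ B) (s : ℝ) :
    HasDerivAt (timeOrderedExp H) ((-Complex.I) • (H s * timeOrderedExp H s)) s := by
  have hB0 : 0 ≤ B := (norm_nonneg _).trans (hB 0)
  set T := |s| + 1 with hT
  -- The term of order zero is constant, and differentiating the term of order `k + 1` gives back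
  -- the one of order `k`; hence the shift of the index.
  set u : ℕ → ℝ := fun k => k.casesOn 0 fun k => B * ((B * T) ^ k / k.factorial)
  set g' : ℕ → ℝ → Matrix (Fin N) (Fin N) ℂ := fun k y =>
    k.casesOn 0 fun k => (-Complex.I) ^ (k + 1) • (H y * dysonTerm H k y)
  have hu : Summable u := by
    rw [← summable_nat_add_iff 1]
    exact (Real.summable_pow_div_factorial (B * T)).mul_left B
  have hs : s ∈ Metric.ball (0 : ℝ) T := by simp [hT]
  have h := hasDerivAt_tsum_of_isPreconnected hu Metric.isOpen_ball
    (convex_ball (0 : ℝ) T).isPreconnected (g := fun k y => (-Complex.I) ^ k • dysonTerm H k y)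
    (g' := g') ?_ ?_ (Metric.mem_ball_self (by positivity)) (summable_dyson hH hB 0) hs
  · refine HasDerivAt.congr_deriv (f := timeOrderedExp H) h ?_
    have hsum : Summable fun k => g' k s := by
      rw [← summable_nat_add_iff 1]
      have := ((summable_dyson hH hB s).mul_left (H s)).const_smul (-Complex.I)
      refine this.congr fun k => ?_
      simp only [g', pow_succ', mul_smul_comm, smul_smul]
    have h2 : Summable fun k => H s * ((-Complex.I) ^ k • dysonTerm H k s) :=
      (summable_dyson hH hB s).mul_left (H s)
    rw [hsum.tsum_eq_zero_add, timeOrderedExp, ← (summable_dyson hH hB s).tsum_mul_left (H s),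
      ← h2.tsum_const_smul (-Complex.I)]
    simp only [g']
    refine (zero_add _).trans (tsum_congr fun k => ?_)
    rw [pow_succ', mul_smul_comm, smul_smul]
  · intro k y _
    cases k with
    | zero => simpa [g', dysonTerm] using hasDerivAt_const y (1 : Matrix (Fin N) (Fin N) ℂ)
    | succ k => exact (hasDerivAt_dysonTerm hH k y).const_smul ((-Complex.I) ^ (k + 1))
  · intro k y hy
    cases k with
    | zero => simp [g', u]
    | succ k =>
      simp only [g', u]
      rw [norm_smul, norm_pow, norm_neg, Complex.norm_I, one_pow, one_mul]
      refine (norm_mul_le _ _).trans (mul_le_mul (hB y) ((norm_dysonTerm_le hH hB k y).trans ?_)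
        (norm_nonneg _) hB0)
      have : |y| ≤ T := by
        rw [Metric.mem_ball, dist_zero_right] at hy
        exact hy.le
      gcongr

lemma timeOrderedExp_zero : timeOrderedExp H 0 = 1 := by
  rw [timeOrderedExp, tsum_eq_single 0]
  · simp [dysonTerm]
  · intro k hk
    obtain ⟨k, rfl⟩ := Nat.exists_eq_succ_of_ne_zero hk
    simp [dysonTerm]

/-- In the derivative of `Uᴴ * U` the two contributions of the Hermitian `H s` cancel, and the value
at `0` is `1`. -/
lemma timeOrderedExp_isometry (hH : Continuous H) {B : ℝ} (hB : ∀ s, ‖H s‖ ≤ B)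
    (hherm : ∀ s, (H s).IsHermitian) (s : ℝ) :
    (timeOrderedExp H s)ᴴ * timeOrderedExp H s = 1 := by
  have hd : ∀ s, HasDerivAt (fun s => (timeOrderedExp H s)ᴴ * timeOrderedExp H s) 0 s := by
    intro s
    have h1 := hasDerivAt_timeOrderedExp hH hB s
    have h2 : HasDerivAt (fun s => (timeOrderedExp H s)ᴴ)
        ((-Complex.I) • (H s * timeOrderedExp H s))ᴴ s := h1.star
    refine (h2.mul h1).congr_deriv ?_
    rw [conjTranspose_smul, conjTranspose_mul, (hherm s).eq, Matrix.smul_mul, Matrix.mul_smul,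
      Matrix.mul_assoc, star_neg, Complex.star_def, Complex.conj_I, neg_neg, neg_smul, add_neg_cancel]
  have hdiff : Differentiable ℝ fun s => (timeOrderedExp H s)ᴴ * timeOrderedExp H s :=
    fun s => (hd s).differentiableAt
  have := is_const_of_deriv_eq_zero hdiff (fun s => (hd s).deriv) s 0
  rw [this, timeOrderedExp_zero, conjTranspose_one, Matrix.one_mul]

lemma timeOrderedExp_sub (hH : Continuous H) {B : ℝ} (hB : ∀ s, ‖H s‖ ≤ B) (a b : ℝ) :
    timeOrderedExp H b - timeOrderedExp H a =
      ∫ s in a..b, (-Complex.I) • (H s * timeOrderedExp H s) := by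
  have hc : Continuous (timeOrderedExp H) :=
    continuous_iff_continuousAt.2 fun s => (hasDerivAt_timeOrderedExp hH hB s).continuousAt
  exact (intervalIntegral.integral_eq_sub_of_hasDerivAt
    (fun s _ => hasDerivAt_timeOrderedExp hH hB s)
    (((hH.mul hc).const_smul (-Complex.I)).intervalIntegrable a b)).symm

/-- An Euler step has two errors: `H` differs from the sample `A` by at most `e`, and the evolution
moves by at most `B * (b - a)` during the step. -/
lemma norm_timeOrderedExp_step_le (hH : Continuous H) {B : ℝ} (hB : ∀ s, ‖H s‖ ≤ B)
    (hherm : ∀ s, (H s).IsHermitian) {a b : ℝ} (hab : a ≤ b) (A : Matrix (Fin N) (Fin N) ℂ)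
    {B' e : ℝ} (hA : ‖A‖ ≤ B') (he : ∀ s ∈ Set.Icc a b, ‖H s - A‖ ≤ e) :
    ‖timeOrderedExp H b - (1 + ((-Complex.I) * (b - a : ℝ)) • A) * timeOrderedExp H a‖ ≤
      (e + B' * (B * (b - a))) * (b - a) := by
  have hiso := timeOrderedExp_isometry hH hB hherm
  have hn : ∀ s, ‖timeOrderedExp H s‖ ≤ 1 := fun s => norm_le_one_of_isometry (hiso s)
  have hB0 : 0 ≤ B := (norm_nonneg _).trans (hB 0)
  have hB0' : 0 ≤ B' := (norm_nonneg _).trans hA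
  have hc : Continuous (timeOrderedExp H) :=
    continuous_iff_continuousAt.2 fun s => (hasDerivAt_timeOrderedExp hH hB s).continuousAt
  have hint : IntervalIntegrable (fun s => (-Complex.I) • (H s * timeOrderedExp H s))
      MeasureTheory.volume a b := ((hH.mul hc).const_smul (-Complex.I)).intervalIntegrable a b
  have h1 : ∀ s ∈ Set.Icc a b, ‖timeOrderedExp H s - timeOrderedExp H a‖ ≤ B * (b - a) := by
    intro s hs
    rw [timeOrderedExp_sub hH hB]
    refine (intervalIntegral.norm_integral_le_of_norm_le_const (C := B) fun r _ => ?_).trans ?_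
    · rw [norm_smul, norm_neg, Complex.norm_I, one_mul]
      refine (norm_mul_le _ _).trans ((mul_le_mul (hB r) (hn r) (norm_nonneg _) hB0).trans_eq ?_)
      rw [mul_one]
    · rw [abs_of_nonneg (by linarith [hs.1])]
      exact mul_le_mul_of_nonneg_left (by linarith [hs.2]) hB0
  have h2 : timeOrderedExp H b - (1 + ((-Complex.I) * (b - a : ℝ)) • A) * timeOrderedExp H a =
      ∫ s in a..b, (-Complex.I) • (H s * timeOrderedExp H s - A * timeOrderedExp H a) := by
    have e1 : ∫ s in a..b, (-Complex.I) • (A * timeOrderedExp H a) =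
        ((-Complex.I) * (b - a : ℝ)) • (A * timeOrderedExp H a) := by
      rw [intervalIntegral.integral_const, ← Complex.coe_smul, smul_smul, mul_comm]
    simp only [smul_sub]
    rw [intervalIntegral.integral_sub hint
      (continuous_const.intervalIntegrable a b), ← timeOrderedExp_sub hH hB, e1, Matrix.add_mul,
      Matrix.one_mul, Matrix.smul_mul]
    abel
  rw [h2]
  refine (intervalIntegral.norm_integral_le_of_norm_le_const
    (C := e + B' * (B * (b - a))) fun s hs => ?_).trans_eq (by rw [abs_of_nonneg (by linarith)])
  rw [Set.uIoc_of_le hab] at hs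
  have hs' : s ∈ Set.Icc a b := ⟨hs.1.le, hs.2⟩
  rw [norm_smul, norm_neg, Complex.norm_I, one_mul]
  have e2 : H s * timeOrderedExp H s - A * timeOrderedExp H a = (H s - A) * timeOrderedExp H s +
      A * (timeOrderedExp H s - timeOrderedExp H a) := by
    rw [Matrix.sub_mul, Matrix.mul_sub]; abel
  rw [e2]
  refine (norm_add_le _ _).trans (add_le_add ?_ ?_)
  · refine (norm_mul_le _ _).trans ((mul_le_mul (he s hs') (hn s) (norm_nonneg _)
      ((norm_nonneg _).trans (he s hs'))).trans_eq (mul_one _))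
  · exact (norm_mul_le _ _).trans (mul_le_mul hA (h1 s hs') (norm_nonneg _) hB0')

end Dyson

/-! ### Ordered products, their expansion and their exponentials. -/

section Products

variable {N : ℕ}

lemma orderedSum_succ_succ {R : Type*} [Semiring R] (A : ℕ → R) (k m : ℕ) :
    orderedSum A (k + 1) (m + 1) = orderedSum A (k + 1) m + A m * orderedSum A k m := by
  simp only [orderedSum, Finset.sum_range_succ]

/-- Expanding the product selects a set of steps, in decreasing order from the left. Sums with more
factors than steps vanish, so any cutoff `L ≥ M` is allowed; the induction and the comparison with
an arbitrary truncation order use this freedom. -/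
lemma timeProd_one_add_smul (A : ℕ → Matrix (Fin N) (Fin N) ℂ) (z : ℂ) {M L : ℕ} (h : M ≤ L) :
    timeProd (fun m => 1 + z • A m) M = ∑ k ∈ Finset.range (L + 1), z ^ k • orderedSum A k M := by
  induction M generalizing L with
  | zero =>
    rw [timeProd, Finset.sum_range_succ', Finset.sum_eq_zero]
    · simp [orderedSum]
    · intro k _
      simp [orderedSum]
  | succ M ih =>
    obtain ⟨L, rfl⟩ : ∃ L', L = L' + 1 := ⟨L - 1, by omega⟩
    have h0 : ∀ m, orderedSum A 0 m = 1 := fun _ => rfl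
    rw [Finset.sum_range_succ', h0]
    simp_rw [orderedSum_succ_succ, smul_add, Finset.sum_add_distrib]
    have h1 : z • A M * timeProd (fun m => 1 + z • A m) M =
        ∑ k ∈ Finset.range (L + 1), z ^ (k + 1) • (A M * orderedSum A k M) := by
      rw [ih (L := L) (by omega), Finset.mul_sum]
      refine Finset.sum_congr rfl fun k _ => ?_
      rw [Matrix.smul_mul, Matrix.mul_smul, smul_smul, pow_succ']
    have h2 : timeProd (fun m => 1 + z • A m) M =
        ∑ k ∈ Finset.range (L + 1), z ^ (k + 1) • orderedSum A (k + 1) M + z ^ 0 • 1 := by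
      rw [ih (L := L + 1) (by omega), Finset.sum_range_succ', h0]
    rw [timeProd, Matrix.add_mul, Matrix.one_mul, h1, h2]
    abel

/-- There is one summand for each of the `m.choose k` increasing sequences of times; the induction
is Pascal's rule. -/
lemma norm_orderedSum_le {A : ℕ → Matrix (Fin N) (Fin N) ℂ} {α : ℝ} {m : ℕ}
    (hA : ∀ i < m, ‖A i‖ ≤ α) (k : ℕ) : ‖orderedSum A k m‖ ≤ α ^ k * m.choose k := by
  induction m generalizing k with
  | zero =>
    cases k with
    | zero => simpa [orderedSum] using norm_one_le
    | succ k => simp [orderedSum]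
  | succ m ih =>
    have ih' := fun k => ih (fun i hi => hA i (by omega)) k
    have hα : 0 ≤ α := (norm_nonneg _).trans (hA m m.lt_succ_self)
    cases k with
    | zero => simpa [orderedSum] using norm_one_le
    | succ k =>
      rw [orderedSum_succ_succ, Nat.choose_succ_succ]
      refine (norm_add_le _ _).trans ?_
      have h1 := (norm_mul_le (A m) (orderedSum A k m)).trans
        (mul_le_mul (hA m m.lt_succ_self) (ih' k) (norm_nonneg _) hα)
      have h2 := ih' (k + 1)
      push_cast
      rw [pow_succ] at *
      linarith

lemma norm_smul_orderedSum_le {A : ℕ → Matrix (Fin N) (Fin N) ℂ} {α : ℝ} (hα : 0 ≤ α) {m : ℕ}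
    (hA : ∀ i < m, ‖A i‖ ≤ α) (z : ℂ) (k : ℕ) :
    ‖z ^ k • orderedSum A k m‖ ≤ (‖z‖ * α * m) ^ k / k.factorial := by
  rw [norm_smul, norm_pow]
  have h1 := norm_orderedSum_le hA k
  have h2 : (m.choose k : ℝ) ≤ (m : ℝ) ^ k / k.factorial := Nat.choose_le_pow_div k m
  calc ‖z‖ ^ k * ‖orderedSum A k m‖ ≤ ‖z‖ ^ k * (α ^ k * ((m : ℝ) ^ k / k.factorial)) := by gcongr; exact h1.trans (by gcongr)
    _ = _ := by rw [mul_pow, mul_pow]; ring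

/-- The sum over `k` with the last term doubled is close to the product. -/
lemma norm_truncation_sub_le {A : ℕ → Matrix (Fin N) (Fin N) ℂ} {α : ℝ} (hα : 0 ≤ α) {M : ℕ}
    (hA : ∀ i < M, ‖A i‖ ≤ α) (z : ℂ) (hz : ‖z‖ * α * M ≤ 1 / 2) (K : ℕ) :
    ‖∑ k ∈ Finset.range (K + 1), (if k < K then (1 : ℂ) else 2) • (z ^ k • orderedSum A k M) -
      timeProd (fun m => 1 + z • A m) M‖ ≤ 3 / K.factorial := by
  set T : ℕ → Matrix (Fin N) (Fin N) ℂ := fun k => z ^ k • orderedSum A k M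
  have hβ0 : 0 ≤ ‖z‖ * α * M := by positivity
  have hT : ∀ k, ‖T (K + k)‖ ≤ (1 / 2) ^ k / K.factorial := by
    intro k
    refine (norm_smul_orderedSum_le hα hA z (K + k)).trans ?_
    have h1 : (‖z‖ * α * M) ^ (K + k) ≤ (1 / 2) ^ k := by
      refine (pow_le_pow_left₀ hβ0 hz _).trans ?_
      exact pow_le_pow_of_le_one (by norm_num) (by norm_num) (by omega)
    have h2 : (K.factorial : ℝ) ≤ (K + k).factorial := by
      exact_mod_cast Nat.factorial_le (by omega)
    gcongr
  have hs : timeProd (fun m => 1 + z • A m) M = ∑ k ∈ Finset.range K, T k +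
      ∑ k ∈ Finset.range (M + 1), T (K + k) := by
    rw [timeProd_one_add_smul A z (show M ≤ K + M by omega), add_assoc, Finset.sum_range_add]
  have hl : ∑ k ∈ Finset.range (K + 1), (if k < K then (1 : ℂ) else 2) • T k =
      ∑ k ∈ Finset.range K, T k + (2 : ℂ) • T K := by
    rw [Finset.sum_range_succ, if_neg (lt_irrefl K)]
    congr 1
    refine Finset.sum_congr rfl fun k hk => ?_
    rw [if_pos (Finset.mem_range.1 hk), one_smul]
  rw [hl, hs, Finset.sum_range_succ']
  -- Doubling the last term leaves one copy of `T K`, to be compared with the tail beyond order `K`.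
  have e : ∑ k ∈ Finset.range K, T k + (2 : ℂ) • T K - (∑ k ∈ Finset.range K, T k +
      (∑ k ∈ Finset.range M, T (K + (k + 1)) + T (K + 0))) =
      T (K + 0) - ∑ k ∈ Finset.range M, T (K + (k + 1)) := by
    rw [add_zero, two_smul]; abel
  rw [e]
  refine (norm_sub_le _ _).trans ?_
  have h3 : ‖∑ k ∈ Finset.range M, T (K + (k + 1))‖ ≤ 1 / K.factorial := by
    refine (norm_sum_le _ _).trans ((Finset.sum_le_sum fun k _ => hT (k + 1)).trans ?_)
    have h4 : ∀ k : ℕ, ((1 : ℝ) / 2) ^ (k + 1) / K.factorial =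
        (1 / K.factorial / 2) * (1 / 2) ^ k := by intro k; ring
    simp_rw [h4]
    rw [← Finset.mul_sum]
    have h5 : ∑ k ∈ Finset.range M, ((1 : ℝ) / 2) ^ k ≤ 2 := by
      refine (Summable.sum_le_tsum _ (fun _ _ => by positivity) summable_geometric_two).trans_eq ?_
      exact tsum_geometric_two
    have h6 : (0 : ℝ) ≤ 1 / K.factorial / 2 := by positivity
    nlinarith
  have h7 := hT 0
  rw [pow_zero] at h7
  have : (0 : ℝ) ≤ 1 / K.factorial := by positivity
  have h8 : (3 : ℝ) / K.factorial = 3 * (1 / K.factorial) := by ring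
  linarith

/-- The remainder is dominated term by term by the scalar series of `exp ‖X‖ - 1 - ‖X‖`. -/
lemma norm_exp_sub_le {X : Matrix (Fin N) (Fin N) ℂ} (hX : ‖X‖ ≤ 1) :
    ‖NormedSpace.exp X - (1 + X)‖ ≤ ‖X‖ ^ 2 := by
  set F : ℕ → Matrix (Fin N) (Fin N) ℂ := fun k => ((k.factorial : ℂ)⁻¹) • X ^ k
  have hs : Summable F := NormedSpace.expSeries_summable' (𝕂 := ℂ) X
  have h1 : NormedSpace.exp X - (1 + X) = ∑' k, F (k + 2) := by
    have h := hs.sum_add_tsum_nat_add 2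
    rw [NormedSpace.exp_eq_tsum ℂ]
    change (∑' k, F k) - _ = _
    rw [← h, Finset.sum_range_succ, Finset.sum_range_one]
    simp [F]
  have hr : Summable fun k : ℕ => ‖X‖ ^ k / k.factorial := Real.summable_pow_div_factorial _
  have h2 : ∑' k, ‖X‖ ^ (k + 2) / (k + 2).factorial = Real.exp ‖X‖ - 1 - ‖X‖ := by
    have h := hr.sum_add_tsum_nat_add 2
    rw [Real.exp_eq_exp_ℝ, NormedSpace.exp_eq_tsum_div]
    simp only [Finset.sum_range_succ, Finset.sum_range_zero] at h
    simp only [← h]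
    simp
    ring
  have h3 : ‖∑' k, F (k + 2)‖ ≤ ∑' k, ‖X‖ ^ (k + 2) / (k + 2).factorial := by
    refine tsum_of_norm_bounded ((summable_nat_add_iff 2).2 hr).hasSum fun k => ?_
    simp only [F]
    rw [norm_smul, norm_inv, Complex.norm_natCast, div_eq_inv_mul]
    gcongr
    exact norm_pow_le' X (by omega)
  rw [h1]
  refine h3.trans ?_
  rw [h2]
  have := Real.abs_exp_sub_one_sub_id_le (x := ‖X‖) (by rwa [abs_of_nonneg (norm_nonneg X)])
  exact (le_abs_self _).trans this

lemma exp_isometry {A : Matrix (Fin N) (Fin N) ℂ} (hA : A.IsHermitian) (δ : ℝ) :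
    (NormedSpace.exp ((-Complex.I * δ) • A))ᴴ * NormedSpace.exp ((-Complex.I * δ) • A) = 1 := by
  have h : ((-Complex.I * δ : ℂ) • A)ᴴ = -((-Complex.I * δ : ℂ) • A) := by
    rw [conjTranspose_smul, hA.eq, ← neg_smul]
    congr 1
    simp
  rw [← Matrix.exp_conjTranspose, h, ← Matrix.exp_add_of_commute _ _ 
      (Commute.refl ((-Complex.I * δ : ℂ) • A)).neg_left,
    neg_add_cancel, NormedSpace.exp_zero]

/-- Telescoping with the contractions `E` on the left and the factors `F` on the right; only the
latter can grow, by at most `(1 + x) ^ M`. -/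
lemma norm_timeProd_sub_le {E F : ℕ → Matrix (Fin N) (Fin N) ℂ} {x e : ℝ} {M : ℕ} (hx : 0 ≤ x)
    (he : 0 ≤ e) (hE : ∀ m < M, ‖E m‖ ≤ 1) (hF : ∀ m < M, ‖F m‖ ≤ 1 + x)
    (hEF : ∀ m < M, ‖E m - F m‖ ≤ e) :
    ‖timeProd E M - timeProd F M‖ ≤ M * e * Real.exp (x * M) := by
  have hFn : ∀ m ≤ M, ‖timeProd F m‖ ≤ Real.exp (x * M) := by
    have : ∀ m ≤ M, ‖timeProd F m‖ ≤ Real.exp (x * m) := by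
      intro m hm
      induction m with
      | zero => simpa [timeProd] using norm_one_le
      | succ m ih =>
        rw [timeProd]
        refine (norm_mul_le _ _).trans ((mul_le_mul ((hF m (by omega)).trans
          (by linarith [Real.add_one_le_exp x])) (ih (by omega)) (norm_nonneg _)
          (Real.exp_pos x).le).trans_eq ?_)
        rw [← Real.exp_add]
        congr 1
        push_cast
        ring
    intro m hm
    refine (this m hm).trans (Real.exp_le_exp.2 (mul_le_mul_of_nonneg_left ?_ hx))
    exact_mod_cast hm
  have key : ∀ m ≤ M, ‖timeProd E m - timeProd F m‖ ≤ m * (e * Real.exp (x * M)) := by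
    intro m hm
    induction m with
    | zero => simp [timeProd]
    | succ m ih =>
      have e1 : timeProd E (m + 1) - timeProd F (m + 1) = E m * (timeProd E m - timeProd F m) +
          (E m - F m) * timeProd F m := by
        rw [timeProd, timeProd, Matrix.mul_sub, Matrix.sub_mul]; abel
      rw [e1]
      refine (norm_add_le _ _).trans ?_
      have h1 := (norm_mul_le (E m) (timeProd E m - timeProd F m)).trans
        (mul_le_mul (hE m (by omega)) (ih (by omega)) (norm_nonneg _) zero_le_one)
      have h2 := (norm_mul_le (E m - F m) (timeProd F m)).trans
        (mul_le_mul (hEF m (by omega)) (hFn m (by omega)) (norm_nonneg _) he)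
      push_cast
      linarith
  refine (key M le_rfl).trans_eq (by ring)

lemma timeProd_add {R : Type*} [Monoid R] (U : ℕ → R) (a b : ℕ) :
    timeProd U (a + b) = timeProd (fun m => U (a + m)) b * timeProd U a := by
  induction b with
  | zero => simp [timeProd]
  | succ b ih => rw [← add_assoc, timeProd, timeProd, ih, mul_assoc]

lemma timeProd_mul {R : Type*} [Monoid R] (U : ℕ → R) (r M : ℕ) :
    timeProd (fun l => timeProd (fun m => U (l * M + m)) M) r = timeProd U (r * M) := by
  induction r with
  | zero => simp [timeProd]
  | succ r ih => rw [timeProd, ih, Nat.succ_mul, timeProd_add]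

end Products

/-! ### The spectral norm of sparse matrices. -/

section Schur

variable {N : ℕ}

/-- The Schur test for the spectral norm. -/
lemma norm_le_of_row_col_sum {A : Matrix (Fin N) (Fin N) ℂ} {R : ℝ} (hR : 0 ≤ R)
    (hrow : ∀ x, ∑ y, ‖A x y‖ ≤ R) (hcol : ∀ y, ∑ x, ‖A x y‖ ≤ R) : ‖A‖ ≤ R := by
  rw [l2_opNorm_def]
  refine ContinuousLinearMap.opNorm_le_bound _ hR fun v => ?_
  refine le_of_sq_le_sq ?_ (by positivity)
  rw [mul_pow, EuclideanSpace.norm_sq_eq, EuclideanSpace.norm_sq_eq]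
  have h1 : ∀ x, ‖∑ y, A x y * v y‖ ^ 2 ≤ R * ∑ y, ‖A x y‖ * ‖v y‖ ^ 2 := by
    intro x
    have h2 : ‖∑ y, A x y * v y‖ ≤ ∑ y, ‖A x y‖ * ‖v y‖ :=
      (norm_sum_le _ _).trans_eq (Finset.sum_congr rfl fun y _ => norm_mul _ _)
    have h3 := Finset.sum_sq_le_sum_mul_sum_of_sq_le_mul Finset.univ
      (r := fun y => ‖A x y‖ * ‖v y‖) (f := fun y => ‖A x y‖) (g := fun y => ‖A x y‖ * ‖v y‖ ^ 2)
      (fun y _ => norm_nonneg _) (fun y _ => by positivity) (fun y _ => by apply le_of_eq; ring)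
    refine (pow_le_pow_left₀ (norm_nonneg _) h2 2).trans (h3.trans ?_)
    exact mul_le_mul_of_nonneg_right (hrow x) (Finset.sum_nonneg fun y _ => by positivity)
  calc _ = ∑ x, ‖∑ y, A x y * v y‖ ^ 2 := rfl
    _ ≤ ∑ x, R * ∑ y, ‖A x y‖ * ‖v y‖ ^ 2 := Finset.sum_le_sum fun x _ => h1 x
    _ = R * ∑ y, (∑ x, ‖A x y‖) * ‖v y‖ ^ 2 := by
      rw [← Finset.mul_sum, Finset.sum_comm]
      simp_rw [Finset.sum_mul]
    _ ≤ R * ∑ y, R * ‖v y‖ ^ 2 := by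
      gcongr with y
      exact hcol y
    _ = _ := by rw [← Finset.mul_sum]; ring

/-- A pattern that contains each nonzero position together with its transpose limits the columns as
well as the rows, which the Schur test requires. -/
lemma norm_le_of_sparse {A : Matrix (Fin N) (Fin N) ℂ} {d : ℕ} {e : ℝ} (he : 0 ≤ e)
    (p : Fin N → Fin N → Prop) (hp : ∀ x, {y | p x y}.ncard ≤ d)
    (hA : ∀ x y, A x y ≠ 0 → p x y ∧ p y x) (hAe : ∀ x y, ‖A x y‖ ≤ e) : ‖A‖ ≤ d * e := by
  classical
  have key : ∀ (F : Fin N → Fin N → ℝ), (∀ x y, F x y ≠ 0 → p x y) → (∀ x y, F x y ≤ e) →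
      ∀ x, ∑ y, F x y ≤ d * e := by
    intro F h1 h2 x
    have hc : (Finset.univ.filter fun y => p x y).card ≤ d := by
      rw [← Set.ncard_coe_finset]
      simpa using hp x
    rw [← Finset.sum_filter_of_ne fun y _ => h1 x y]
    refine (Finset.sum_le_card_nsmul _ _ _ fun y _ => h2 x y).trans ?_
    rw [nsmul_eq_mul]
    gcongr
  refine norm_le_of_row_col_sum (by positivity) (key (fun x y => ‖A x y‖) (fun x y h => ?_) hAe)
    (key (fun y x => ‖A x y‖) (fun y x h => ?_) fun y x => hAe x y)
  · exact (hA x y (norm_ne_zero_iff.1 h)).1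
  · exact (hA x y (norm_ne_zero_iff.1 h)).2

end Schur

/-! ### Sampling a differentiable sparse Hamiltonian. -/

section Hamiltonian

variable {N d : ℕ} {t hmax rate : ℝ} {H : ℝ → Matrix (Fin N) (Fin N) ℂ}

lemma IsSparseHamiltonian.norm_apply_le (h : IsSparseHamiltonian d t hmax rate H) {s : ℝ}
    (hs : s ∈ Set.Icc 0 t) (hm : 0 ≤ hmax) : ‖H s‖ ≤ d * hmax := by
  have hsym : ∀ x y, H s x y ≠ 0 → H s y x ≠ 0 := fun x y hxy h0 => hxy <| by
    rw [← (h.hermitian s hs).apply x y, h0, star_zero]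
  exact norm_le_of_sparse hm (fun x y => H s x y ≠ 0) (h.sparse s hs)
    (fun x y hxy => ⟨hxy, hsym x y hxy⟩) (h.entry_le s hs)

/-- The evolution depends only on the Hamiltonian in `[0, t]`, which extends continuously. -/
lemma IsSparseHamiltonian.exists_extension (h : IsSparseHamiltonian d t hmax rate H) (ht : 0 ≤ t)
    (hm : 0 ≤ hmax) : ∃ H' : ℝ → Matrix (Fin N) (Fin N) ℂ, Continuous H' ∧
      (∀ s, ‖H' s‖ ≤ d * hmax) ∧ (∀ s, (H' s).IsHermitian) ∧ (∀ s ∈ Set.Icc 0 t, H s = H' s) ∧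
      timeOrderedExp H t = timeOrderedExp H' t := by
  have heq : ∀ s ∈ Set.Icc 0 t, H s =
      Set.IccExtend ht (Set.domRestrict (Set.Icc 0 t) H) s := fun s hs => by
    rw [Set.IccExtend_of_mem _ _ hs, Set.domRestrict_apply]
  refine ⟨Set.IccExtend ht (Set.domRestrict (Set.Icc 0 t) H),
    (continuousOn_iff_continuous_domRestrict.1 h.differentiable.continuousOn).Icc_extend',
    fun s => h.norm_apply_le (Set.projIcc 0 t ht s).2 hm,
    fun s => h.hermitian _ (Set.projIcc 0 t ht s).2, heq, tsum_congr fun k => ?_⟩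
  rw [dysonTerm_congr heq k t ⟨ht, le_rfl⟩]

lemma IsSparseHamiltonian.timeOrderedExp_isometry (h : IsSparseHamiltonian d t hmax rate H)
    (ht : 0 ≤ t) (hm : 0 ≤ hmax) : (timeOrderedExp H t)ᴴ * timeOrderedExp H t = 1 := by
  obtain ⟨H', hc, hB, hh, -, e⟩ := h.exists_extension ht hm
  rw [e]
  exact SparseSim.timeOrderedExp_isometry hc hB hh t

lemma IsSparseHamiltonian.norm_sub_apply_le (h : IsSparseHamiltonian d t hmax rate H) {a b : ℝ}
    (ha : 0 ≤ a) (hab : a ≤ b) (hb : b ≤ t) :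
    ‖H b - H a‖ ≤ ∫ s in a..b, ‖derivWithin H (Set.Icc 0 t) s‖ := by
  have hsub : Set.Icc a b ⊆ Set.Icc 0 t := Set.Icc_subset_Icc ha hb
  have hd : ∀ s ∈ Set.Ioo a b, HasDerivAt H (derivWithin H (Set.Icc 0 t) s) s := by
    intro s hs
    have hn : Set.Icc 0 t ∈ nhds s := Icc_mem_nhds (ha.trans_lt hs.1) (hs.2.trans_le hb)
    exact ((h.differentiable s (hsub (Set.Ioo_subset_Icc_self hs))).hasDerivWithinAt).hasDerivAt hn
  have hint : IntervalIntegrable (derivWithin H (Set.Icc 0 t)) MeasureTheory.volume a b := by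
    have h1 : IntervalIntegrable (fun s => ‖derivWithin H (Set.Icc 0 t) s‖)
        MeasureTheory.volume a b := h.integrable.mono_set (by
      rw [Set.uIcc_of_le hab, Set.uIcc_of_le (ha.trans (hab.trans hb))]; exact hsub)
    rw [intervalIntegrable_iff, Set.uIoc_of_le hab,
      integrableOn_Ioc_iff_integrableOn_Ioo] at h1 ⊢
    -- Only the norm of the derivative is known to be integrable. The derivative itself is
    -- measurable because it agrees with `deriv H` inside the interval.
    refine (MeasureTheory.integrable_norm_iff ?_).1 h1
    refine ((stronglyMeasurable_deriv H).aestronglyMeasurable).congr ?_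
    filter_upwards [MeasureTheory.ae_restrict_mem measurableSet_Ioo] with s hs
    exact (hd s hs).deriv
  rw [← intervalIntegral.integral_eq_sub_of_hasDerivAt_of_le hab
    (h.differentiable.continuousOn.mono hsub) hd hint]
  exact intervalIntegral.norm_integral_le_integral_norm hab

/-- The error of replacing the evolution by short exponentials of approximate samples. -/
lemma IsSparseHamiltonian.norm_timeProd_exp_sub_le (h : IsSparseHamiltonian d t hmax rate H)
    (ht : 0 < t) (hm : 0 ≤ hmax) {nt : ℕ} {A : ℕ → Matrix (Fin N) (Fin N) ℂ} {B' e : ℝ}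
    (hherm : ∀ m < 2 ^ nt, (A m).IsHermitian) (hA : ∀ m < 2 ^ nt, ‖A m‖ ≤ B')
    (he : ∀ m < 2 ^ nt, ‖A m - H (gridTime nt t m)‖ ≤ e) (hδ : t / 2 ^ nt * B' ≤ 1) :
    ‖timeProd (fun m => NormedSpace.exp ((-Complex.I * (t / 2 ^ nt : ℝ)) • A m)) (2 ^ nt) -
        timeOrderedExp H t‖ ≤
      t * e + t / 2 ^ nt * t * (B' ^ 2 + B' * (d * hmax) + rate) := by
  set δ : ℝ := t / 2 ^ nt with hδd
  have hδ0 : 0 < δ := by positivity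
  set G : ℝ → ℝ := fun s => ‖derivWithin H (Set.Icc 0 t) s‖ with hG
  set E : ℕ → Matrix (Fin N) (Fin N) ℂ := fun m => NormedSpace.exp ((-Complex.I * (δ : ℝ)) • A m)
    with hE
  obtain ⟨H', hc, hB, hh, heq, hUt⟩ := h.exists_extension ht.le hm
  have hgrid : ∀ m : ℕ, gridTime nt t m = m * δ := fun m => by rw [gridTime, hδd]; ring
  have hNt : ((2 ^ nt : ℕ) : ℝ) * δ = t := by rw [hδd]; push_cast; field_simp
  have hint : ∀ a b : ℝ, 0 ≤ a → a ≤ b → b ≤ t → IntervalIntegrable G MeasureTheory.volume a b :=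
    fun a b ha hab hb => h.integrable.mono_set (by
      rw [Set.uIcc_of_le hab, Set.uIcc_of_le ht.le]; exact Set.Icc_subset_Icc ha hb)
  have hB0 : 0 ≤ B' := (norm_nonneg _).trans (hA 0 (by positivity))
  -- Each step contributes its sampling error, errors of second order in `δ`, and `δ` times its own
  -- share of the integral of the rate of change; the shares add up to the full integral.
  have key : ∀ m : ℕ, m ≤ 2 ^ nt → ‖timeProd E m - timeOrderedExp H' (m * δ)‖ ≤
      m * (δ * e + δ ^ 2 * (B' ^ 2 + B' * (d * hmax))) + δ * ∫ s in (0 : ℝ)..(m * δ), G s := by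
    intro m hmn
    induction m with
    | zero => simp [timeProd, timeOrderedExp_zero]
    | succ m ih =>
      have hm' : m < 2 ^ nt := by omega
      have ha : 0 ≤ (m : ℝ) * δ := by positivity
      have hb : ((m + 1 : ℕ) : ℝ) * δ ≤ t := by
        rw [← hNt]
        have : ((m + 1 : ℕ) : ℝ) ≤ ((2 ^ nt : ℕ) : ℝ) := by exact_mod_cast hmn
        gcongr
      have hab : (m : ℝ) * δ ≤ (m + 1 : ℕ) * δ := by push_cast; nlinarith
      have hba : ((m + 1 : ℕ) : ℝ) * δ - m * δ = δ := by push_cast; ring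
      set I : ℝ := ∫ s in (m * δ)..((m + 1 : ℕ) * δ), G s with hI
      have h1 : ∀ s ∈ Set.Icc ((m : ℝ) * δ) ((m + 1 : ℕ) * δ), ‖H' s - A m‖ ≤ I + e := by
        intro s hs
        have h2 := h.norm_sub_apply_le ha hs.1 (hs.2.trans hb)
        have h3 := he m hm'
        rw [hgrid] at h3
        have h4 : ∫ s in (m * δ)..s, G s ≤ I := by
          refine intervalIntegral.integral_mono_interval le_rfl hs.1 hs.2
            (Filter.Eventually.of_forall fun s => norm_nonneg _) (hint _ _ ha hab hb)
        rw [← heq s ⟨ha.trans hs.1, hs.2.trans hb⟩]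
        have e1 : H s - A m = (H s - H (m * δ)) - (A m - H (m * δ)) := by abel
        rw [e1]
        refine (norm_sub_le _ _).trans ?_
        linarith
      have h5 := norm_timeOrderedExp_step_le hc hB hh hab (A m) (hA m hm') h1
      rw [hba] at h5
      have hnX : ‖(-Complex.I * (δ : ℝ)) • A m‖ ≤ δ * B' := by
        rw [norm_smul, norm_mul, norm_neg, Complex.norm_I, one_mul, Complex.norm_real,
          Real.norm_of_nonneg hδ0.le]
        exact mul_le_mul_of_nonneg_left (hA m hm') hδ0.le
      have h6 : ‖E m - (1 + (-Complex.I * (δ : ℝ)) • A m)‖ ≤ (δ * B') ^ 2 :=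
        (norm_exp_sub_le (hnX.trans hδ)).trans (pow_le_pow_left₀ (norm_nonneg _) hnX 2)
      have hU := norm_le_one_of_isometry (SparseSim.timeOrderedExp_isometry hc hB hh (m * δ))
      have hE1 : ‖E m‖ ≤ 1 := norm_le_one_of_isometry (exp_isometry (hherm m hm') δ)
      have e2 : timeProd E (m + 1) - timeOrderedExp H' ((m + 1 : ℕ) * δ) =
          E m * (timeProd E m - timeOrderedExp H' (m * δ)) +
          (E m - (1 + (-Complex.I * (δ : ℝ)) • A m)) * timeOrderedExp H' (m * δ) -
          (timeOrderedExp H' ((m + 1 : ℕ) * δ) -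
            (1 + (-Complex.I * (δ : ℝ)) • A m) * timeOrderedExp H' (m * δ)) := by
        rw [timeProd, Matrix.mul_sub, Matrix.sub_mul]; abel
      rw [e2]
      refine (norm_sub_le _ _).trans ((add_le_add_left (norm_add_le _ _) _).trans ?_)
      have h7 := (norm_mul_le (E m) (timeProd E m - timeOrderedExp H' (m * δ))).trans
        (mul_le_mul hE1 (ih (by omega)) (norm_nonneg _) zero_le_one)
      have h8 := (norm_mul_le (E m - (1 + (-Complex.I * (δ : ℝ)) • A m))
        (timeOrderedExp H' (m * δ))).trans
        (mul_le_mul h6 hU (norm_nonneg _) (by positivity))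
      have h9 : ∫ s in (0 : ℝ)..((m + 1 : ℕ) * δ), G s = (∫ s in (0 : ℝ)..(m * δ), G s) + I :=
        (intervalIntegral.integral_add_adjacent_intervals (hint _ _ le_rfl ha (hab.trans hb))
          (hint _ _ ha hab hb)).symm
      rw [h9]
      push_cast at *
      nlinarith
  have hk := key (2 ^ nt) le_rfl
  rw [hNt, ← hUt] at hk
  have hr := h.avgRate_le
  rw [avgRate, one_div, inv_mul_le_iff₀ ht] at hr
  refine hk.trans ?_
  have h10 : δ * ∫ s in (0 : ℝ)..t, G s ≤ δ * (t * rate) := mul_le_mul_of_nonneg_left hr hδ0.le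
  have h11 : ((2 ^ nt : ℕ) : ℝ) * (δ * e + δ ^ 2 * (B' ^ 2 + B' * (d * hmax))) =
      (((2 ^ nt : ℕ) : ℝ) * δ) * (e + δ * (B' ^ 2 + B' * (d * hmax))) := by ring
  rw [h11, hNt]
  nlinarith

end Hamiltonian

/-! ### Low-order digits of two's-complement integers. -/

section TwosComplement

lemma bitsToInt_add_eq_bv {n : ℕ} (b : Fin (n + 1) → Bool) :
    bitsToInt b + (if b (Fin.last n) then 2 ^ (n + 1) else 0) = bv b := by
  have h : ∀ i : Fin n, (i : ℕ) ≠ n := fun i => i.2.ne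
  simp only [bv, bitsToInt, Fin.sum_univ_castSucc,
    Fin.val_castSucc, Fin.val_last, Nat.add_right_cancel_iff, h, if_false, if_true]
  cases b (Fin.last n) <;> simp [pow_succ]; ring

lemma bitsToInt_modEq_bv {n : ℕ} (b : Fin n → Bool) : bitsToInt b ≡ bv b [ZMOD 2 ^ n] := by
  cases n with
  | zero => simp [bitsToInt, bv, Int.ModEq.refl]
  | succ n =>
    rw [← bitsToInt_add_eq_bv b]
    refine Int.modEq_iff_dvd.2 ?_
    rw [add_sub_cancel_left]
    split_ifs <;> simp

lemma bitsToInt_bounds {k : ℕ} (hk : 0 < k) (b : Fin k → Bool) :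
    -2 ^ (k - 1) ≤ bitsToInt b ∧ bitsToInt b < 2 ^ (k - 1) := by
  have h := bv_flipTop hk b
  have h2 := bv_lt (flipTop b)
  have h3 : (2 : ℤ) ^ k = 2 * 2 ^ (k - 1) := by
    rw [← pow_succ', Nat.sub_add_cancel hk]
  have h4 : (bv (flipTop b) : ℤ) < 2 ^ k := by exact_mod_cast h2
  constructor <;> omega

variable {P : Params}

/-- The two integers are congruent modulo `2 ^ k` and lie in the same half-open interval of that
length. -/
lemma lowInt_eq_bitsToInt (hk : P.k ≤ P.np) (hk0 : 0 < P.k) (b : Fin P.np → Bool)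
    (h : |bitsToInt b| < 2 ^ (P.k - 1) ∨ P.k = P.np) : lowInt hk b = bitsToInt b := by
  have h1 : lowInt hk b ≡ bitsToInt b [ZMOD 2 ^ P.k] := by
    have h2 : (fun i : Fin P.k => b (i.castLE hk)) = natBits P.k (bv b) := by
      ext i
      exact (congrFun (natBits_bv b) (i.castLE hk)).symm
    have h3 := bitsToInt_modEq_bv fun i : Fin P.k => b (i.castLE hk)
    rw [h2, bv_natBits, ← h2] at h3
    refine h3.trans ?_
    have h4 : (bitsToInt b) ≡ bv b [ZMOD 2 ^ P.k] :=
      (bitsToInt_modEq_bv b).of_dvd (pow_dvd_pow 2 hk)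
    refine Int.ModEq.trans ?_ h4.symm
    push_cast
    exact Int.mod_modEq _ _
  have h5 := bitsToInt_bounds hk0 fun i : Fin P.k => b (i.castLE hk)
  have h6 : -2 ^ (P.k - 1) ≤ bitsToInt b ∧ bitsToInt b < 2 ^ (P.k - 1) := by
    rcases h with h | h
    · exact ⟨(abs_lt.1 h).1.le, (abs_lt.1 h).2⟩
    · have := bitsToInt_bounds (h ▸ hk0 : 0 < P.np) b
      have e : (2 : ℤ) ^ (P.k - 1) = 2 ^ (P.np - 1) := by rw [h]
      rwa [e]
  have h7 : (2 : ℤ) ^ P.k = 2 * 2 ^ (P.k - 1) := by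
    rw [← pow_succ', Nat.sub_add_cancel hk0]
  change -2 ^ (P.k - 1) ≤ lowInt hk b ∧ lowInt hk b < 2 ^ (P.k - 1) at h5
  obtain ⟨q, hq⟩ := Int.modEq_iff_dvd.1 h1
  rw [h7] at hq
  have hp : (0 : ℤ) < 2 ^ (P.k - 1) := by positivity
  have hq0 : q = 0 := by
    have : q < 1 := by by_contra! hc; nlinarith
    have : -1 < q := by by_contra! hc; nlinarith
    omega
  rw [hq0] at hq
  linarith

lemma abs_re_im_le {unit B : ℝ} (hu : 0 < unit) {a b : ℤ}
    (h : ‖(unit : ℂ) * ((a : ℂ) + (b : ℂ) * Complex.I)‖ ≤ B) :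
    unit * |(a : ℝ)| ≤ B ∧ unit * |(b : ℝ)| ≤ B := by
  rw [norm_mul, Complex.norm_real, Real.norm_of_nonneg hu.le] at h
  have h1 := Complex.abs_re_le_norm ((a : ℂ) + (b : ℂ) * Complex.I)
  have h2 := Complex.abs_im_le_norm ((a : ℂ) + (b : ℂ) * Complex.I)
  simp at h1 h2
  exact ⟨(mul_le_mul_of_nonneg_left h1 hu.le).trans h, (mul_le_mul_of_nonneg_left h2 hu.le).trans h⟩

end TwosComplement

/-! ### The matrices that the oracles determine. -/

section OracleData

variable {P : Params} {t hmax rate unit δ : ℝ} {H : ℝ → Matrix (Fin P.N) (Fin P.N) ℂ}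

lemma exists_valData {OH : unitaryGroup (HWire (P.n + P.p) P.N P.np → Bool) ℂ}
    (h : IsValueOracle (P.n + P.p) P.np unit t δ H OH.1) :
    ∃ vre vim, ValData OH.1 vre vim ∧ ∀ m x y,
      ‖(unit : ℂ) * ((bitsToInt (vre m x y) : ℂ) + (bitsToInt (vim m x y) : ℂ) * Complex.I)
          - H (gridTime (P.n + P.p) t (bv m)) x y‖ ≤ δ := by
  choose vre vim h1 h2 using fun m : Fin (P.n + P.p) → Bool => h (bv m) (bv_lt m)
  refine ⟨vre, vim, ⟨OH.2, fun m x y => ?_⟩, h2⟩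
  have := h1 m x y
  rwa [hState, hState, natBits_bv] at this

lemma exists_posData {Of : unitaryGroup (FWire (P.n + P.p) P.N → Bool) ℂ}
    (h : IsPositionOracle (P.n + P.p) P.d t H Of.1) :
    ∃ f, PosData Of.1 f ∧ ∀ m x y,
      H (gridTime (P.n + P.p) t (bv m)) x y ≠ 0 → listed f m x y := by
  choose f h1 h2 h3 using fun m : Fin (P.n + P.p) → Bool => h (bv m) (bv_lt m)
  refine ⟨f, ⟨Of.2, h1, fun m x j => ?_⟩, h2⟩
  have := h3 m x j
  rwa [fState, fState, natBits_bv] at this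

variable {vre vim : (Fin (P.n + P.p) → Bool) → Fin P.N → Fin P.N → Fin P.np → Bool}
  {f : (Fin (P.n + P.p) → Bool) → Fin P.N → Fin P.d → Fin P.N} (hk : P.k ≤ P.np)

lemma oracleMatrix_isHermitian (m : Fin (P.n + P.p) → Bool) :
    (oracleMatrix hk vre vim f m).IsHermitian := by
  ext x y
  by_cases h : listed f m x y ∧ listed f m y x
  · simp [oracleMatrix, h, add_comm]
  · have h' : ¬(listed f m y x ∧ listed f m x y) := fun h' => h h'.symm
    simp [oracleMatrix, h, h']

lemma gridTime_mem {nt m : ℕ} (ht : 0 ≤ t) (hm : m < 2 ^ nt) :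
    gridTime nt t m ∈ Set.Icc 0 t := by
  have : (m : ℝ) ≤ 2 ^ nt := by exact_mod_cast hm.le
  refine ⟨by unfold gridTime; positivity, ?_⟩
  rw [gridTime, div_le_iff₀ (by positivity), mul_comm t]
  gcongr

/-- The oracles determine the Hamiltonian at the sampled times up to their precision. -/
lemma norm_oracleMatrix_sub_le (h : IsSparseHamiltonian P.d t hmax rate H) (ht : 0 ≤ t)
    (hk0 : 0 < P.k) (hu : 0 < unit) (hδ : 0 ≤ δ)
    (hfit : hmax + δ < unit * 2 ^ (P.k - 1) ∨ P.k = P.np)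
    (m : Fin (P.n + P.p) → Bool)
    (hv : ∀ x y,
      ‖(unit : ℂ) * ((bitsToInt (vre m x y) : ℂ) + (bitsToInt (vim m x y) : ℂ) * Complex.I)
          - H (gridTime (P.n + P.p) t (bv m)) x y‖ ≤ δ)
    (hl : ∀ x y, H (gridTime (P.n + P.p) t (bv m)) x y ≠ 0 → listed f m x y) :
    ‖(unit : ℂ) • oracleMatrix hk vre vim f m - H (gridTime (P.n + P.p) t (bv m))‖ ≤ P.d * δ := by
  have hs := gridTime_mem ht (bv_lt m)
  set s := gridTime (P.n + P.p) t (bv m)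
  have hsym : ∀ x y, star (H s x y) = H s y x := fun x y => (h.hermitian s hs).apply y x
  have hlow : ∀ x y, lowVal hk (vre m x y) (vim m x y) =
      (bitsToInt (vre m x y) : ℂ) + (bitsToInt (vim m x y) : ℂ) * Complex.I := by
    intro x y
    have h1 : ‖(unit : ℂ) * ((bitsToInt (vre m x y) : ℂ) +
        (bitsToInt (vim m x y) : ℂ) * Complex.I)‖ ≤ hmax + δ := by
      have h2 := norm_add_le (H s x y) ((unit : ℂ) * ((bitsToInt (vre m x y) : ℂ) +
        (bitsToInt (vim m x y) : ℂ) * Complex.I) - H s x y)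
      rw [add_sub_cancel] at h2
      linarith [hv x y, h.entry_le s hs x y]
    obtain ⟨h3, h4⟩ := abs_re_im_le hu h1
    have key : ∀ b : Fin P.np → Bool, unit * |(bitsToInt b : ℝ)| ≤ hmax + δ →
        lowInt hk b = bitsToInt b := by
      intro b hb
      refine lowInt_eq_bitsToInt hk hk0 b (hfit.imp_left fun hf => ?_)
      have := lt_of_mul_lt_mul_left (hb.trans_lt hf) hu.le
      exact_mod_cast this
    rw [lowVal, key _ h3, key _ h4]
  refine norm_le_of_sparse (hδ) (listed f m) (fun x => ?_) (fun x y hxy => ?_) fun x y => ?_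
  · have : {y | listed f m x y} = Set.range (f m x) := rfl
    rw [this, ← Set.image_univ]
    refine (Set.ncard_image_le).trans ?_
    simp
  · by_contra hc
    refine hxy ?_
    rw [Matrix.sub_apply, Matrix.smul_apply, oracleMatrix, if_neg fun h' => hc ⟨h'.2, h'.1⟩, smul_zero, zero_sub, neg_eq_zero]
    by_contra h0
    refine hc ⟨hl x y h0, hl y x fun h1 => h0 ?_⟩
    rw [← hsym, h1, star_zero]
  · by_cases hc : listed f m y x ∧ listed f m x y
    · have e : ((unit : ℂ) • oracleMatrix hk vre vim f m - H s) x y =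
          (((unit : ℂ) * ((bitsToInt (vre m x y) : ℂ) + (bitsToInt (vim m x y) : ℂ) * Complex.I) -
            H s x y) + star ((unit : ℂ) * ((bitsToInt (vre m y x) : ℂ) +
            (bitsToInt (vim m y x) : ℂ) * Complex.I) - H s y x)) / 2 := by
        rw [Matrix.sub_apply, Matrix.smul_apply, oracleMatrix, if_pos hc, hlow, hlow, star_sub, hsym, star_mul', smul_eq_mul]
        have : star (unit : ℂ) = unit := Complex.conj_ofReal _
        rw [this]
        ring
      rw [e, norm_div]
      have h1 := norm_add_le ((unit : ℂ) * ((bitsToInt (vre m x y) : ℂ) +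
        (bitsToInt (vim m x y) : ℂ) * Complex.I) - H s x y) (star ((unit : ℂ) *
        ((bitsToInt (vre m y x) : ℂ) + (bitsToInt (vim m y x) : ℂ) * Complex.I) - H s y x))
      rw [norm_star] at h1
      have h2 : ‖(2 : ℂ)‖ = 2 := by simp
      rw [h2]
      linarith [hv x y, hv y x]
    -- Each row lists its nonzero entries and `H s` is Hermitian, so a position not listed by both
    -- rows carries a zero entry.
    · have h0 : H s x y = 0 := by
        by_contra h0
        refine hc ⟨hl y x fun h1 => h0 ?_, hl x y h0⟩
        rw [← hsym, h1, star_zero]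
      rw [Matrix.sub_apply, Matrix.smul_apply, oracleMatrix, if_neg hc, h0, smul_zero, sub_zero, norm_zero]
      exact hδ

/-- If all encoded values vanish, the Hamiltonian is negligible at the sampled times. -/
lemma norm_apply_gridTime_le {N d np nt : ℕ} {H : ℝ → Matrix (Fin N) (Fin N) ℂ}
    (h : IsSparseHamiltonian d t hmax rate H) (ht : 0 ≤ t) (hu : 0 < unit) (hδ : 0 ≤ δ)
    (hfit : hmax + δ < unit ∨ np = 0) {OH : QOp (HWire nt N np)}
    (hO : IsValueOracle nt np unit t δ H OH) {m : ℕ} (hm : m < 2 ^ nt) :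
    ‖H (gridTime nt t m)‖ ≤ d * δ := by
  have hs := gridTime_mem ht hm
  set s := gridTime nt t m
  have he : ∀ x y, ‖H s x y‖ ≤ δ := by
    intro x y
    obtain ⟨re, im, -, h1⟩ := hO m hm x y
    have h2 : ‖(unit : ℂ) * ((bitsToInt re : ℂ) + (bitsToInt im : ℂ) * Complex.I)‖ ≤ hmax + δ := by
      have h2 := norm_add_le (H s x y) ((unit : ℂ) * ((bitsToInt re : ℂ) +
        (bitsToInt im : ℂ) * Complex.I) - H s x y)
      rw [add_sub_cancel] at h2
      linarith [h.entry_le s hs x y]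
    obtain ⟨h3, h4⟩ := abs_re_im_le hu h2
    have key : ∀ b : Fin np → Bool, unit * |(bitsToInt b : ℝ)| ≤ hmax + δ → bitsToInt b = 0 := by
      intro b hb
      -- A multiple of `unit` smaller than `unit` is zero, and without digits only zero can be
      -- encoded.
      rcases hfit with hf | rfl
      · have : |(bitsToInt b : ℝ)| < 1 := by
          refine lt_of_mul_lt_mul_left ((hb.trans_lt hf).trans_eq (mul_one _).symm) hu.le
        exact Int.abs_lt_one_iff.1 (by exact_mod_cast this)
      · simp [bitsToInt]
    rw [key _ h3, key _ h4] at h1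
    simpa using h1
  have hsym : ∀ x y, H s x y ≠ 0 → H s y x ≠ 0 := fun x y hxy h0 => hxy <| by
    rw [← (h.hermitian s hs).apply x y, h0, star_zero]
  exact norm_le_of_sparse hδ (fun x y => H s x y ≠ 0) (h.sparse s hs)
    (fun x y hxy => ⟨hxy, hsym x y hxy⟩) he

end OracleData

/-! ### The error of the simulation. -/

section Simulation

lemma natBits_append {n p l m : ℕ} (hm : m < 2 ^ n) :
    Fin.append (natBits n m) (natBits p l) = natBits (n + p) (l * 2 ^ n + m) := by
  ext j
  rw [mul_comm]
  refine Fin.addCases (fun i => ?_) (fun i => ?_) j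
  · simp [natBits, Nat.testBit_two_pow_mul_add l hm, i.2]
  · simp [natBits, Nat.testBit_two_pow_mul_add l hm]

lemma timeProd_congr {R : Type*} [Monoid R] {U V : ℕ → R} {r : ℕ} (h : ∀ l < r, U l = V l) :
    timeProd U r = timeProd V r := by
  induction r with
  | zero => rfl
  | succ r ih => rw [timeProd, timeProd, h r r.lt_succ_self, ih fun l hl => h l (by omega)]

lemma timeProd_one {R : Type*} [Monoid R] (r : ℕ) : timeProd (fun _ => (1 : R)) r = 1 := by
  induction r with
  | zero => rfl
  | succ r ih => rw [timeProd, ih, mul_one]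

variable {P : Params} {K : ℕ} {hkd : P.kd ≤ indexQubits P.N} {hk : P.k ≤ P.np}
  {Ra : Matrix Bool Bool ℂ} {OH : QOp (HWire (P.n + P.p) P.N P.np)} {Of : QOp (FWire (P.n + P.p) P.N)}
  {vre vim : (Fin (P.n + P.p) → Bool) → Fin P.N → Fin P.N → Fin P.np → Bool}
  {f : (Fin (P.n + P.p) → Bool) → Fin P.N → Fin P.d → Fin P.N}

/-- The factor `2` in `hz` yields `2 ^ k` in order `k`. Against the weight `2 ^ -(k + 1)` this
leaves `1 / 2` in every order, except in the last, where the weight `2 ^ -K` leaves `1`. -/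
lemma blk_opW_eq (hd : 0 < P.d) (hdN : P.d ≤ P.N) (hdk : P.d ≤ 2 ^ P.kd) (hk0 : 0 < P.k)
    (hV : ValData OH vre vim) (hF : PosData Of f) {z : ℂ}
    (hz : Ra false false * (2 ^ (P.kd + P.k))⁻¹ = 2 * 2 ^ P.n * z) (l : ℕ) :
    (2 : ℂ) • blk (sst K) (opW (K := K) hkd hk Ra OH Of l) =
      ∑ k ∈ Finset.range (K + 1), (if k < K then (1 : ℂ) else 2) •
        (z ^ k • orderedSum (segMatrix hk vre vim f l) k (2 ^ P.n)) := by
  ext x' x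
  rw [Matrix.smul_apply, blk, submatrix_apply, opW_apply hd hdN hdk hk0 hV hF hz, smul_eq_mul,
    Finset.mul_sum, Matrix.sum_apply]
  refine Finset.sum_congr rfl fun k hkK => ?_
  have h2 : (2 : ℂ) * 2 ^ P.n * z / 2 ^ P.n = 2 * z := by field_simp
  rw [Matrix.smul_apply, Matrix.smul_apply, smul_eq_mul, smul_eq_mul, h2, mul_pow]
  split_ifs with h
  · rw [pow_succ]; field_simp
  · have : k = K := by have := Finset.mem_range.1 hkK; omega
    subst this
    field_simp

/-- The error of a segment: truncation of the series, and the exponentials in place of the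
linear factors. -/
lemma norm_blk_opW_sub_le (hd : 0 < P.d) (hdN : P.d ≤ P.N) (hdk : P.d ≤ 2 ^ P.kd) (hk0 : 0 < P.k)
    (hV : ValData OH vre vim) (hF : PosData Of f) {unit δ B : ℝ} (hδ : 0 ≤ δ) (hu : 0 < unit)
    (hz : Ra false false * (2 ^ (P.kd + P.k))⁻¹ = 2 * 2 ^ P.n * (-Complex.I * δ * unit)) {l : ℕ}
    (hB : ∀ m, ‖(unit : ℂ) • oracleMatrix hk vre vim f m‖ ≤ B) (hBδ : 2 ^ P.n * (δ * B) ≤ 1 / 2) :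
    ‖(2 : ℂ) • blk (sst K) (opW (K := K) hkd hk Ra OH Of l) - timeProd (fun m =>
      NormedSpace.exp ((-Complex.I * δ) • ((unit : ℂ) • segMatrix hk vre vim f l m))) (2 ^ P.n)‖ ≤
      3 / K.factorial + 2 * 2 ^ P.n * (δ * B) ^ 2 := by
  have hB0 : 0 ≤ B := (norm_nonneg _).trans (hB fun _ => false)
  have hseg : ∀ m, ‖segMatrix hk vre vim f l m‖ ≤ B / unit := by
    intro m
    have := hB (Fin.append (natBits P.n m) (natBits P.p l))
    rw [norm_smul, Complex.norm_real, Real.norm_of_nonneg hu.le] at this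
    rw [le_div_iff₀ hu, mul_comm]
    exact this
  have hnz : ‖(-Complex.I * δ * unit : ℂ)‖ = δ * unit := by
    rw [norm_mul, norm_mul, norm_neg, Complex.norm_I, one_mul, Complex.norm_real,
      Complex.norm_real, Real.norm_of_nonneg hδ, Real.norm_of_nonneg hu.le]
  have e1 : δ * unit * (B / unit) = δ * B := by field_simp
  have h1 := norm_truncation_sub_le (A := segMatrix hk vre vim f l) (M := 2 ^ P.n)
    (div_nonneg hB0 hu.le) (fun m _ => hseg m) (-Complex.I * δ * unit) (by
      rw [hnz, e1, mul_comm]; push_cast; exact hBδ) K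
  rw [← blk_opW_eq (hkd := hkd) hd hdN hdk hk0 hV hF hz] at h1
  have hn : ∀ m, ‖(-Complex.I * δ : ℂ) • ((unit : ℂ) • segMatrix hk vre vim f l m)‖ ≤ δ * B := by
    intro m
    rw [norm_smul, norm_mul, norm_neg, Complex.norm_I, one_mul, Complex.norm_real,
      Real.norm_of_nonneg hδ]
    exact mul_le_mul_of_nonneg_left (hB _) hδ
  have hone : δ * B ≤ 1 := by
    have : (1 : ℝ) ≤ 2 ^ P.n := one_le_pow₀ (by norm_num)
    nlinarith [mul_nonneg hδ hB0]
  have h2 := norm_timeProd_sub_le (M := 2 ^ P.n) (x := δ * B) (e := (δ * B) ^ 2)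
    (E := fun m => NormedSpace.exp ((-Complex.I * δ) • ((unit : ℂ) • segMatrix hk vre vim f l m)))
    (F := fun m => 1 + (-Complex.I * δ * unit : ℂ) • segMatrix hk vre vim f l m)
    (mul_nonneg hδ hB0) (by positivity)
    (fun m _ => norm_le_one_of_isometry (exp_isometry (((oracleMatrix_isHermitian hk _).smul
      (k := (unit : ℂ)) (Complex.conj_ofReal _))) δ))
    (fun m _ => by
      refine (norm_add_le _ _).trans (add_le_add norm_one_le ?_)
      rw [← smul_smul (-Complex.I * δ : ℂ)]
      exact hn m)
    (fun m _ => by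
      rw [← smul_smul (-Complex.I * δ : ℂ)]
      refine (norm_exp_sub_le ((hn m).trans hone)).trans ?_
      exact pow_le_pow_left₀ (norm_nonneg _) (hn m) 2)
  have h3 : Real.exp (δ * B * (2 ^ P.n : ℕ)) ≤ 2 := by
    have h4 : δ * B * (2 ^ P.n : ℕ) ≤ 1 / 2 := by rw [mul_comm]; push_cast; exact hBδ
    refine (Real.exp_le_exp.2 h4).trans ?_
    have h5 : Real.exp (1 / 2) ^ 2 = Real.exp 1 := by rw [← Real.exp_nat_mul]; norm_num
    have := Real.exp_one_lt_d9
    nlinarith [Real.exp_pos (1 / 2)]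
  have h4 : ((2 ^ P.n : ℕ) : ℝ) * (δ * B) ^ 2 * Real.exp (δ * B * (2 ^ P.n : ℕ)) ≤
      2 * 2 ^ P.n * (δ * B) ^ 2 := by
    have := mul_le_mul_of_nonneg_left h3
      (show 0 ≤ ((2 ^ P.n : ℕ) : ℝ) * (δ * B) ^ 2 by positivity)
    push_cast at *
    linarith
  refine (norm_sub_le_norm_sub_add_norm_sub _ (timeProd (fun m =>
    1 + (-Complex.I * δ * unit : ℂ) • segMatrix hk vre vim f l m) (2 ^ P.n)) _).trans ?_
  rw [norm_sub_rev] at h2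
  linarith

/-- The error of the whole simulation. -/
lemma norm_opTotal_sub_timeOrderedExp_le (hd : 0 < P.d) (hdN : P.d ≤ P.N) (hdk : P.d ≤ 2 ^ P.kd)
    (hk0 : 0 < P.k) (hRa : Ra ∈ unitaryGroup Bool ℂ)
    {OH : unitaryGroup (HWire (P.n + P.p) P.N P.np → Bool) ℂ}
    {Of : unitaryGroup (FWire (P.n + P.p) P.N → Bool) ℂ}
    {t hmax rate unit ω η : ℝ} {H : ℝ → Matrix (Fin P.N) (Fin P.N) ℂ} (ht : 0 < t) (hm : 0 ≤ hmax)
    (hu : 0 < unit) (hω : 0 ≤ ω)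
    (h : IsSparseHamiltonian P.d t hmax rate H)
    (hOH : IsValueOracle (P.n + P.p) P.np unit t ω H OH.1)
    (hOf : IsPositionOracle (P.n + P.p) P.d t H Of.1)
    (hfit : hmax + ω < unit * 2 ^ (P.k - 1) ∨ P.k = P.np)
    (hz : Ra false false * (2 ^ (P.kd + P.k))⁻¹ = -(2 * (t / 2 ^ P.p : ℝ) * unit) * Complex.I)
    (hB : t / 2 ^ P.p * (P.d * (hmax + ω)) ≤ 1 / 2)
    (hη : 3 / K.factorial + 2 * (t / 2 ^ P.p * (P.d * (hmax + ω))) ^ 2 / 2 ^ P.n ≤ η) (hη1 : η ≤ 1) :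
    ‖blk (sst K) (opTotal hkd hk K Ra OH.1 Of.1 (2 ^ P.p)) - timeOrderedExp H t‖ ≤
      2 ^ P.p * √(6 * η) + (t * (P.d * ω) + t / 2 ^ (P.n + P.p) * t *
        ((P.d * (hmax + ω)) ^ 2 + P.d * (hmax + ω) * (P.d * hmax) + rate)) := by
  obtain ⟨vre, vim, hV, hv⟩ := exists_valData hOH
  obtain ⟨f, hF, hl⟩ := exists_posData hOf
  set δ : ℝ := t / 2 ^ (P.n + P.p) with hδd
  have hδ : 0 ≤ δ := by positivity
  set B : ℝ := P.d * (hmax + ω) with hBd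
  have hδn : 2 ^ P.n * δ = t / 2 ^ P.p := by rw [hδd, pow_add]; field_simp
  have hsub := fun m => norm_oracleMatrix_sub_le (vre := vre) (vim := vim) (f := f) hk h ht.le hk0 hu
    hω hfit m (hv m) (hl m)
  have hnB : ∀ m, ‖(unit : ℂ) • oracleMatrix hk vre vim f m‖ ≤ B := by
    intro m
    have h1 := h.norm_apply_le (gridTime_mem ht.le (bv_lt m)) hm
    have h2 := norm_add_le ((unit : ℂ) • oracleMatrix hk vre vim f m -
      H (gridTime (P.n + P.p) t (bv m))) (H (gridTime (P.n + P.p) t (bv m)))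
    rw [sub_add_cancel] at h2
    rw [hBd, mul_add]
    linarith [hsub m]
  have hherm : ∀ m, ((unit : ℂ) • oracleMatrix hk vre vim f m).IsHermitian := fun m =>
    (oracleMatrix_isHermitian hk m).smul (k := (unit : ℂ)) (Complex.conj_ofReal _)
  have hBδ : 2 ^ P.n * (δ * B) ≤ 1 / 2 := by rw [← mul_assoc, hδn]; exact hB
  have hB0 : 0 ≤ B := by positivity
  set E : ℕ → Matrix (Fin P.N) (Fin P.N) ℂ := fun j => NormedSpace.exp ((-Complex.I * (δ : ℝ)) •
    ((unit : ℂ) • oracleMatrix hk vre vim f (natBits (P.n + P.p) j))) with hE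
  set U : ℕ → Matrix (Fin P.N) (Fin P.N) ℂ := fun l => timeProd (fun m => E (l * 2 ^ P.n + m)) (2 ^ P.n)
    with hU
  have h1 : ‖blk (sst K) (opTotal hkd hk K Ra OH.1 Of.1 (2 ^ P.p)) - timeProd U (2 ^ P.p)‖ ≤
      (2 ^ P.p : ℕ) * √(6 * η) := by
    refine norm_opTotal_block_sub_le (hd.trans_le hdN) hRa OH.2 Of.2 hη1 (fun l _ => ?_) fun l _ => ?_
    · exact timeProd_isometry fun m _ => exp_isometry (hherm _) δ
    · have h2 := norm_blk_opW_sub_le (K := K) (hkd := hkd) (l := l) hd hdN hdk hk0 hV hF hδ hu (by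
        rw [hz, ← hδn]; push_cast; ring) hnB hBδ
      have e1 : U l = timeProd (fun m => NormedSpace.exp ((-Complex.I * δ) •
          ((unit : ℂ) • segMatrix hk vre vim f l m))) (2 ^ P.n) := by
        refine timeProd_congr fun m hm => ?_
        rw [hE, segMatrix, natBits_append hm]
      rw [e1]
      refine h2.trans (le_trans (le_of_eq ?_) hη)
      rw [← hδn]
      field_simp
  have h3 : timeProd U (2 ^ P.p) = timeProd E (2 ^ (P.n + P.p)) := by
    rw [hU, timeProd_mul, ← pow_add, add_comm]
  have h4 := h.norm_timeProd_exp_sub_le (nt := P.n + P.p) ht hm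
    (A := fun j => (unit : ℂ) • oracleMatrix hk vre vim f (natBits (P.n + P.p) j)) (B' := B)
    (e := P.d * ω) (fun j _ => hherm _) (fun j _ => hnB _) (fun j hj => by
      have := hsub (natBits (P.n + P.p) j)
      rwa [bv_natBits, Nat.mod_eq_of_lt hj] at this) (by
      have : (1 : ℝ) ≤ 2 ^ P.n := one_le_pow₀ (by norm_num)
      have := mul_nonneg hδ hB0
      rw [← hδd]
      nlinarith)
  rw [h3] at h1
  refine (norm_sub_le_norm_sub_add_norm_sub _ (timeProd E (2 ^ (P.n + P.p))) _).trans ?_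
  push_cast at h1
  exact add_le_add h1 h4

end Simulation

/-! ### Choice of the parameters. -/

section Parameters

/-- Such a rotation of one ancilla damps a block encoding by any prescribed factor, so its scale can
be made to fit the amplification exactly. -/
lemma exists_unitary_apply_eq {u : ℂ} (hu : ‖u‖ ≤ 1) :
    ∃ R ∈ unitaryGroup Bool ℂ, R false false = u := by
  have h1 : ‖u‖ ^ 2 ≤ 1 := pow_le_one₀ (norm_nonneg u) hu
  have h2 : ((√(1 - ‖u‖ ^ 2) : ℝ) : ℂ) * (√(1 - ‖u‖ ^ 2) : ℝ) = 1 - u * star u := by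
    rw [← Complex.ofReal_mul, Real.mul_self_sqrt (by linarith), Complex.star_def,
      Complex.mul_conj, Complex.normSq_eq_norm_sq]
    push_cast
    ring
  have h3 : star ((√(1 - ‖u‖ ^ 2) : ℝ) : ℂ) = (√(1 - ‖u‖ ^ 2) : ℝ) := Complex.conj_ofReal _
  refine ⟨Matrix.of fun i j => if i then (if j then star u else (√(1 - ‖u‖ ^ 2) : ℝ)) else
    (if j then -(√(1 - ‖u‖ ^ 2) : ℝ) else u), ?_, by simp⟩
  rw [mem_unitaryGroup_iff']
  ext i j
  rw [Matrix.mul_apply, Fintype.sum_bool, star_apply, star_apply, Matrix.one_apply]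
  simp only [Matrix.of_apply]
  cases i <;> cases j <;> simp only [if_true, Bool.false_eq_true, if_false, star_neg, star_star, h3] <;>
    first | linear_combination h2 | (simp; ring)

lemma card_wires_le {P : Params} (hk : P.k ≤ P.np) (K : ℕ) :
    Fintype.card (Wires P K) ≤ 6 * P.size + 3 * K := by
  have h : Function.Surjective (Sum.elim Reg.x (Sum.elim Reg.y (Sum.elim Reg.m (Sum.elim Reg.m2
      (Sum.elim Reg.re (Sum.elim Reg.im (Sum.elim Reg.w
        ![Reg.sel, Reg.h, Reg.g1, Reg.g2, Reg.e, Reg.a])))))) : _ → Reg P) := by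
    rintro (i | i | i | i | i | i | i | _ | _ | _ | _ | _ | _)
    · exact ⟨.inl i, rfl⟩
    · exact ⟨.inr (.inl i), rfl⟩
    · exact ⟨.inr (.inr (.inl i)), rfl⟩
    · exact ⟨.inr (.inr (.inr (.inl i))), rfl⟩
    · exact ⟨.inr (.inr (.inr (.inr (.inl i)))), rfl⟩
    · exact ⟨.inr (.inr (.inr (.inr (.inr (.inl i))))), rfl⟩
    · exact ⟨.inr (.inr (.inr (.inr (.inr (.inr (.inl i)))))), rfl⟩
    · exact ⟨.inr (.inr (.inr (.inr (.inr (.inr (.inr 0)))))), rfl⟩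
    · exact ⟨.inr (.inr (.inr (.inr (.inr (.inr (.inr 1)))))), rfl⟩
    · exact ⟨.inr (.inr (.inr (.inr (.inr (.inr (.inr 2)))))), rfl⟩
    · exact ⟨.inr (.inr (.inr (.inr (.inr (.inr (.inr 3)))))), rfl⟩
    · exact ⟨.inr (.inr (.inr (.inr (.inr (.inr (.inr 4)))))), rfl⟩
    · exact ⟨.inr (.inr (.inr (.inr (.inr (.inr (.inr 5)))))), rfl⟩
  have h1 := Fintype.card_le_of_surjective _ h
  simp only [Fintype.card_sum, Fintype.card_fin] at h1 ⊢
  simp only [Params.size]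
  omega

lemma two_lt_log {L : ℝ} (hL : 16 ≤ L) : 2.7 < Real.log L := by
  have h1 : Real.log 16 = 4 * Real.log 2 := by
    rw [show (16 : ℝ) = 2 ^ 4 by norm_num, Real.log_pow]; norm_num
  have h2 := Real.log_le_log (by norm_num) hL
  have := Real.log_two_gt_d9
  linarith

lemma half_le_log_log {L : ℝ} (hL : 16 ≤ L) : 1 / 2 ≤ Real.log (Real.log L) := by
  have h := two_lt_log hL
  have h1 := Real.one_sub_inv_le_log_of_pos (show 0 < Real.log L by linarith)
  have h2 : (Real.log L)⁻¹ ≤ 1 / 2 := by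
    rw [one_div]; exact inv_anti₀ (by norm_num) (by linarith)
  linarith

lemma one_le_log_div {L : ℝ} (hL : 16 ≤ L) : 1 ≤ Real.log L / Real.log (Real.log L) := by
  have h1 := half_le_log_log hL
  have h2 := Real.log_le_sub_one_of_pos (show 0 < Real.log L by linarith [two_lt_log hL])
  rw [one_le_div (by linarith)]
  linarith

lemma log_div_le {L : ℝ} (hL : 16 ≤ L) :
    Real.log L / Real.log (Real.log L) ≤ 2 * Real.log L := by
  have h1 := half_le_log_log hL
  have h2 := two_lt_log hL
  rw [div_le_iff₀ (by linarith)]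
  nlinarith

/-- The truncation order `Ω(log L / log log L)` suffices for precision `1 / L ^ 7`. -/
lemma pow_le_factorial {L : ℝ} (hL : 16 ≤ L) {K : ℕ}
    (hK : 14 * (Real.log L / Real.log (Real.log L)) ≤ K) : L ^ 7 ≤ K.factorial := by
  set l := Real.log L with hl
  set g := Real.log l with hg
  have hg0 : 1 / 2 ≤ g := half_le_log_log hL
  have hl0 := two_lt_log hL
  have hR := one_le_log_div hL
  have hK0 : (0 : ℝ) < K := by linarith
  have h1 := Real.pow_div_factorial_le_exp (K : ℝ) hK0.le K
  have hf : (0 : ℝ) < K.factorial := by exact_mod_cast K.factorial_pos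
  rw [div_le_iff₀ hf] at h1
  have h2 : (K : ℝ) ^ K = Real.exp (K * Real.log K) := by
    rw [mul_comm, ← Real.rpow_def_of_pos hK0, Real.rpow_natCast]
  have h3 : Real.log 14 + g - Real.log g ≤ Real.log K := by
    have : Real.log (14 * (l / g)) = Real.log 14 + g - Real.log g := by
      rw [Real.log_mul (by norm_num) (by positivity), Real.log_div (by positivity) (by positivity)]
      ring
    rw [← this]
    exact Real.log_le_log (by positivity) hK
  -- From `log (g / 2) ≤ g / 2 - 1` and `log 2 < 1`.
  have h4 : Real.log g ≤ g / 2 := by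
    have h5 := Real.log_le_sub_one_of_pos (show 0 < g / 2 by linarith)
    rw [Real.log_div (by linarith) (by norm_num)] at h5
    linarith [Real.log_two_lt_d9]
  have h6 : 1 ≤ Real.log 14 := by
    have := Real.log_le_log (by norm_num) (show (2 : ℝ) ^ 2 ≤ 14 by norm_num)
    rw [Real.log_pow] at this
    push_cast at this
    linarith [Real.log_two_gt_d9]
  -- The preceding bounds give `log K - 1 ≥ g / 2`, and `14 * (l / g) * (g / 2) = 7 * l`. With `K! ≥
  -- (K / e) ^ K` this is the exponent `7`.
  have h7 : 7 * l ≤ K * (Real.log K - 1) := by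
    have h8 : 14 * (l / g) * (g / 2) ≤ K * (Real.log K - 1) :=
      mul_le_mul hK (by linarith) (by positivity) hK0.le
    have h9 : 14 * (l / g) * (g / 2) = 7 * l := by field_simp; ring
    linarith
  have h10 : Real.exp (7 * l) * Real.exp K ≤ Real.exp K * K.factorial := by
    refine le_trans ?_ h1
    rw [h2, ← Real.exp_add, Real.exp_le_exp]
    linarith
  have h11 : Real.exp (7 * l) = L ^ 7 := by
    rw [hl, ← Real.exp_log (show 0 < L by linarith), ← Real.exp_nat_mul, Real.log_exp]
    norm_num
  rw [← h11]
  have := Real.exp_pos K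
  nlinarith

/-- The constants fit because `8 * log 2 > 5`. -/
lemma pow_le_two_pow {Y S : ℝ} (hY : 1 ≤ Y) (hS : Real.log Y ≤ S) {n : ℕ} (hn : 8 * S ≤ n) :
    Y ^ 5 ≤ 2 ^ n := by
  have h0 := Real.log_nonneg hY
  rw [← Real.log_le_log_iff (by positivity) (by positivity), Real.log_pow, Real.log_pow]
  have := Real.log_two_gt_d9
  push_cast
  nlinarith

/-- The number of binary digits that hold integer multiples of `unit` up to `2 * hmax`. -/
lemma exists_digits {unit hmax : ℝ} (hu : 0 < unit) (h : unit < 2 * hmax) {np : ℕ} (hnp : 0 < np) :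
    ∃ k, 0 < k ∧ k ≤ np ∧ (2 * hmax ≤ unit * 2 ^ (k - 1) ∨ k = np) ∧ unit * 2 ^ k ≤ 8 * hmax := by
  obtain ⟨j, hj1, hj2⟩ := exists_nat_pow_near (x := 2 * hmax / unit) (y := 2)
    ((one_le_div hu).2 h.le) (by norm_num)
  rw [le_div_iff₀ hu] at hj1
  rw [div_lt_iff₀ hu] at hj2
  -- `j + 1` digits for the magnitude and one for the sign; if the oracle has no more digits than
  -- that, all are used.
  rcases le_total (j + 2) np with hjn | hjn
  · refine ⟨j + 2, by omega, hjn, .inl ?_, ?_⟩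
    · rw [Nat.add_sub_assoc (by norm_num)]; linarith
    · rw [pow_add]; linarith
  · refine ⟨np, hnp, le_rfl, .inr rfl, ?_⟩
    have : (2 : ℝ) ^ np ≤ 2 ^ (j + 2) := pow_le_pow_right₀ (by norm_num) hjn
    rw [pow_add] at this
    nlinarith

lemma exists_two_pow_near {x : ℝ} (hx : 1 ≤ x) : ∃ p : ℕ, 32 * x ≤ 2 ^ p ∧ (2 : ℝ) ^ p ≤ 64 * x := by
  obtain ⟨j, hj1, hj2⟩ := exists_nat_pow_near hx (y := 2) (by norm_num)
  refine ⟨j + 6, ?_, ?_⟩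
  · rw [pow_add]; rw [pow_succ] at hj2; linarith
  · rw [pow_add]; linarith

lemma two_pow_clog_le {d : ℕ} (hd : 0 < d) : 2 ^ Nat.clog 2 d ≤ 2 * d := by
  rcases Nat.eq_or_lt_of_le (Nat.one_le_iff_ne_zero.2 hd.ne') with rfl | h
  · simp
  · have := Nat.pow_pred_clog_lt_self (b := 2) (by norm_num) h
    have h2 : 0 < Nat.clog 2 d := Nat.clog_pos (by norm_num) h
    obtain ⟨c, hc⟩ := Nat.exists_eq_succ_of_ne_zero h2.ne'
    rw [hc] at this ⊢
    rw [Nat.pred_succ] at this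
    rw [pow_succ]
    omega

lemma clog_le_log {N : ℕ} (hN : 0 < N) : (Nat.clog 2 N : ℝ) ≤ 3 / 2 * Real.log N + 1 := by
  have h1 : (2 : ℝ) ^ Nat.clog 2 N ≤ 2 * N := by exact_mod_cast two_pow_clog_le hN
  have h2 := Real.log_le_log (by positivity) h1
  rw [Real.log_pow, Real.log_mul (by norm_num) (by positivity)] at h2
  have h3 : 0 ≤ Real.log N := Real.log_natCast_nonneg N
  have := Real.log_two_gt_d9
  have := Real.log_two_lt_d9
  nlinarith

end Parameters

/-! ### Error and resource budgets. -/

section Budget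

lemma exists_simulation_circuit {P : Params} {K : ℕ} (hkd : P.kd ≤ indexQubits P.N)
    (hk : P.k ≤ P.np) {Ra : Matrix Bool Bool ℂ} (hRa : Ra ∈ unitaryGroup Bool ℂ) :
    ∃ (a : ℕ) (c : Circuit (P.n + P.p) P.N P.np a), c.queries ≤ 2 ^ P.p * (24 * K) ∧
      c.primitiveGates ≤ 2 ^ P.p * (20000 * ((K + 1) * P.size)) ∧
      c.qubits ≤ 86 * P.size + 83 * K ∧
      ∀ OH ∈ unitaryGroup (HWire (P.n + P.p) P.N P.np → Bool) ℂ,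
      ∀ Of ∈ unitaryGroup (FWire (P.n + P.p) P.N → Bool) ℂ,
        c.implemented OH Of = blk (sst K) (opTotal hkd hk K Ra OH Of (2 ^ P.p)) := by
  have hinj : Function.Injective fun i => (Sum.inl (Reg.x i) : Wires P K) := fun i j h => by
    simpa using h
  obtain ⟨a, c, h1, h2, h3, h4⟩ := exists_circuit (Impl.opTotal (hkd := hkd) (hk := hk) (K := K) hRa
    le_rfl (2 ^ P.p)) ⟨_, hinj⟩
  refine ⟨a, c, h1, h2, ?_, fun OH hOH Of hOf => ?_⟩
  · have := card_wires_le hk K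
    omega
  · have he : ∀ x : Fin P.N, Function.extend (fun i => (Sum.inl (Reg.x i) : Wires P K))
        (natBits _ x) (fun _ => false) = sst K x := by
      intro x
      ext k
      by_cases h : ∃ i, Sum.inl (Reg.x i) = k
      · obtain ⟨i, rfl⟩ := h
        rw [hinj.extend_apply]
        rfl
      · rw [Function.extend_apply' _ _ _ h]
        rcases k with (k | k | k | k | k | k | k | _ | _ | _ | _ | _ | _) | k | k <;>
          first | rfl | exact absurd ⟨_, rfl⟩ h
    ext x y
    rw [h4 OH hOH Of hOf]
    simp only [Function.Embedding.coeFn_mk, he]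
    rfl

/-- The constant is `6 * 128 ^ 2`, so that a segment error of this size leaks at most `1 / (128 *
L)`. The exponents `7` and `5` leave a power of `L ≥ 16` that absorbs the constants. -/
lemma precision_le {L X M b : ℝ} (hL : 16 ≤ L) (hX : L ^ 7 ≤ X) (hM : L ^ 5 ≤ M) (hb0 : 0 ≤ b)
    (hb : b ≤ 1 / 16) : 3 / X + 2 * b ^ 2 / M ≤ 1 / (98304 * L ^ 2) := by
  have hL2 : 0 < L ^ 2 := by positivity
  have h5 : 1048576 * L ^ 2 ≤ L ^ 7 := by
    have : (16 : ℝ) ^ 5 ≤ L ^ 5 := pow_le_pow_left₀ (by norm_num) hL 5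
    nlinarith
  have h3 : 4096 * L ^ 2 ≤ L ^ 5 := by
    have : (16 : ℝ) ^ 3 ≤ L ^ 3 := pow_le_pow_left₀ (by norm_num) hL 3
    nlinarith
  have h1 : 3 / X ≤ 3 / (1048576 * L ^ 2) :=
    div_le_div_of_nonneg_left (by norm_num) (by positivity) (h5.trans hX)
  have h2 : 2 * b ^ 2 / M ≤ (2 * (1 / 16) ^ 2) / (4096 * L ^ 2) :=
    div_le_div₀ (by norm_num) (by gcongr) (by positivity) (h3.trans hM)
  refine (add_le_add h1 h2).trans ?_
  rw [div_add_div _ _ (by positivity) (by positivity), div_le_div_iff₀ (by positivity) (by positivity)]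
  nlinarith [sq_nonneg (L ^ 2 * L ^ 2 ), pow_pos hL2 2, pow_pos hL2 3]

/-- By the definition of `Y`, `rate + D ^ 2` is `Y * (D * ε) / t`; with `M ≥ Y` and `r ≥ 32 * (D *
t)` everything cancels except `6 / 32` of `ε`. -/
lemma discretization_le {D t ε rate Y B M r : ℝ} (hD : 0 < D) (ht : 0 < t) (hε : 0 < ε)
    (hrate : 0 ≤ rate) (hY : Y = t / (D * ε) * (rate + D ^ 2)) (hB0 : 0 ≤ B) (hB : B ≤ 2 * D)
    (hM : Y ≤ M) (hr : 32 * (D * t) ≤ r) :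
    t / (M * r) * t * (B ^ 2 + B * D + rate) ≤ 3 / 16 * ε := by
  have hY0 : 0 < Y := by rw [hY]; positivity
  have h1 : B ^ 2 + B * D + rate ≤ 6 * (rate + D ^ 2) := by nlinarith
  have h2 : rate + D ^ 2 = Y * (D * ε) / t := by rw [hY]; field_simp
  have h3 : t / (M * r) ≤ t / (Y * (32 * (D * t))) :=
    div_le_div_of_nonneg_left ht.le (by positivity) (mul_le_mul hM hr (by positivity) (by linarith))
  calc _ ≤ t / (Y * (32 * (D * t))) * t * (6 * (Y * (D * ε) / t)) := by
        rw [← h2]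
        gcongr
    _ = _ := by field_simp; norm_num

lemma resources_le {x R S q n p K np size r : ℝ} (hx : 0 ≤ x) (hR : 1 ≤ R) (hRS : R ≤ 2 * S)
    (hS : 2.7 ≤ S) (hq : q ≤ 2 * S) (hn : n ≤ 9 * S) (hp : p ≤ 5 * S) (hK0 : 0 ≤ K)
    (hK : K ≤ 15 * R) (hnp : 0 ≤ np) (hsize0 : 0 ≤ size) (hsize : size = q + n + p + np + 1)
    (hr : r ≤ 64 * x) :
    r * (24 * K) ≤ 10 ^ 9 * (x * R) ∧ 86 * size + 83 * K ≤ 10 ^ 9 * (np + S) ∧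
      r * (20000 * ((K + 1) * size)) ≤ 10 ^ 9 * (x * (np ^ 2 + S * R)) := by
  have h1 : size ≤ np + 17 * S := by linarith
  refine ⟨?_, by linarith, ?_⟩
  · have h2 : r * (24 * K) ≤ 64 * x * (24 * (15 * R)) := by gcongr
    nlinarith [mul_nonneg hx (by linarith : 0 ≤ R)]
  · have h2 : r * (20000 * ((K + 1) * size)) ≤ 64 * x * (20000 * ((16 * R) * (np + 17 * S))) := by
      gcongr
      linarith
    -- The mixed term `R * np` is split into squares, and `R ^ 2 ≤ 2 * (S * R)`. This is how the
    -- quadratic polynomial in `np` arises.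
    have h3 : R * (np + 17 * S) ≤ np ^ 2 + 19 * (S * R) := by
      nlinarith [sq_nonneg (R - np), mul_le_mul_of_nonneg_left hRS (by linarith : 0 ≤ R)]
    have h4 : np ^ 2 + 19 * (S * R) ≤ 19 * (np ^ 2 + S * R) := by nlinarith
    have h5 := mul_le_mul_of_nonneg_left (h3.trans h4) hx
    have h6 : 0 ≤ x * (np ^ 2 + S * R) := by
      have : 0 ≤ S * R := by nlinarith
      positivity
    nlinarith

lemma log_le_of_index {N : ℕ} {L Y : ℝ} (hN : 0 < N) (hL : 16 ≤ L) (hLY : L ≤ Y) :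
    Real.log N + Real.log L ≤ Real.log (N * Y) ∧ Real.log Y ≤ Real.log (N * Y) ∧
      0 ≤ Real.log N ∧ 2.7 ≤ Real.log (N * Y) := by
  have h0 : 0 ≤ Real.log N := Real.log_natCast_nonneg N
  have hN' : (0 : ℝ) < N := by exact_mod_cast hN
  have h1 := Real.log_le_log (by linarith) hLY
  have h2 := two_lt_log hL
  rw [Real.log_mul (by positivity) (by linarith)]
  refine ⟨by linarith, by linarith, h0, by linarith⟩

end Budget

/-! ### Comparison of the evolution with the identity. -/

section Trivial

variable {N d np nt a : ℕ} {t hmax rate : ℝ} {H : ℝ → Matrix (Fin N) (Fin N) ℂ}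

lemma implemented_nil (OH : QOp (HWire nt N np)) (Of : QOp (FWire nt N)) :
    Circuit.implemented OH Of ([] : Circuit nt N np a) = 1 := by
  have hinj : ∀ x y : Fin N, natBits (indexQubits N) x = natBits (indexQubits N) y ↔ x = y := by
    refine fun x y => ⟨fun h => Fin.ext ?_, fun h => by rw [h]⟩
    have h1 := congrArg bv h
    rwa [bv_natBits, bv_natBits, Nat.mod_eq_of_lt (index_lt x), Nat.mod_eq_of_lt (index_lt y)] at h1
  ext x y
  simp only [Circuit.implemented, Circuit.op, Matrix.one_apply]
  by_cases h : x = y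
  · rw [if_pos h, if_pos (by rw [h])]
  · rw [if_neg h, if_neg fun h' => h ((hinj x y).1 (funext fun i => congrFun h' (Sum.inl i)))]

lemma IsSparseHamiltonian.norm_one_sub_le_two (h : IsSparseHamiltonian d t hmax rate H)
    (ht : 0 ≤ t) (hm : 0 ≤ hmax) : ‖1 - timeOrderedExp H t‖ ≤ 2 := by
  have h1 := norm_le_one_of_isometry (h.timeOrderedExp_isometry ht hm)
  have h2 := norm_sub_le (1 : Matrix (Fin N) (Fin N) ℂ) (timeOrderedExp H t)
  linarith [norm_one_le (n := Fin N)]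

/-- The sampling estimate with all samples replaced by zero: the exponentials are then `1`, and `e`
measures how far `H` is from zero on the grid. -/
lemma IsSparseHamiltonian.norm_one_sub_le (h : IsSparseHamiltonian d t hmax rate H)
    (ht : 0 < t) (hm : 0 ≤ hmax) {e : ℝ} (he : ∀ m < 2 ^ nt, ‖H (gridTime nt t m)‖ ≤ e) :
    ‖1 - timeOrderedExp H t‖ ≤ t * e + t / 2 ^ nt * t * rate := by
  have h1 := h.norm_timeProd_exp_sub_le (nt := nt) (A := fun _ => 0) (B' := 0) (e := e) ht hm
    (fun _ _ => isHermitian_zero) (fun _ _ => by simp) (fun m hm => by simpa using he m hm) (by simp)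
  simpa [timeProd_one] using h1

end Trivial

/-! ### Assembly of the simulation. -/

section Main

variable {N d np : ℕ} {t ε hmax rate unit x L Y R S : ℝ}

/-- If the precision is low or all encoded values vanish, the empty circuit suffices. -/
lemma exists_simulation_of_trivial (hd : 0 < d) (hdN : d ≤ N) (ht : 0 < t) (hε : 0 < ε)
    (hm : 0 < hmax) (hrate : 0 ≤ rate) (hu : 0 < unit) (htriv : 2 ≤ ε ∨ np = 0 ∨ 2 * hmax ≤ unit)
    (hx : x = d * hmax * t) (hx1 : 1 ≤ x) (hL : L = x / ε) (hL16 : 16 ≤ L)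
    (hY : Y = t / (d * hmax * ε) * (rate + (d * hmax) ^ 2))
    (hR : R = Real.log L / Real.log (Real.log L)) (hS : S = Real.log (N * Y)) :
    ∃ (nt a : ℕ) (circ : Circuit nt N np a),
      (circ.queries : ℝ) ≤ 10 ^ 9 * (x * R) ∧ (circ.qubits : ℝ) ≤ 10 ^ 9 * (np + S) ∧
      (circ.primitiveGates : ℝ) ≤ 10 ^ 9 * (x * (np ^ 2 + S * R)) ∧
      ∀ (H : ℝ → Matrix (Fin N) (Fin N) ℂ) (OH : unitaryGroup (HWire nt N np → Bool) ℂ)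
        (Of : unitaryGroup (FWire nt N → Bool) ℂ),
        IsSparseHamiltonian d t hmax rate H →
        IsValueOracle nt np unit t (1 / 4 * ε / (d * t)) H OH.1 →
        IsPositionOracle nt d t H Of.1 →
        ‖circ.implemented OH.1 Of.1 - timeOrderedExp H t‖ ≤ ε := by
  have hd' : (0 : ℝ) < d := by exact_mod_cast hd
  have hN : 0 < N := hd.trans_le hdN
  have hLε : L * ε = x := by rw [hL]; field_simp
  have hLY : L ≤ Y := by
    have : L = t / (d * hmax * ε) * (d * hmax) ^ 2 := by rw [hL, hx]; field_simp
    rw [this, hY]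
    gcongr
    linarith
  obtain ⟨hS1, -, hlN, hS3⟩ := log_le_of_index hN hL16 hLY
  rw [← hS] at hS1 hS3
  have hlL := two_lt_log hL16
  have hR1 : 1 ≤ R := hR ▸ one_le_log_div hL16
  -- The empty circuit stores no time, so `nt` may be as large as the discretization error requires.
  obtain ⟨nt, hnt⟩ := pow_unbounded_of_one_lt (2 * (t * t * rate) / ε) (one_lt_two)
  have hx0 : 0 ≤ x := by linarith
  have hS0 : 0 ≤ S := by linarith
  have hR0 : 0 ≤ R := by linarith
  refine ⟨nt, 0, [], ?_, ?_, ?_, fun H OH Of hH hOH hOf => ?_⟩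
  · simp only [Circuit.queries, List.countP_nil, Nat.cast_zero]
    positivity
  · have := clog_le_log hN
    have hnp : (0 : ℝ) ≤ np := Nat.cast_nonneg np
    simp only [Circuit.qubits, Nat.add_zero]
    linarith
  · simp only [Circuit.primitiveGates, List.countP_nil, Nat.cast_zero]
    positivity
  rw [implemented_nil]
  rcases htriv with h2 | htriv
  · exact (hH.norm_one_sub_le_two ht.le hm.le).trans h2
  set ω : ℝ := 1 / 4 * ε / (d * t) with hω
  have hω0 : 0 < ω := by positivity
  have e2 : t * (d * ω) = ε / 4 := by rw [hω]; field_simp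
  have hfit : hmax + ω < unit ∨ np = 0 := by
    rcases htriv with h | h
    · exact .inr h
    · refine .inl (lt_of_lt_of_le ?_ h)
      have h1 : 16 * ε ≤ x := hLε ▸ mul_le_mul_of_nonneg_right hL16 hε.le
      have h2 : ω < hmax := by
        rw [hω, div_lt_iff₀ (by positivity), show hmax * (d * t) = x by rw [hx]; ring]
        linarith
      linarith
  have h1 := hH.norm_one_sub_le ht hm.le fun m hmn =>
    norm_apply_gridTime_le hH ht.le hu hω0.le hfit hOH hmn
  have h3 : t / 2 ^ nt * t * rate ≤ ε / 2 := by
    rw [div_lt_iff₀ hε] at hnt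
    rw [div_mul_eq_mul_div, div_mul_eq_mul_div, div_le_iff₀ (by positivity)]
    linarith
  linarith

/-- The circuit in the case that the problem is not trivial. -/
lemma exists_simulation (hd : 0 < d) (hdN : d ≤ N) (hnp : 0 < np) (ht : 0 < t) (hε : 0 < ε)
    (hε2 : ε < 2) (hm : 0 < hmax) (hrate : 0 ≤ rate) (hu : 0 < unit) (hum : unit < 2 * hmax)
    (hx : x = d * hmax * t) (hx1 : 1 ≤ x) (hL : L = x / ε) (hL16 : 16 ≤ L)
    (hY : Y = t / (d * hmax * ε) * (rate + (d * hmax) ^ 2))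
    (hR : R = Real.log L / Real.log (Real.log L)) (hS : S = Real.log (N * Y)) :
    ∃ (nt a : ℕ) (circ : Circuit nt N np a),
      (circ.queries : ℝ) ≤ 10 ^ 9 * (x * R) ∧ (circ.qubits : ℝ) ≤ 10 ^ 9 * (np + S) ∧
      (circ.primitiveGates : ℝ) ≤ 10 ^ 9 * (x * (np ^ 2 + S * R)) ∧
      ∀ (H : ℝ → Matrix (Fin N) (Fin N) ℂ) (OH : unitaryGroup (HWire nt N np → Bool) ℂ)
        (Of : unitaryGroup (FWire nt N → Bool) ℂ),
        IsSparseHamiltonian d t hmax rate H →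
        IsValueOracle nt np unit t (1 / 4 * ε / (d * t)) H OH.1 →
        IsPositionOracle nt d t H Of.1 →
        ‖circ.implemented OH.1 Of.1 - timeOrderedExp H t‖ ≤ ε := by
  have hd' : (0 : ℝ) < d := by exact_mod_cast hd
  have hN : 0 < N := hd.trans_le hdN
  set D : ℝ := d * hmax with hD
  have hD0 : 0 < D := by positivity
  have hLε : L * ε = x := by rw [hL]; field_simp
  have hLY : L ≤ Y := by
    have : L = t / (D * ε) * D ^ 2 := by rw [hL, hx]; field_simp
    rw [this, hY]
    gcongr
    linarith
  obtain ⟨hS1, hS2, hlN, hS3⟩ := log_le_of_index hN hL16 hLY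
  rw [← hS] at hS1 hS2 hS3
  have hlL := two_lt_log hL16
  have hR1 : 1 ≤ R := hR ▸ one_le_log_div hL16
  have hR2 : R ≤ 2 * S := by
    have := log_div_le hL16
    rw [← hR] at this
    linarith
  obtain ⟨k, hk0, hk, hkfit, hkle⟩ := exists_digits hu hum hnp
  -- At least `32 * x` segments keep the amplitude required of `Ra` at most one; at most `64 * x`
  -- keep the leakage and the costs in bounds.
  obtain ⟨p, hp1, hp2⟩ := exists_two_pow_near hx1
  -- Large enough for `Y ^ 5 ≤ 2 ^ n`, which serves the precision of a segment, through `L ≤ Y`, and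
  -- the discretization.
  set n := ⌈8 * S⌉₊ with hn
  set K := ⌈14 * R⌉₊ with hK
  have hn1 : 8 * S ≤ n := Nat.le_ceil _
  have hn2 : (n : ℝ) ≤ 9 * S := by
    have := Nat.ceil_lt_add_one (show 0 ≤ 8 * S by linarith)
    linarith
  have hK1 : 14 * R ≤ K := Nat.le_ceil _
  have hK2 : (K : ℝ) ≤ 15 * R := by
    have := Nat.ceil_lt_add_one (show 0 ≤ 14 * R by linarith)
    linarith
  have hpS : (p : ℝ) ≤ 5 * S := by
    have h1 : (2 : ℝ) ^ p ≤ 2 ^ 7 * L := by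
      -- `2 ^ p ≤ 64 * (L * ε)`; the bound `ε < 2` is what makes `p` logarithmic in `L`.
      have h2 := mul_le_mul_of_nonneg_left hε2.le (show 0 ≤ L by linarith)
      linarith
    have h2 := Real.log_le_log (by positivity) h1
    rw [Real.log_mul (by positivity) (by positivity), Real.log_pow, Real.log_pow] at h2
    have := Real.log_two_gt_d9
    have := Real.log_two_lt_d9
    push_cast at h2
    have h3 : (p : ℝ) * (2 / 3) ≤ p * Real.log 2 := by gcongr; linarith
    linarith
  have hqS : (indexQubits N : ℝ) ≤ 2 * S := by
    have := clog_le_log hN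
    linarith
  have h2p : (0 : ℝ) < 2 ^ p := by positivity
  have hx0 : 0 < x := by linarith
  set ω : ℝ := 1 / 4 * ε / (d * t) with hω
  have hω0 : 0 < ω := by positivity
  have hωm : ω ≤ 1 / 64 * hmax := by
    have h1 : 16 * ε ≤ x := hLε ▸ mul_le_mul_of_nonneg_right hL16 hε.le
    have h2 : 1 / 64 * hmax * (d * t) = x / 64 := by rw [hx, hD]; ring
    rw [hω, div_le_iff₀ (by positivity), h2]
    linarith
  have hτ : t / 2 ^ p * D ≤ 1 / 32 := by
    rw [div_mul_eq_mul_div, div_le_iff₀ h2p, mul_comm t, ← hx]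
    linarith
  have hB : (d : ℝ) * (hmax + ω) ≤ 2 * D := by
    have h1 := mul_le_mul_of_nonneg_left (hωm.trans (show 1 / 64 * hmax ≤ hmax by linarith)) hd'.le
    rw [mul_add]
    linarith
  have hb : t / 2 ^ p * (d * (hmax + ω)) ≤ 1 / 16 := by
    have : t / 2 ^ p * (d * (hmax + ω)) ≤ t / 2 ^ p * (2 * D) := by gcongr
    linarith
  have hY5 : Y ^ 5 ≤ 2 ^ n := pow_le_two_pow (by linarith) hS2 hn1
  have hprec := precision_le (X := K.factorial) (M := 2 ^ n) hL16
    (pow_le_factorial hL16 (by rwa [← hR])) ((pow_le_pow_left₀ (by linarith) hLY 5).trans hY5)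
    (by positivity) hb
  have hdisc := discretization_le (B := d * (hmax + ω)) (M := 2 ^ n) (r := 2 ^ p) hD0 ht hε hrate hY
    (by positivity) hB ((le_self_pow₀ (by linarith) (by norm_num)).trans hY5) (by rw [← hx]; exact hp1)
  -- The unscaled encoding has scale `2 ^ (clog d + k) * unit ≤ 16 * D`, so the required amplitude
  -- is at most `32 * (t / 2 ^ p) * D ≤ 1`.
  obtain ⟨Ra, hRa, hRa0⟩ := exists_unitary_apply_eq
    (u := -(2 * (t / 2 ^ p : ℝ) * unit) * Complex.I * 2 ^ (Nat.clog 2 d + k)) (by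
      have hdc : (2 : ℝ) ^ Nat.clog 2 d ≤ 2 * d := by exact_mod_cast two_pow_clog_le hd
      have h1 : ‖-(2 * (t / 2 ^ p : ℝ) * unit) * Complex.I * 2 ^ (Nat.clog 2 d + k)‖ =
          2 * (t / 2 ^ p) * (2 ^ Nat.clog 2 d * (unit * 2 ^ k)) := by
        rw [norm_mul, norm_mul, norm_neg, norm_mul, norm_mul, Complex.norm_I, Complex.norm_real,
          Complex.norm_real, Real.norm_of_nonneg hu.le, Real.norm_of_nonneg (by positivity), norm_pow,
          pow_add]
        simp only [Complex.norm_ofNat]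
        ring
      rw [h1]
      have h2 : 2 ^ Nat.clog 2 d * (unit * 2 ^ k) ≤ 2 * d * (8 * hmax) := by gcongr
      have h3 : 2 * (t / 2 ^ p) * (2 ^ Nat.clog 2 d * (unit * 2 ^ k)) ≤
          2 * (t / 2 ^ p) * (2 * d * (8 * hmax)) := by gcongr
      refine h3.trans ?_
      rw [hD] at hτ
      linarith)
  let P : Params := ⟨N, d, np, n, p, Nat.clog 2 d, k⟩
  have hkd : P.kd ≤ indexQubits P.N := Nat.clog_mono_right 2 hdN
  obtain ⟨a, c, hc1, hc2, hc3, hc4⟩ := exists_simulation_circuit (P := P) (K := K) hkd hk hRa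
  have hsize : (P.size : ℝ) = indexQubits N + n + p + np + 1 := by
    rw [Params.size]; push_cast; rfl
  obtain ⟨r1, r2, r3⟩ := resources_le hx0.le hR1 hR2 hS3 hqS hn2 hpS (Nat.cast_nonneg K) hK2
    (Nat.cast_nonneg np) (Nat.cast_nonneg P.size) hsize hp2
  refine ⟨n + p, a, c, le_trans ?_ r1, le_trans ?_ r2, le_trans ?_ r3, ?_⟩
  · exact_mod_cast hc1
  · exact_mod_cast hc3
  · exact_mod_cast hc2
  intro H OH Of hH hOH hOf
  have herr := norm_opTotal_sub_timeOrderedExp_le (P := P) (K := K) (hkd := hkd) (hk := hk) hd hdN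
    (Nat.le_pow_clog (by norm_num) d) hk0 hRa (OH := OH) (Of := Of) ht hm.le hu hω0.le hH hOH hOf
    (hkfit.imp_left fun h => by linarith) (by
      rw [hRa0]
      exact mul_inv_cancel_right₀ (pow_ne_zero _ two_ne_zero) _)
    (hb.trans (by norm_num)) hprec (by
      rw [div_le_one (by positivity)]
      have := one_le_pow₀ (n := 2) (show 1 ≤ L by linarith)
      linarith)
  rw [hc4 _ OH.2 _ Of.2]
  refine herr.trans ?_
  have hsq : √(6 * (1 / (98304 * L ^ 2))) = 1 / (128 * L) := by
    rw [show 6 * (1 / (98304 * L ^ 2)) = (1 / (128 * L)) ^ 2 by field_simp; norm_num]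
    exact Real.sqrt_sq (by positivity)
  have e1 : (2 : ℝ) ^ p * (1 / (128 * L)) ≤ ε / 2 := by
    rw [mul_one_div, div_le_iff₀ (by positivity)]
    linarith
  have e2 : t * (d * ω) = ε / 4 := by rw [hω]; field_simp
  -- The segments contribute `ε / 2`, the oracle `ε / 4` and the discretization `3 / 16 * ε`.
  rw [hsq, pow_add]
  change 2 ^ p * (1 / (128 * L)) + (t * (d * ω) + t / (2 ^ n * 2 ^ p) * t *
    ((d * (hmax + ω)) ^ 2 + d * (hmax + ω) * D + rate)) ≤ ε
  rw [e2]
  linarith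

end Main

end SparseSim

/-! ### The main theorem. -/

theorem mainTheorem6 :
    ∃ (C c : ℝ) (P : Polynomial ℕ), 0 < C ∧ 0 < c ∧
      ∀ (N d np : ℕ) (t ε hmax rate unit : ℝ),
        0 < d → d ≤ N → 0 < t → 0 < ε → 0 < hmax → 0 ≤ rate → 0 < unit →
        1 ≤ d * hmax * t → 16 ≤ d * hmax * t / ε →
        ∃ (nt a : ℕ) (circ : SparseSim.Circuit nt N np a),
          (circ.queries : ℝ) ≤
              C * (d * hmax * t *
                (Real.log (d * hmax * t / ε) / Real.log (Real.log (d * hmax * t / ε)))) ∧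
          (circ.qubits : ℝ) ≤
              C * (np + Real.log (N * t / (d * hmax * ε) * (rate + (d * hmax) ^ 2))) ∧
          (circ.primitiveGates : ℝ) ≤
              C * (d * hmax * t * ((P.eval np : ℕ) +
                Real.log (N * t / (d * hmax * ε) * (rate + (d * hmax) ^ 2)) *
                (Real.log (d * hmax * t / ε) / Real.log (Real.log (d * hmax * t / ε))))) ∧
          ∀ (H : ℝ → Matrix (Fin N) (Fin N) ℂ)
            (OH : Matrix.unitaryGroup (SparseSim.HWire nt N np → Bool) ℂ)
            (Of : Matrix.unitaryGroup (SparseSim.FWire nt N → Bool) ℂ),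
            SparseSim.IsSparseHamiltonian d t hmax rate H →
            SparseSim.IsValueOracle nt np unit t (c * ε / (d * t)) H OH.1 →
            SparseSim.IsPositionOracle nt d t H Of.1 →
            ‖circ.implemented OH.1 Of.1 - SparseSim.timeOrderedExp H t‖ ≤ ε ∧
            ∀ ψ : Fin N → ℂ, ∑ x, ‖ψ x‖ ^ 2 = 1 →
              SparseSim.failureProb (circ.implemented OH.1 Of.1) ψ ≤ C * ε := by
  -- Oracle entries precise to `ε / (4 * d * t)` change the evolution by at most `ε / 4`; the
  -- constant `10 ^ 9` dominates every resource bound and the `2` in the failure probability.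
  refine ⟨10 ^ 9, 1 / 4, Polynomial.X ^ 2, by norm_num, by norm_num, ?_⟩
  intro N d np t ε hmax rate unit hd hdN ht hε hm hrate hu hx1 hL16
  suffices hsuff : ∃ (nt a : ℕ) (circ : SparseSim.Circuit nt N np a), (circ.queries : ℝ) ≤ 10 ^ 9 *
      (d * hmax * t *
        (Real.log (d * hmax * t / ε) / Real.log (Real.log (d * hmax * t / ε)))) ∧
      (circ.qubits : ℝ) ≤
        10 ^ 9 * (np + Real.log (N * (t / (d * hmax * ε) * (rate + (d * hmax) ^ 2)))) ∧
      (circ.primitiveGates : ℝ) ≤ 10 ^ 9 * (d * hmax * t * ((np : ℝ) ^ 2 +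
        Real.log (N * (t / (d * hmax * ε) * (rate + (d * hmax) ^ 2))) *
        (Real.log (d * hmax * t / ε) / Real.log (Real.log (d * hmax * t / ε))))) ∧
      ∀ (H : ℝ → Matrix (Fin N) (Fin N) ℂ) (OH : Matrix.unitaryGroup (SparseSim.HWire nt N np → Bool) ℂ)
        (Of : Matrix.unitaryGroup (SparseSim.FWire nt N → Bool) ℂ),
        SparseSim.IsSparseHamiltonian d t hmax rate H →
        SparseSim.IsValueOracle nt np unit t (1 / 4 * ε / (d * t)) H OH.1 →
        SparseSim.IsPositionOracle nt d t H Of.1 →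
        ‖circ.implemented OH.1 Of.1 - SparseSim.timeOrderedExp H t‖ ≤ ε by
    obtain ⟨nt, a, circ, h1, h2, h3, h4⟩ := hsuff
    have e : (N : ℝ) * t / (d * hmax * ε) * (rate + (d * hmax) ^ 2) =
        N * (t / (d * hmax * ε) * (rate + (d * hmax) ^ 2)) := by ring
    rw [e]
    refine ⟨nt, a, circ, h1, h2, ?_, fun H OH Of hH hOH hOf => ?_⟩
    · rw [Polynomial.eval_pow, Polynomial.eval_X]
      push_cast
      exact h3
    · have h5 := h4 H OH Of hH hOH hOf
      refine ⟨h5, fun ψ hψ => ?_⟩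
      have h6 := SparseSim.failureProb_le (hH.timeOrderedExp_isometry ht.le hm.le) h5 hψ
      linarith
  by_cases htriv : 2 ≤ ε ∨ np = 0 ∨ 2 * hmax ≤ unit
  · exact SparseSim.exists_simulation_of_trivial hd hdN ht hε hm hrate hu htriv rfl hx1 rfl hL16 rfl rfl rfl
  · push Not at htriv
    exact SparseSim.exists_simulation hd hdN (Nat.pos_of_ne_zero htriv.2.1) ht hε htriv.1 hm hrate hu
      htriv.2.2 rfl hx1 rfl hL16 rfl rfl rfl
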